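/- Let $\mathbb F_q$ be a finite field with $q$ elements, $\overline{\mathbb F}_q$ an algebraic closure, $\Gamma_q=\mathrm{Gal}(\overline{\mathbb F}_q/\mathbb F_q)$, and $\mathrm{Fr}_q\in\Gamma_q$ the geometric Frobenius (the inverse of $x\mapsto x^q$). **Motive.** Let $G$ be a connected reductive group over $\mathbb F_q$, $S_0$ a maximal $\mathbb F_q$-split torus of $G$, $T_0$ the centralizer of $S_0$ in $G$ (a maximal torus), $W=N_G(T_0)/T_0$ its Weyl group (over $\overline{\mathbb F}_q$), $E=X^*(T_0)\otimes\mathbb Q$, $R=\mathrm{Sym}(E)^W$ and $R_+\subset R$ the ideal of invariants of positive degree. Let $V_d$ be the degree $d$ part of $R_+/R_+^2$, a representation of $\Gamma_q$. The motive of $G$ is $M_G=\bigoplus_{d\ge1}V_d(1-d)$; thus, for $m\ge 1$ and $t\in\mathbb C$, $$\det(1-t\,\mathrm{Fr}_q^m\mid M_G)=\prod_{d\ge1}\det\bigl(1-t\,q^{(d-1)m}\,\mathrm{Fr}_q^m\mid V_d\bigr).$$ **$L$-function.** Let $X$ be a smooth projective curve over $\mathbb F_q$ with function field $k$, and $S$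 a finite set of places of $k$. For a place $v$ put $L_v(M_G,s)=\det(1-q^{-s\deg v}\,\mathrm{Fr}_q^{\deg v}\mid M_G)^{-1}$. Let $L(M_G,s)$ be the meromorphic function on $\mathbb C$ which equals $\prod_vL_v(M_G,s)$ for $\mathrm{Re}\,s\gg0$, and let $L_S(M_G)$ be the value at $s=0$ of the meromorphic function $L(M_G,s)/\prod_{v\in S}L_v(M_G,s)$. **Type.** Let $n\ge1$, let $\gamma\in\mathrm{SL}_n(\mathbb F_q)$ be semisimple, and let $G_\gamma$ be its centralizer in the algebraic group $\mathrm{SL}_n$ over $\mathbb F_q$. If $P_1^{a_1}\cdots P_r^{a_r}$ is the characteristic polynomial of $\gamma$, with distinct monic irreducible $P_i\in\mathbb F_q[x]$ of degree $d_i$, the weighted partition $n=\sum_{i=1}^ra_id_i$ is called the type of $\gamma$. **Proposition.** We have $\det(1-q\,\mathrm{Fr}_q\mid M_{G_\gamma})\neq0$ and $$\frac{\det(1-\mathrm{Fr}_q\mid M_{G_\gamma})}{\det(1-q\,\mathrm{Fr}_q\mid M_{G_\gamma})}=\begin{cases}d\cdot\dfrac{1-q}{1-q^n}&\text{if the type of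 }\gamma\text{ is }n=ad\text{ (i.e. }r=1,\ a_1=a,\ d_1=d),\\[2mm]0&\text{otherwise.}\end{cases}$$ In particular, if $\#S\ge2$, then $L(M_{G_\gamma},s)$ exists and $L_S(M_{G_\gamma})=0$ unless the type of $\gamma$ is of the form $n=ad$. -/

import Mathlib

open scoped TensorProduct Topology

noncomputable section

/-! ### Linear algebraic groups over a finite field

`K` is an algebraic closure of the finite field `F`. A linear algebraic group over `F` is given by
its group of `K`-points in `GL n K`: a Zariski closed subgroup which is stable under
`Gal(K/F)` (over the perfect field `F` this is the same as being defined over `F`). -/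

theorem GL_entry_congr {K : Type*} [Field K] {n : ℕ} {g h : GL (Fin n) K} (e : g = h)
    (i j : Fin n) : g.1 i j = h.1 i j := by
  rw [e]

/-- Zariski closed subsets of `GL n K`. -/
def IsZariskiClosed {K : Type*} [Field K] {n : ℕ} (Z : Set (GL (Fin n) K)) : Prop :=
  ∃ I : Set (MvPolynomial (Fin n × Fin n) K),
    ∀ g : GL (Fin n) K, g ∈ Z ↔ ∀ p ∈ I, MvPolynomial.eval (fun ij => g.1 ij.1 ij.2) p = 0

/-- Connectedness in the Zariski topology. -/
def IsZariskiConnected {K : Type*} [Field K] {n : ℕ} (H : Set (GL (Fin n) K)) : Prop :=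
  H.Nonempty ∧ ∀ Z₁ Z₂ : Set (GL (Fin n) K), IsZariskiClosed Z₁ → IsZariskiClosed Z₂ →
    H ⊆ Z₁ ∪ Z₂ → H ∩ (Z₁ ∩ Z₂) = ∅ → H ⊆ Z₁ ∨ H ⊆ Z₂

theorem IsZariskiClosed.inter {K : Type*} [Field K] {n : ℕ} {Z₁ Z₂ : Set (GL (Fin n) K)}
    (h₁ : IsZariskiClosed Z₁) (h₂ : IsZariskiClosed Z₂) : IsZariskiClosed (Z₁ ∩ Z₂) := by
  obtain ⟨I, hI⟩ := h₁
  obtain ⟨J, hJ⟩ := h₂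
  refine ⟨I ∪ J, fun g => ?_⟩
  rw [Set.mem_inter_iff, hI, hJ]
  constructor
  · rintro ⟨h, h'⟩ p (hp | hp)
    · exact h p hp
    · exact h' p hp
  · exact fun h => ⟨fun p hp => h p (Or.inl hp), fun p hp => h p (Or.inr hp)⟩

theorem isZariskiClosed_centralizer {K : Type*} [Field K] {n : ℕ} (S : Set (GL (Fin n) K)) :
    IsZariskiClosed (Subgroup.centralizer S : Set (GL (Fin n) K)) := by
  refine ⟨{p | ∃ s ∈ S, ∃ i j, p = ∑ k, MvPolynomial.C (s.1 i k) * MvPolynomial.X (k, j)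
    - ∑ k, MvPolynomial.X (i, k) * MvPolynomial.C (s.1 k j)}, fun g => ?_⟩
  rw [SetLike.mem_coe, Subgroup.mem_centralizer_iff]
  constructor
  · rintro h p ⟨s, hs, i, j, rfl⟩
    have := GL_entry_congr (h s hs) i j
    simpa [Matrix.mul_apply, sub_eq_zero] using this
  · intro h s hs
    ext i j
    have := h _ ⟨s, hs, i, j, rfl⟩
    simpa [Matrix.mul_apply, sub_eq_zero] using this

/-- The entrywise action of `Gal(K/F)` on `GL n K`. -/
def galGL {F K : Type*} [Field F] [Field K] [Algebra F K] {n : ℕ} (σ : Gal(K/F)) :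
    GL (Fin n) K →* GL (Fin n) K :=
  Matrix.GeneralLinearGroup.map (σ : K →+* K)

theorem galGL_inv_galGL {F K : Type*} [Field F] [Field K] [Algebra F K] {n : ℕ} (σ : Gal(K/F))
    (g : GL (Fin n) K) : galGL σ⁻¹ (galGL σ g) = g := by
  ext i j
  exact σ.symm_apply_apply _

theorem galGL_galGL_inv {F K : Type*} [Field F] [Field K] [Algebra F K] {n : ℕ} (σ : Gal(K/F))
    (g : GL (Fin n) K) : galGL σ (galGL σ⁻¹ g) = g := by
  ext i j
  exact σ.apply_symm_apply _

/-- Linear algebraic groups over `F`, embedded in `GL n`. -/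
structure LinAlgGroup (F K : Type*) [Field F] [Field K] [Algebra F K] (n : ℕ) where
  points : Subgroup (GL (Fin n) K)
  isClosed : IsZariskiClosed (points : Set (GL (Fin n) K))
  gal_mem : ∀ (σ : Gal(K/F)), ∀ g ∈ points, galGL σ g ∈ points

section Groups

variable {F K : Type*} [Field F] [Field K] [Algebra F K] {n : ℕ}

/-- The centralizer of the subgroup `S` in `G`. -/
def LinAlgGroup.centralizer (G S : LinAlgGroup F K n) : LinAlgGroup F K n where
  points := G.points ⊓ Subgroup.centralizer (S.points : Set (GL (Fin n) K))
  isClosed := G.isClosed.inter (isZariskiClosed_centralizer _)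
  gal_mem σ g hg := by
    refine ⟨G.gal_mem σ g hg.1, ?_⟩
    have h2 := Subgroup.mem_centralizer_iff.1 hg.2
    refine Subgroup.mem_centralizer_iff.2 ?_
    intro s hs
    have := congrArg (galGL σ) (h2 _ (S.gal_mem σ⁻¹ s hs))
    simpa only [map_mul, galGL_galGL_inv] using this

/-- `G_γ`, the centralizer of `γ ∈ SL_n(F)` in the algebraic group `SL_n` over `F`. -/
def slCentralizer (K : Type*) [Field K] [Algebra F K]
    (γ : Matrix.SpecialLinearGroup (Fin n) F) : LinAlgGroup F K n where
  points := (Matrix.SpecialLinearGroup.toGL (n := Fin n) (R := K)).range ⊓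
    Subgroup.centralizer {Matrix.SpecialLinearGroup.mapGL K γ}
  isClosed := by
    refine IsZariskiClosed.inter ?_ (isZariskiClosed_centralizer _)
    refine ⟨{(Matrix.of fun i j => MvPolynomial.X (i, j)).det - 1}, fun g => ?_⟩
    have key : MvPolynomial.eval (fun ij : Fin n × Fin n => g.1 ij.1 ij.2)
        ((Matrix.of fun i j => MvPolynomial.X (i, j)).det - 1) = g.1.det - 1 := by
      rw [map_sub, RingHom.map_det, map_one]
      congr 2
      ext i j
      simp
    simp only [Set.mem_singleton_iff, forall_eq, key, sub_eq_zero]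
    constructor
    · rintro ⟨s, rfl⟩
      exact s.2
    · intro h
      exact ⟨⟨g.1, h⟩, by ext; rfl⟩
  gal_mem σ g hg := by
    obtain ⟨⟨s, rfl⟩, h2⟩ := hg
    refine ⟨⟨Matrix.SpecialLinearGroup.map (σ : K →+* K) s, by ext; rfl⟩, ?_⟩
    replace h2 := Subgroup.mem_centralizer_iff.1 h2
    refine Subgroup.mem_centralizer_iff.2 ?_
    rintro _ rfl
    have hγ : galGL σ (Matrix.SpecialLinearGroup.mapGL K γ)
        = Matrix.SpecialLinearGroup.mapGL K γ := by
      ext i j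
      exact σ.commutes _
    have := congrArg (galGL σ) (h2 _ rfl)
    rwa [map_mul, map_mul, hγ] at this

/-- Split tori over `F`: closed connected groups which are diagonalizable over `F`. -/
def LinAlgGroup.IsSplitTorus (S : LinAlgGroup F K n) : Prop :=
  IsZariskiConnected (S.points : Set (GL (Fin n) K)) ∧
    ∃ g : GL (Fin n) F, ∀ s ∈ S.points,
      (Matrix.GeneralLinearGroup.map (algebraMap F K) g * s *
        (Matrix.GeneralLinearGroup.map (algebraMap F K) g)⁻¹ : GL (Fin n) K).1.IsDiag

/-- `S` is a maximal `F`-split torus of `G`. -/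
def LinAlgGroup.IsMaximalSplitTorus (G S : LinAlgGroup F K n) : Prop :=
  S.points ≤ G.points ∧ S.IsSplitTorus ∧
    ∀ S' : LinAlgGroup F K n, S'.points ≤ G.points → S'.IsSplitTorus →
      S.points ≤ S'.points → S'.points = S.points

/-! ### Characters, and the actions of the Galois group and of the Weyl group -/

/-- Regular functions on a subgroup of `GL n K`: polynomials in the matrix entries of an element
and of its inverse. -/
def IsRegularFun (T : Subgroup (GL (Fin n) K)) (f : T → K) : Prop :=
  ∃ p : MvPolynomial ((Fin n × Fin n) ⊕ (Fin n × Fin n)) K, ∀ t : T,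
    f t = MvPolynomial.eval
      (Sum.elim (fun ij => t.1.1 ij.1 ij.2) (fun ij => (t⁻¹).1.1 ij.1 ij.2)) p

/-- The character group `X^*(T) = Hom(T, G_m)` over `K`. -/
def charGroup (T : Subgroup (GL (Fin n) K)) : Subgroup (T →* Kˣ) where
  carrier := {χ | IsRegularFun T fun t => (χ t : K)}
  mul_mem' := by
    rintro χ ψ ⟨p, hp⟩ ⟨r, hr⟩
    exact ⟨p * r, fun t => by rw [map_mul, ← hp, ← hr]; rfl⟩
  one_mem' := ⟨1, fun t => by simp⟩
  inv_mem' := by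
    rintro χ ⟨p, hp⟩
    refine ⟨MvPolynomial.rename Sum.swap p, fun t => ?_⟩
    rw [MvPolynomial.eval_rename]
    have h : ((χ⁻¹ t : Kˣ) : K) = _ := (congrArg Units.val (map_inv χ t).symm).trans (hp t⁻¹)
    refine h.trans ?_
    congr 2
    funext x
    rcases x with x | x <;> simp

/-- The action of `σ ∈ Gal(K/F)` on the points of an algebraic group over `F`. -/
def LinAlgGroup.galPoints (T : LinAlgGroup F K n) (σ : Gal(K/F)) : T.points →* T.points :=
  ((galGL σ).comp T.points.subtype).codRestrict T.points fun t => T.gal_mem σ t.1 t.2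

/-- The Galois action on characters, `(σχ)(t) = σ(χ(σ⁻¹ t))`. -/
def galChar (T : LinAlgGroup F K n) (σ : Gal(K/F)) : charGroup T.points →* charGroup T.points :=
  MonoidHom.codRestrict
    { toFun := fun χ => (Units.map (σ : K →* K)).comp (χ.1.comp (T.galPoints σ⁻¹))
      map_one' := by ext; simp
      map_mul' := fun χ ψ => by ext; simp }
    (charGroup T.points) (by
      rintro ⟨χ, p, hp⟩
      refine ⟨MvPolynomial.map (σ : K →+* K) p, fun t => ?_⟩
      have h := congrArg (σ : K →+* K) (hp (T.galPoints σ⁻¹ t))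
      rw [MvPolynomial.map_eval] at h
      refine h.trans ?_
      congr 2
      funext x
      rcases x with x | x
      · exact GL_entry_congr (galGL_galGL_inv σ t.1) x.1 x.2
      · have h3 : galGL σ ((T.galPoints σ⁻¹ t)⁻¹ : T.points).1 = (t⁻¹ : T.points).1 := by
          rw [← map_inv]
          exact galGL_galGL_inv σ _
        exact GL_entry_congr h3 x.1 x.2)

/-- The normalizer `N_G(T)`. -/
def normalizerIn (G T : LinAlgGroup F K n) : Subgroup (GL (Fin n) K) :=
  G.points ⊓ Subgroup.normalizer (T.points : Set (GL (Fin n) K))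

/-- Conjugation `t ↦ w⁻¹ t w` on `T` for `w` in the normalizer of `T`. -/
def conjPoints (G T : LinAlgGroup F K n) (w : normalizerIn G T) : T.points →* T.points :=
  ((MulAut.conj (w.1)⁻¹).toMonoidHom.comp T.points.subtype).codRestrict T.points fun t => by
    have := (Subgroup.mem_normalizer_iff''.1 w.2.2 t.1).1 t.2
    simpa using this

/-- The action of `w ∈ N_G(T)` on characters, `(wχ)(t) = χ(w⁻¹ t w)`. It factors through the
Weyl group `N_G(T)/T` if `T` is a maximal torus, since `T` then acts trivially. -/
def weylChar (G T : LinAlgGroup F K n) (w : normalizerIn G T) :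
    charGroup T.points →* charGroup T.points :=
  MonoidHom.codRestrict
    { toFun := fun χ => χ.1.comp (conjPoints G T w)
      map_one' := by ext; simp
      map_mul' := fun χ ψ => by ext; simp }
    (charGroup T.points) (by
      rintro ⟨χ, p, hp⟩
      let c : (Fin n × Fin n → MvPolynomial ((Fin n × Fin n) ⊕ (Fin n × Fin n)) K) →
          Fin n × Fin n → MvPolynomial ((Fin n × Fin n) ⊕ (Fin n × Fin n)) K :=
        fun v ij => ∑ k, (∑ l, MvPolynomial.C ((w.1⁻¹ : GL (Fin n) K).1 ij.1 l) * v (l, k)) *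
          MvPolynomial.C (w.1.1 k ij.2)
      refine ⟨MvPolynomial.bind₁ (Sum.elim (c fun ij => MvPolynomial.X (Sum.inl ij))
        (c fun ij => MvPolynomial.X (Sum.inr ij))) p, fun t => ?_⟩
      rw [← MvPolynomial.aeval_eq_eval, MvPolynomial.aeval_bind₁]
      refine (hp (conjPoints G T w t)).trans ?_
      rw [← MvPolynomial.aeval_eq_eval]
      congr 2
      funext x
      have e : ∀ u : T.points, (conjPoints G T w u).1 = w.1⁻¹ * u.1 * w.1 := fun u => by
        simp [conjPoints]
      rcases x with x | x
      · simp only [Sum.elim_inl, c, e]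
        simp [Matrix.mul_apply]
      · simp only [Sum.elim_inr, c, ← map_inv, e]
        simp [Matrix.mul_apply])

end Groups

/-! ### Primitive invariants -/

section Primitive

variable {E : Type*} [AddCommGroup E] [Module ℚ E]

/-- The algebra map `Sym(E) → Sym(E)` induced by a linear map. -/
def symMap (f : E →ₗ[ℚ] E) : SymmetricAlgebra ℚ E →ₐ[ℚ] SymmetricAlgebra ℚ E :=
  SymmetricAlgebra.lift (SymmetricAlgebra.ι ℚ E ∘ₗ f)

/-- The homogeneous part of degree `d` of the algebra of invariants `R = Sym(E)^W`. Here
`Sym^d(E)` is the span of the `d`-fold products of elements of `E`. -/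
def invariantsDeg (W : Set (E →ₗ[ℚ] E)) (d : ℕ) : Submodule ℚ (SymmetricAlgebra ℚ E) where
  carrier := {x | x ∈ (LinearMap.range (SymmetricAlgebra.ι ℚ E)) ^ d ∧
    ∀ w ∈ W, symMap w x = x}
  add_mem' := fun ⟨h, h'⟩ ⟨k, k'⟩ =>
    ⟨add_mem h k, fun w hw => by rw [map_add, h' w hw, k' w hw]⟩
  zero_mem' := ⟨zero_mem _, fun w _ => map_zero _⟩
  smul_mem' := fun c _ ⟨h, h'⟩ =>
    ⟨Submodule.smul_mem _ c h, fun w hw => by rw [map_smul, h' w hw]⟩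

/-- The homogeneous part of degree `d` of `(R_+)²`, where `R_+` is the ideal of
invariants of positive degree. -/
def decomposablesDeg (W : Set (E →ₗ[ℚ] E)) (d : ℕ) : Submodule ℚ (SymmetricAlgebra ℚ E) :=
  ⨆ ij : {ij : ℕ × ℕ // 1 ≤ ij.1 ∧ 1 ≤ ij.2 ∧ ij.1 + ij.2 = d},
    invariantsDeg W ij.1.1 * invariantsDeg W ij.1.2

/-- The space `V_d` of primitive invariants: the part of degree `d` of `R_+ / (R_+)²`
(for `1 ≤ d`). -/
abbrev primitives (W : Set (E →ₗ[ℚ] E)) (d : ℕ) : Type _ :=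
  invariantsDeg W d ⧸ (decomposablesDeg W d).comap (invariantsDeg W d).subtype

/-- `f` normalizes `W`, in the form in which it is needed to preserve the invariants. -/
def Normalizes (W : Set (E →ₗ[ℚ] E)) (f : E →ₗ[ℚ] E) : Prop :=
  ∀ w ∈ W, ∃ w' ∈ W, w ∘ₗ f = f ∘ₗ w'

theorem symMap_comp (f g : E →ₗ[ℚ] E) : symMap (f ∘ₗ g) = (symMap f).comp (symMap g) := by
  apply SymmetricAlgebra.algHom_ext
  ext x
  simp [symMap]

theorem symMap_mem_invariantsDeg {W : Set (E →ₗ[ℚ] E)} {f : E →ₗ[ℚ] E} (hf : Normalizes W f)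
    {d : ℕ} : ∀ x ∈ invariantsDeg W d, (symMap f).toLinearMap x ∈ invariantsDeg W d := by
  rintro x ⟨h, h'⟩
  constructor
  · have hle : (LinearMap.range (SymmetricAlgebra.ι ℚ E)).map (symMap f).toLinearMap
        ≤ LinearMap.range (SymmetricAlgebra.ι ℚ E) := by
      rintro _ ⟨_, ⟨y, rfl⟩, rfl⟩
      exact ⟨f y, by simp [symMap]⟩
    have h1 := Submodule.mem_map_of_mem (f := (symMap f).toLinearMap) h
    rw [Submodule.map_pow] at h1
    exact pow_le_pow_left' hle d h1
  · intro w hw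
    obtain ⟨w', hw', e⟩ := hf w hw
    have h1 := DFunLike.congr_fun (congrArg symMap e) x
    rw [symMap_comp, symMap_comp] at h1
    simpa [h' w' hw'] using h1

theorem symMap_mem_decomposablesDeg {W : Set (E →ₗ[ℚ] E)} {f : E →ₗ[ℚ] E} (hf : Normalizes W f)
    {d : ℕ} : ∀ x ∈ decomposablesDeg W d, (symMap f).toLinearMap x ∈ decomposablesDeg W d := by
  suffices h : decomposablesDeg W d ≤ (decomposablesDeg W d).comap (symMap f).toLinearMap from h
  refine iSup_le fun ij => ?_
  rw [Submodule.mul_le]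
  intro x hx y hy
  have h1 := Submodule.mul_mem_mul (symMap_mem_invariantsDeg hf x hx)
    (symMap_mem_invariantsDeg hf y hy)
  have h2 : (symMap f).toLinearMap (x * y)
      = (symMap f).toLinearMap x * (symMap f).toLinearMap y := map_mul (symMap f) x y
  rw [Submodule.mem_comap, h2]
  exact Submodule.mem_iSup_of_mem ij h1

/-- The endomorphism of `V_d` induced by a linear map which normalizes `W`. -/
def primitivesMap (W : Set (E →ₗ[ℚ] E)) (f : E →ₗ[ℚ] E) (hf : Normalizes W f) (d : ℕ) :
    primitives W d →ₗ[ℚ] primitives W d :=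
  Submodule.mapQ _ _ ((symMap f).toLinearMap.restrict (symMap_mem_invariantsDeg hf))
    (fun x hx => symMap_mem_decomposablesDeg hf x.1 hx)

end Primitive

/-! ### The motive of a group -/

section Motive

variable {F K : Type*} [Field F] [Field K] [Algebra F K] {n : ℕ}

/-- `E = X^*(T) ⊗ ℚ`. -/
abbrev ratChar (T : LinAlgGroup F K n) : Type _ := ℚ ⊗[ℤ] Additive (charGroup T.points)

/-- The linear map on `X^*(T) ⊗ ℚ` induced by an endomorphism of `X^*(T)`. -/
def ratMap (T : LinAlgGroup F K n) (f : charGroup T.points →* charGroup T.points) :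
    ratChar T →ₗ[ℚ] ratChar T :=
  (MonoidHom.toAdditive f).toIntLinearMap.baseChange ℚ

theorem ratMap_comp (T : LinAlgGroup F K n) (f g : charGroup T.points →* charGroup T.points) :
    ratMap T (f.comp g) = ratMap T f ∘ₗ ratMap T g := by
  unfold ratMap
  rw [← LinearMap.baseChange_comp]
  rfl

/-- The action of the Weyl group `N_G(T)/T` on `X^*(T) ⊗ ℚ`, as a set of linear maps. -/
def weylSet (G T : LinAlgGroup F K n) : Set (ratChar T →ₗ[ℚ] ratChar T) :=
  Set.range fun w : normalizerIn G T => ratMap T (weylChar G T w)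

theorem galGL_mem_normalizerIn (G T : LinAlgGroup F K n) (σ : Gal(K/F)) (w : normalizerIn G T) :
    galGL σ w.1 ∈ normalizerIn G T := by
  refine ⟨G.gal_mem σ _ w.2.1, ?_⟩
  refine Subgroup.mem_normalizer_iff.2 fun h => ?_
  have hw := Subgroup.mem_normalizer_iff.1 w.2.2
  constructor
  · intro hh
    have h1 := T.gal_mem σ _ ((hw _).1 (T.gal_mem σ⁻¹ h hh))
    simpa only [map_mul, map_inv, galGL_galGL_inv] using h1
  · intro hh
    have h1 := T.gal_mem σ⁻¹ _ hh
    simp only [map_mul, map_inv, galGL_inv_galGL] at h1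
    have h2 := T.gal_mem σ _ ((hw _).2 h1)
    rwa [galGL_galGL_inv] at h2

theorem normalizes_galChar (G T : LinAlgGroup F K n) (σ : Gal(K/F)) :
    Normalizes (weylSet G T) (ratMap T (galChar T σ)) := by
  rintro _ ⟨w, rfl⟩
  refine ⟨_, ⟨⟨galGL σ⁻¹ w.1, galGL_mem_normalizerIn G T σ⁻¹ w⟩, rfl⟩, ?_⟩
  dsimp only
  rw [← ratMap_comp, ← ratMap_comp]
  congr 1
  ext χ t
  have e : T.galPoints σ⁻¹ (conjPoints G T w t)
      = conjPoints G T ⟨galGL σ⁻¹ w.1, galGL_mem_normalizerIn G T σ⁻¹ w⟩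
        (T.galPoints σ⁻¹ t) := by
    apply Subtype.ext
    have h1 : (conjPoints G T w t).1 = w.1⁻¹ * t.1 * w.1 := by simp [conjPoints]
    have h2 : ∀ u : T.points, (T.galPoints σ⁻¹ u).1 = galGL σ⁻¹ u.1 := fun u => rfl
    rw [h2, h1]
    simp [conjPoints, h2]
  exact congrArg (fun u => σ (χ.1 u : K)) e

/-- The graded piece `V_d` of the graded Galois representation attached to a group `G`
and its torus `T`. -/
abbrev motivePiece (G T : LinAlgGroup F K n) (d : ℕ) : Type _ := primitives (weylSet G T) d

/-- The action of `σ ∈ Gal(K/F)` on `V_d`. -/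
def motiveAct (G T : LinAlgGroup F K n) (σ : Gal(K/F)) (d : ℕ) :
    motivePiece G T d →ₗ[ℚ] motivePiece G T d :=
  primitivesMap (weylSet G T) (ratMap T (galChar T σ)) (normalizes_galChar G T σ) d

/-- The geometric Frobenius `Fr_q`, the inverse of `x ↦ x ^ q`. -/
def geomFrob (F K : Type*) [Field F] [Fintype F] [Field K] [Algebra F K]
    [Algebra.IsAlgebraic F K] : Gal(K/F) :=
  (FiniteField.frobeniusAlgEquivOfAlgebraic F K)⁻¹

/-- `det(1 - t Fr_q^m | M_G)` for `M_G = ⨁_{d ≥ 1} V_d(1-d)`, where `V_d` is formed with the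
centralizer `T₀` of the maximal split torus `S₀` of `G`. The Frobenius
`Fr_q^m` acts on `ℚ(1-d)` as `q ^ ((d-1)m)`; the index of the product is `d - 1`. -/
def motiveDet [Fintype F] [Algebra.IsAlgebraic F K] (G S₀ : LinAlgGroup F K n) (m : ℕ) (t : ℂ) :
    ℂ :=
  ∏ᶠ e : ℕ, LinearMap.det
    ((1 : Module.End ℂ (ℂ ⊗[ℚ] motivePiece G (G.centralizer S₀) (e + 1))) -
      (t * (Fintype.card F : ℂ) ^ (e * m)) •
        (motiveAct G (G.centralizer S₀) (geomFrob F K ^ m) (e + 1)).baseChange ℂ)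

end Motive

/-! ### Places and `L`-functions -/

/-- The places of the function field `k` over `F`, i.e. the closed points of the corresponding
smooth projective curve: the valuation rings `F ⊆ O ⊊ k`. -/
structure Place (F k : Type*) [Field F] [Field k] [Algebra F k] where
  ring : ValuationSubring k
  algebraMap_mem : ∀ x : F, algebraMap F k x ∈ ring
  ne_top : ring ≠ ⊤

/-- The inclusion of the constants in the residue field at a place. -/
def Place.toResidueField {F k : Type*} [Field F] [Field k] [Algebra F k] (v : Place F k) :
    F →+* IsLocalRing.ResidueField v.ring :=
  (IsLocalRing.residue v.ring).comp
    ((algebraMap F k).codRestrict v.ring.toSubring v.algebraMap_mem)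

/-- The degree of a place, `[κ_v : F]`. -/
def Place.deg {F k : Type*} [Field F] [Field k] [Algebra F k] (v : Place F k) : ℕ :=
  letI := v.toResidueField.toAlgebra
  Module.finrank F (IsLocalRing.ResidueField v.ring)

section LFunction

variable {F K k : Type*} [Field F] [Fintype F] [Field K] [Algebra F K] [Algebra.IsAlgebraic F K]
  [Field k] [Algebra F k] {n : ℕ}

/-- The local `L`-function `L_v(M_G, s) = det(1 - q^{-s deg v} Fr_v | M_G)⁻¹` with
`Fr_v = Fr_q^{deg v}`. -/
def localL (G S₀ : LinAlgGroup F K n) (v : Place F k) (s : ℂ) : ℂ :=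
  (motiveDet G S₀ v.deg ((Fintype.card F : ℂ) ^ (-s * (v.deg : ℂ))))⁻¹

/-- `L` is the global `L`-function `L(M_G, s)`: a meromorphic function on `ℂ` which is given by
the Euler product over all places of `k` if `Re s` is large. -/
def IsGlobalL (k : Type*) [Field k] [Algebra F k] (G S₀ : LinAlgGroup F K n) (L : ℂ → ℂ) :
    Prop :=
  Meromorphic L ∧ ∃ σ : ℝ, ∀ s : ℂ, σ < s.re → HasProd (fun v : Place F k => localL G S₀ v s) (L s)

/-- `L_{S,T}(M_G) = c`: the meromorphic function
`L(M_G, s) / (∏_{v ∈ S} L_v(M_G, s) * ∏_{v ∈ T} L_v(M_G, s - 1))` exists and has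
no pole and the value `c` at `s = 0`. (The value of a meromorphic function is taken as a limit over
`s ≠ 0`, since the quotient of the values at `s = 0` may be of the form `∞ / ∞`.) -/
def HasModifiedLValue (G S₀ : LinAlgGroup F K n) (S T : Finset (Place F k)) (c : ℂ) : Prop :=
  ∃ L : ℂ → ℂ, IsGlobalL k G S₀ L ∧
    Filter.Tendsto
      (fun s => L s / ((∏ v ∈ S, localL G S₀ v s) * ∏ v ∈ T, localL G S₀ v (s - 1)))
      (𝓝[≠] 0) (𝓝 c)

end LFunction

/-! ### The type of an element of `SL_n(F)` -/

open Classical in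
/-- The type of `γ`: if `P₁ ^ a₁ ⋯ P_r ^ a_r` is the characteristic polynomial, with distinct monic
irreducible `P_i` of degree `d_i`, the weighted partition `n = ∑ a_i d_i`, as the multiset of the
pairs `(a_i, d_i)`. -/
def slType {F : Type*} [Field F] {n : ℕ} (γ : Matrix.SpecialLinearGroup (Fin n) F) :
    Multiset (ℕ × ℕ) :=
  let P := UniqueFactorizationMonoid.normalizedFactors γ.1.charpoly
  P.toFinset.val.map fun p => (P.count p, p.natDegree)

end

/-! Group side. Over `K` the semisimple `γ` is diagonal in a basis of linear forms on `F ^ n`. The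
basis can be chosen so that it is permuted by the Galois group and so that it also diagonalizes the
centralizer `T₀` of a maximal split torus of `G_γ`; then `T₀` becomes the full group of diagonal
matrices of determinant one (`IsAdapted.isDiagonalizing`). So `E = X^*(T₀) ⊗ ℚ` is spanned by the
`n` diagonal entries with the single relation that their sum is zero. The Weyl group acts through
the permutations that preserve the eigenvalues of `γ`, a Young subgroup, and Galois permutes the
entries compatibly with its action on the eigenvalues (`IsDiagonalizing.isYoungAction`,
`IsDiagonalizing.exists_perm_vec`).

Invariant theory. For `d ≥ 2` the classes of the power sums of degree `d`, one for each eigenvalue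
of multiplicity at least `d`, form a basis of `V_d` after extension of scalars to `ℂ`. They span by
an induction on monomials (`orbitSum_mem_sup`) together with Newton's identities
(`blockSum_mem_decomposablesDeg`). They are independent by evaluation at the `d`-th roots of unity,
a point fixed up to a scalar by a cyclic permutation (`exists_eval_primitiveSum`). In degree one the
sum of all of them vanishes, and that is the only relation. Frobenius permutes the eigenvalues in
cycles, one of length `d_i` for each irreducible factor `P_i`. Hence the eigenvalues of Frobenius on
the motive, with one extra eigenvalue `1`, are the numbers `q ^ e * ζ` with `ζ ^ d_i = 1` and `e <
a_i` (`IsYoungAction.finprod_primitivesDet`).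

Special values. At `t = q` every `t * λ`, with `λ` an eigenvalue, has absolute value greater than
`1`, so no factor vanishes. At `t = 1` each `P_i` contributes one eigenvalue `1` and only one of
these is removed, so a second factor makes the determinant zero. With a single factor of degree `d`
and multiplicity `a`, removing the eigenvalue `1` leaves `(1 - t ^ d) / (1 - t)`, which is `d` at `t
= 1`; the remaining products at `t = 1` and `t = q` telescope to `d (1 - q) / (1 - q ^ n)`.

L-function. It is the product over the eigenvalues `λ` of `Z (q ^ (-s) * λ)`, with `Z` the zeta
function of `k`. Riemann's theorem counts effective divisors of large degree and gives `Z` as a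
rational function with denominators `1 - (q T) ^ δ` and `1 - T ^ δ`, where `δ` divides all degrees
(`exists_zeta`). At `s = 0` the arguments satisfy `1 ≤ |λ|`, so only `1 - T ^ δ` can give a pole,
and it is simple. Each of the two or more Euler factors removed at `S` vanishes there, so every `λ`
contributes a finite factor, and the surviving eigenvalue `1` contributes zero
(`continuousAt_zeta_mul_prod`). -/

set_option linter.unusedSectionVars false

noncomputable section

/-! ### Fields of transcendence degree one -/

open scoped IntermediateField

/-- `k` is finitely generated of transcendence degree one over `F`. -/
class IsOneVariable (F k : Type*) [Field F] [Field k] [Algebra F k] : Prop where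
  exists_transcendental : ∃ y : k, Transcendental F y
  finite (y : k) : Transcendental F y → FiniteDimensional F⟮y⟯ k

section OneVariable

open scoped IntermediateField.algebraAdjoinAdjoin

variable {F k : Type*} [Field F] [Field k] [Algebra F k]

/-- The transcendence degree is at most one, so `y` is already a transcendence basis and `k` is
algebraic over `F⟮y⟯`. It is also finitely generated as a field, hence finite. -/
theorem finiteDimensional_adjoin_of_transcendental {x y : k}
    [FiniteDimensional F⟮x⟯ k] (hy : Transcendental F y) : FiniteDimensional F⟮y⟯ k := by
  have htx : Algebra.IsAlgebraic (Algebra.adjoin F {x}) k :=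
    (IsFractionRing.comap_isAlgebraic_iff (A := Algebra.adjoin F {x}) (K := F⟮x⟯)).2 inferInstance
  have hle : Algebra.trdeg F k ≤ 1 := by
    have := Algebra.IsAlgebraic.trdeg_le_cardinalMk (R := F) (A := k) {x}
    simpa using this
  have hty : IsTranscendenceBasis F (fun _ : Unit => y) := by
    apply AlgebraicIndependent.isTranscendenceBasis_of_lift_trdeg_le_of_finite
    · rwa [algebraicIndependent_unique_type_iff]
    · simpa using hle
  have hay : Algebra.IsAlgebraic F⟮y⟯ k := by
    have := hty.isAlgebraic_field
    rwa [Set.range_const] at this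
  have h1 : Algebra.EssFiniteType F F⟮x⟯ :=
    IntermediateField.essFiniteType_iff.2 ⟨{x}, by simp⟩
  have h2 : Algebra.EssFiniteType F k := Algebra.EssFiniteType.comp F F⟮x⟯ k
  have h3 : Algebra.EssFiniteType F⟮y⟯ k := Algebra.EssFiniteType.of_comp F F⟮y⟯ k
  obtain ⟨s, hs⟩ := IntermediateField.fg_top_iff.2 h3
  have hfd : FiniteDimensional F⟮y⟯ (IntermediateField.adjoin F⟮y⟯ (s : Set k)) :=
    IntermediateField.finiteDimensional_adjoin fun z _ => (hay.isAlgebraic z).isIntegral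
  rw [hs] at hfd
  exact LinearEquiv.finiteDimensional (IntermediateField.topEquiv (F := F⟮y⟯) (E := k)).toLinearEquiv

theorem FunctionField.isOneVariable [Algebra (RatFunc F) k] [IsScalarTower F (RatFunc F) k]
    [FunctionField F k] : IsOneVariable F k := by
  set x : k := algebraMap (RatFunc F) k RatFunc.X with hx
  have htx : Transcendental F x := by
    rw [hx, transcendental_algebraMap_iff (algebraMap (RatFunc F) k).injective]
    exact RatFunc.transcendental_X
  have hfd : FiniteDimensional F⟮x⟯ k := by
    let φ : RatFunc F →ₐ[F] k := IsScalarTower.toAlgHom F (RatFunc F) k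
    have hr : ∀ r : RatFunc F, φ r ∈ F⟮x⟯ := by
      have : (⊤ : IntermediateField F (RatFunc F)) ≤ (F⟮x⟯).comap φ := by
        rw [← RatFunc.adjoin_X, IntermediateField.adjoin_simple_le_iff]
        exact IntermediateField.mem_adjoin_simple_self F x
      exact fun r => this trivial
    let b := Module.finBasis (RatFunc F) k
    refine ⟨Submodule.fg_def.2 ⟨Set.range b, Set.finite_range b, ?_⟩⟩
    rw [eq_top_iff]
    intro z _
    rw [← b.sum_repr z]
    refine sum_mem fun i _ => ?_
    have e : b.repr z i • b i = (⟨φ (b.repr z i), hr _⟩ : F⟮x⟯) • b i := by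
      rw [Algebra.smul_def]; rfl
    rw [e]
    exact Submodule.smul_mem _ _ (Submodule.subset_span (by simp))
  exact ⟨⟨x, htx⟩, fun y hy => finiteDimensional_adjoin_of_transcendental (x := x) hy⟩

theorem aeval_mem_of_mem (O : Subalgebra F k) {y : k} (hy : y ∈ O) (p : Polynomial F) :
    Polynomial.aeval y p ∈ O :=
  Algebra.adjoin_le (Set.singleton_subset_iff.2 hy) (Polynomial.aeval_mem_adjoin_singleton F y)

/-- Elements of an algebra `O` which are linearly independent modulo a transcendental element `y`
are linearly independent over `F(y)`. -/
theorem linearIndependent_adjoin_of_quotient (O : Subalgebra F k) {y : k} (hyO : y ∈ O)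
    (hy : Transcendental F y) {ι : Type*} [Finite ι] (u : ι → k) (hu : ∀ i, u i ∈ O)
    (h : ∀ c : ι → F, (∃ z ∈ O, ∑ᶠ i, c i • u i = y * z) → c = 0) :
    LinearIndependent F⟮y⟯ u := by
  classical
  have := Fintype.ofFinite ι
  rw [← LinearIndependent.iff_fractionRing (R := Algebra.adjoin F {y})]
  -- After clearing denominators a relation has coefficients that are polynomials in `y`. Modulo `y`
  -- only the constant terms remain, and these vanish by hypothesis; dividing by `y` lowers the
  -- degree bound `N`.
  have key : ∀ (N : ℕ) (p : ι → Polynomial F), (∀ i m, N ≤ m → (p i).coeff m = 0) →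
      ∑ i, Polynomial.aeval y (p i) * u i = 0 → p = 0 := by
    intro N
    induction N with
    | zero =>
      intro p hp _
      funext i
      exact Polynomial.ext fun m => hp i m (Nat.zero_le m)
    | succ N ih =>
      intro p hp hs
      have h0 : (fun i => (p i).coeff 0) = 0 := by
        refine h _ ⟨-∑ i, Polynomial.aeval y (p i).divX * u i, ?_, ?_⟩
        · refine neg_mem (sum_mem fun i _ => mul_mem ?_ (hu i))
          exact aeval_mem_of_mem O hyO _
        · rw [finsum_eq_sum_of_fintype]
          have : ∀ i, Polynomial.aeval y (p i) * u i
              = y * (Polynomial.aeval y (p i).divX * u i) + (p i).coeff 0 • u i := by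
            intro i
            conv_lhs => rw [← Polynomial.divX_mul_X_add (p i)]
            simp [Algebra.smul_def]
            ring
          rw [Finset.sum_congr rfl fun i _ => this i, Finset.sum_add_distrib,
            ← Finset.mul_sum] at hs
          linear_combination hs
      have hX : ∀ i, p i = (p i).divX * Polynomial.X := by
        intro i
        conv_lhs => rw [← Polynomial.divX_mul_X_add (p i)]
        have := congrFun h0 i
        simp only [Pi.zero_apply] at this
        simp [this]
      have hd : (fun i => (p i).divX) = 0 := by
        refine ih _ (fun i m hm => ?_) ?_
        · rw [Polynomial.coeff_divX]
          exact hp i (m + 1) (Nat.succ_le_succ hm)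
        · have hy0 : y ≠ 0 := by
            rintro rfl
            exact hy isAlgebraic_zero
          have : y * ∑ i, Polynomial.aeval y (p i).divX * u i = 0 := by
            rw [← hs, Finset.mul_sum]
            refine Finset.sum_congr rfl fun i _ => ?_
            conv_rhs => rw [hX i]
            simp
            ring
          exact (mul_eq_zero.1 this).resolve_left hy0
      funext i
      rw [hX i, show (p i).divX = 0 from congrFun hd i]
      simp
  rw [Fintype.linearIndependent_iff]
  intro g hg i
  have hmem : ∀ i, ∃ p : Polynomial F, Polynomial.aeval y p = (g i : k) := by
    intro i
    have := (g i).2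
    simpa only [Algebra.adjoin_singleton_eq_range_aeval, AlgHom.mem_range] using this
  choose p hp using hmem
  obtain ⟨N, hN⟩ : ∃ N : ℕ, ∀ i m, N ≤ m → (p i).coeff m = 0 := by
    refine ⟨(Finset.univ.sup fun i => (p i).natDegree) + 1, fun i m hm => ?_⟩
    refine Polynomial.coeff_eq_zero_of_natDegree_lt (lt_of_lt_of_le (Nat.lt_succ_of_le ?_) hm)
    exact Finset.le_sup (f := fun i => (p i).natDegree) (Finset.mem_univ i)
  have := key N p hN (by
    rw [← hg]
    refine Finset.sum_congr rfl fun i _ => ?_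
    rw [hp i, Algebra.smul_def]; rfl)
  apply Subtype.ext
  rw [← hp i, this]
  simp

end OneVariable
end

noncomputable section

/-! ### Places are discrete valuations with finite residue fields -/

open scoped IntermediateField WithZero

namespace Place

variable {F k : Type*} [Field F] [Field k] [Algebra F k]

theorem ext_of_ring {v w : Place F k} (h : v.ring = w.ring) : v = w := by
  cases v; cases w; cases h; rfl

/-- The valuation ring as a subalgebra. -/
def toSubalgebra (v : Place F k) : Subalgebra F k :=
  { v.ring.toSubring with algebraMap_mem' := v.algebraMap_mem }

theorem mem_toSubalgebra {v : Place F k} {x : k} : x ∈ v.toSubalgebra ↔ x ∈ v.ring := Iff.rfl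

/-- If `y⁻¹` is in the valuation ring, then so is `y`, because `y` is a polynomial in the algebraic
element `y⁻¹`. -/
theorem mem_of_isAlgebraic (v : Place F k) {y : k} (hy : IsAlgebraic F y) : y ∈ v.ring := by
  rcases v.ring.mem_or_inv_mem y with h | h
  · exact h
  · have h1 := hy.inv.isIntegral.inv_mem_adjoin
    rw [inv_inv] at h1
    exact Algebra.adjoin_le (S := v.toSubalgebra) (Set.singleton_subset_iff.2 h) h1

theorem transcendental_of_mem_nonunits (v : Place F k) {y : k} (hy : y ∈ v.ring.nonunits)
    (h0 : y ≠ 0) : Transcendental F y := fun h =>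
  ((v.ring.mem_nonunits_iff_or).1 hy).resolve_left h0 |>.elim <| v.mem_of_isAlgebraic h.inv

theorem exists_mem_nonunits (v : Place F k) : ∃ y ∈ v.ring.nonunits, y ≠ 0 := by
  obtain ⟨x, hx⟩ : ∃ x, x ∉ v.ring := by
    by_contra! h
    exact v.ne_top (eq_top_iff.2 fun x _ => h x)
  refine ⟨x⁻¹, v.ring.inv_mem_nonunits_iff.2 (Or.inr hx), inv_ne_zero ?_⟩
  rintro rfl
  exact hx (zero_mem v.ring)

theorem algebraMap_notMem_nonunits (v : Place F k) {c : F} (hc : c ≠ 0) :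
    algebraMap F k c ∉ v.ring.nonunits := fun h =>
  v.transcendental_of_mem_nonunits h (by simpa using hc) (isAlgebraic_algebraMap c)

theorem sum_mem_nonunits (v : Place F k) {ι : Type*} (s : Finset ι) (f : ι → k)
    (h : ∀ i ∈ s, f i ∈ v.ring.nonunits) : ∑ i ∈ s, f i ∈ v.ring.nonunits :=
  sum_mem h

theorem mul_mem_nonunits (v : Place F k) {a b : k} (ha : a ∈ v.ring) (hb : b ∈ v.ring.nonunits) :
    a * b ∈ v.ring.nonunits := by
  rw [ValuationSubring.mem_nonunits_iff] at *
  rw [← v.ring.valuation_le_one_iff] at ha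
  rw [map_mul]
  exact (mul_le_of_le_one_left' ha).trans_lt hb

variable [IsOneVariable F k]

/-- Elements of strictly increasing order, all below the order of `y`, are independent modulo `y`:
dividing a relation by its term of lowest order would make a nonzero constant a nonunit. This bounds
the length of divisor chains and makes the valuation discrete. -/
theorem card_chain_le (v : Place F k) {y : k} (hy : y ∈ v.ring.nonunits) (h0 : y ≠ 0) (N : ℕ)
    (z : ℕ → k) (hz : ∀ i < N, z i ∈ v.ring) (hz0 : ∀ i < N, z i ≠ 0)
    (hlt : ∀ i j, i < j → j < N → z j / z i ∈ v.ring.nonunits)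
    (hyz : ∀ i < N, y / z i ∈ v.ring.nonunits) : N ≤ Module.finrank F⟮y⟯ k := by
  have hty := v.transcendental_of_mem_nonunits hy h0
  have := IsOneVariable.finite y hty
  have hli := linearIndependent_adjoin_of_quotient v.toSubalgebra
    (y := y) (v.ring.nonunits_le hy) hty (fun i : Fin N => z i) (fun i => hz i i.2) (by
      rintro c ⟨w, hw, e⟩
      by_contra hc
      rw [finsum_eq_sum_of_fintype] at e
      obtain ⟨i, hi⟩ := Function.ne_iff.1 hc
      simp only [Pi.zero_apply] at hi
      classical
      have hne : (Finset.univ.filter fun i => c i ≠ 0).Nonempty := ⟨i, by simpa using hi⟩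
      obtain ⟨m, hm, hmin⟩ := Finset.exists_min_image _ id hne
      simp only [Finset.mem_filter, Finset.mem_univ, true_and, id] at hm hmin
      have hzm := hz0 m m.2
      have e2 : algebraMap F k (c m)
          = w * (y / z m) + ∑ j ∈ Finset.univ.erase m, -(algebraMap F k (c j) * (z j / z m)) := by
        rw [← Finset.add_sum_erase _ _ (Finset.mem_univ m)] at e
        rw [Finset.sum_neg_distrib]
        simp only [Algebra.smul_def] at e
        have h3 : ∑ j ∈ Finset.univ.erase m, algebraMap F k (c j) * (z j / z m)
            = (∑ j ∈ Finset.univ.erase m, algebraMap F k (c j) * z j) / z m := by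
          rw [Finset.sum_div]
          exact Finset.sum_congr rfl fun j _ => by ring
        rw [h3]
        field_simp
        linear_combination e
      refine v.algebraMap_notMem_nonunits hm (e2 ▸ add_mem ?_ (v.sum_mem_nonunits _ _ ?_))
      · exact v.mul_mem_nonunits hw (hyz m m.2)
      · intro j hj
        rw [← neg_mul]
        by_cases hcj : c j = 0
        · simp [hcj]
        · refine v.mul_mem_nonunits (neg_mem (v.algebraMap_mem _)) (hlt m j ?_ j.2)
          exact lt_of_le_of_ne (hmin j hcj) fun h => Finset.ne_of_mem_erase hj (Fin.ext h).symm)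
  simpa using hli.fintype_card_le_finrank

instance isDiscreteValuationRing (v : Place F k) : IsDiscreteValuationRing v.ring := by
  have hwf : WfDvdMonoid v.ring := by
    refine ⟨?_⟩
    rw [wellFounded_iff_isEmpty_descending_chain]
    refine ⟨fun ⟨f, hd⟩ => ?_⟩
    -- Only `f 0` may vanish, so the argument uses the chain from `f 1` on, with `y = f 1`.
    have h0 : ∀ n, f (n + 1) ≠ 0 := fun n => (hd n).1
    have hdiv : ∀ n m, n < m → ((f (n + 1) : k) / f (m + 1)) ∈ v.ring.nonunits := by
      intro n m hnm
      induction m, hnm using Nat.le_induction with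
      | base =>
        obtain ⟨hne, x, hx, e⟩ := hd (n + 1)
        have hne' : (f (n + 1 + 1) : k) ≠ 0 := by exact_mod_cast hne
        have : (f (n + 1) : k) / f (n + 1 + 1) = x := by
          rw [e]; push_cast; field_simp
        rw [this, ValuationSubring.coe_mem_nonunits_iff]
        exact hx
      | succ m hm ih =>
        obtain ⟨hne, x, hx, e⟩ := hd (m + 1)
        have hne' : (f (m + 1 + 1) : k) ≠ 0 := by exact_mod_cast hne
        have hne2 : (f (m + 1) : k) ≠ 0 := by exact_mod_cast h0 m
        have : (f (n + 1) : k) / f (m + 1 + 1) = x * (f (n + 1) / f (m + 1)) := by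
          field_simp
          rw [e]; push_cast; ring
        rw [this]
        exact v.mul_mem_nonunits x.2 ih
    have hy0 : (f 1 : k) ≠ 0 := by exact_mod_cast h0 0
    have hy : (f 1 : k) ∈ v.ring.nonunits := by
      have := v.mul_mem_nonunits (f 2).2 (hdiv 0 1 Nat.zero_lt_one)
      have h2 : (f 2 : k) ≠ 0 := by exact_mod_cast h0 1
      rwa [mul_div_cancel₀] at this
      exact h2
    set M := Module.finrank F⟮(f 1 : k)⟯ k
    -- The elements `f 2, …, f (M + 2)` are listed backwards so that their orders increase; there is
    -- one more of them than the bound `M` allows.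
    have := v.card_chain_le hy hy0 (M + 1) (fun i => f (M + 2 - i)) (fun i _ => (f _).2)
      (fun i hi => by
        obtain ⟨j, hj⟩ : ∃ j, M + 2 - i = j + 1 := ⟨M + 1 - i, by omega⟩
        rw [hj]; exact_mod_cast h0 j)
      (fun i j hij hj => by
        have := hdiv (M + 1 - j) (M + 1 - i) (by omega)
        rwa [show M + 1 - j + 1 = M + 2 - j by omega, show M + 1 - i + 1 = M + 2 - i by omega]
          at this)
      (fun i hi => by
        have := hdiv 0 (M + 1 - i) (by omega)
        rwa [show M + 1 - i + 1 = M + 2 - i by omega] at this)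
    omega
  have hp : IsPrincipalIdealRing v.ring := (IsBezout.TFAE.out 3 1).1 hwf
  refine { hp, ValuationSubring.isLocalRing v.ring with not_a_field' := ?_ }
  obtain ⟨y, hy, h0⟩ := v.exists_mem_nonunits
  intro h
  have := (ValuationSubring.coe_mem_nonunits_iff (a := ⟨y, v.ring.nonunits_le hy⟩)).1 hy
  rw [h, Ideal.mem_bot] at this
  exact h0 (congrArg Subtype.val this)

/-- The normalized valuation at a place. -/
def val (v : Place F k) : Valuation k ℤᵐ⁰ :=
  (IsDiscreteValuationRing.maximalIdeal v.ring).valuation k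

theorem val_le_one_iff {v : Place F k} {x : k} : v.val x ≤ 1 ↔ x ∈ v.ring := by
  constructor
  · intro h
    obtain ⟨a, rfl⟩ := IsDiscreteValuationRing.exists_lift_of_le_one h
    exact a.2
  · intro h
    exact IsDedekindDomain.HeightOneSpectrum.valuation_le_one _ (⟨x, h⟩ : v.ring)

theorem val_lt_one_iff {v : Place F k} {x : k} : v.val x < 1 ↔ x ∈ v.ring.nonunits := by
  constructor
  · intro h
    have hx := val_le_one_iff.1 h.le
    have := (IsDedekindDomain.HeightOneSpectrum.valuation_lt_one_iff_mem (K := k)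
      (IsDiscreteValuationRing.maximalIdeal v.ring) (⟨x, hx⟩ : v.ring)).1 h
    exact (ValuationSubring.coe_mem_nonunits_iff (a := ⟨x, hx⟩)).2 this
  · intro h
    have hx := v.ring.nonunits_le h
    have := (ValuationSubring.coe_mem_nonunits_iff (a := ⟨x, hx⟩)).1 h
    exact (IsDedekindDomain.HeightOneSpectrum.valuation_lt_one_iff_mem (K := k)
      (IsDiscreteValuationRing.maximalIdeal v.ring) (⟨x, hx⟩ : v.ring)).2 this

theorem val_eq_one_of_isAlgebraic (v : Place F k) {x : k} (hx : IsAlgebraic F x) (h0 : x ≠ 0) :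
    v.val x = 1 := by
  refine le_antisymm (val_le_one_iff.2 (v.mem_of_isAlgebraic hx)) (not_lt.1 fun h => ?_)
  exact v.transcendental_of_mem_nonunits (val_lt_one_iff.1 h) h0 hx

theorem val_algebraMap (v : Place F k) {c : F} (hc : c ≠ 0) : v.val (algebraMap F k c) = 1 :=
  v.val_eq_one_of_isAlgebraic (isAlgebraic_algebraMap c) (by simpa using hc)

theorem val_smul_le (v : Place F k) (c : F) (x : k) : v.val (c • x) ≤ v.val x := by
  rw [Algebra.smul_def]
  by_cases hc : c = 0
  · simp [hc]
  · rw [map_mul, v.val_algebraMap hc, one_mul]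

theorem exists_uniformizer (v : Place F k) : ∃ x : k, v.val x = WithZero.exp (-1) :=
  IsDedekindDomain.HeightOneSpectrum.valuation_exists_uniformizer k _

/-- Representatives of a basis of the residue field. -/
theorem exists_residue_basis (v : Place F k) : 0 < v.deg ∧ ∃ s : Fin v.deg → k,
    (∀ b, v.val (s b) ≤ 1) ∧
    (∀ c : Fin v.deg → F, v.val (∑ b, c b • s b) < 1 → c = 0) ∧
    ∀ x, v.val x ≤ 1 → ∃ c : Fin v.deg → F, v.val (x - ∑ b, c b • s b) < 1 := by
  let := v.toResidueField.toAlgebra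
  have hres : ∀ c : F, algebraMap F (IsLocalRing.ResidueField v.ring) c
      = IsLocalRing.residue v.ring ⟨algebraMap F k c, v.algebraMap_mem c⟩ := fun _ => rfl
  have hval : ∀ x : v.ring, v.val (x : k) < 1 ↔ IsLocalRing.residue v.ring x = 0 := by
    intro x
    rw [val_lt_one_iff, ValuationSubring.coe_mem_nonunits_iff, IsLocalRing.residue_eq_zero_iff]
  have hsum : ∀ (N : ℕ) (c : Fin N → F) (u : Fin N → v.ring),
      ∃ w : v.ring, (w : k) = ∑ b, c b • (u b : k) ∧
        IsLocalRing.residue v.ring w = ∑ b, c b • IsLocalRing.residue v.ring (u b) := by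
    intro N c u
    refine ⟨∑ b, ⟨algebraMap F k (c b), v.algebraMap_mem _⟩ * u b, ?_, ?_⟩
    · push_cast
      simp only [Algebra.smul_def]
    · rw [map_sum]
      simp only [map_mul, Algebra.smul_def, hres]
  -- Lifts of independent residues are independent modulo a nonunit `y`, so their number is at most
  -- `[k : F(y)]`.
  have hfin : Module.Finite F (IsLocalRing.ResidueField v.ring) := by
    obtain ⟨y, hy, h0⟩ := v.exists_mem_nonunits
    have hty := v.transcendental_of_mem_nonunits hy h0
    have := IsOneVariable.finite y hty
    rw [← Module.rank_lt_aleph0_iff]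
    refine lt_of_le_of_lt (rank_le (n := Module.finrank F⟮y⟯ k) fun s hs => ?_)
      (Cardinal.natCast_lt_aleph0)
    let e := s.equivFin
    have hs' : LinearIndependent F fun i : Fin s.card => ((e.symm i : s) : IsLocalRing.ResidueField v.ring) :=
      hs.comp _ e.symm.injective
    choose u hu using fun i : Fin s.card =>
      IsLocalRing.residue_surjective (R := v.ring) (e.symm i : IsLocalRing.ResidueField v.ring)
    have hli := linearIndependent_adjoin_of_quotient v.toSubalgebra
      (y := y) (v.ring.nonunits_le hy) hty (fun i => (u i : k)) (fun i => (u i).2) (by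
        rintro c ⟨z, hz, e⟩
        rw [finsum_eq_sum_of_fintype] at e
        obtain ⟨w, hw, hw'⟩ := hsum _ c u
        have h1 : v.val (w : k) < 1 := by
          rw [hw, e, mul_comm, val_lt_one_iff]
          exact v.mul_mem_nonunits hz hy
        rw [hval, hw'] at h1
        simp only [hu] at h1
        exact funext (Fintype.linearIndependent_iff.1 hs' c h1))
    simpa using hli.fintype_card_le_finrank
  have hdeg : v.deg = Module.finrank F (IsLocalRing.ResidueField v.ring) := rfl
  refine ⟨hdeg ▸ Module.finrank_pos, ?_⟩
  let b := Module.finBasis F (IsLocalRing.ResidueField v.ring)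
  choose u hu using fun i => IsLocalRing.residue_surjective (R := v.ring) (b i)
  refine ⟨fun i => u i, fun i => val_le_one_iff.2 (u i).2, fun c hc => ?_, fun x hx => ?_⟩
  · obtain ⟨w, hw, hw'⟩ := hsum _ c u
    have h1 : v.val (w : k) < 1 := by
      rw [hw]; exact hc
    rw [hval, hw'] at h1
    refine funext (Fintype.linearIndependent_iff.1 b.linearIndependent c ?_)
    rw [← h1]
    exact Finset.sum_congr rfl fun i _ => by rw [hu]
  · let x' : v.ring := ⟨x, val_le_one_iff.1 hx⟩
    refine ⟨fun i => b.repr (IsLocalRing.residue v.ring x') i, ?_⟩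
    obtain ⟨w, hw, hw'⟩ := hsum _ (fun i => b.repr (IsLocalRing.residue v.ring x') i) u
    simp only [hu, b.sum_repr] at hw'
    have h1 : v.val ((x' - w : v.ring) : k) < 1 := by
      rw [hval, map_sub, hw', sub_self]
    push_cast at h1
    rw [hw] at h1
    exact h1

theorem deg_pos (v : Place F k) : 0 < v.deg := v.exists_residue_basis.1

end Place

end

noncomputable section

/-! ### Weak approximation and the number of zeros -/

open scoped IntermediateField WithZero

namespace Place

variable {F k : Type*} [Field F] [Field k] [Algebra F k] [IsOneVariable F k]

/-- The absolute value `2 ^ (-ord_v x)`. -/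
def abv (v : Place F k) : AbsoluteValue k ℝ :=
  (IsDiscreteValuationRing.maximalIdeal v.ring).adicAbv (K := k) (b := 2) one_lt_two

theorem abv_le_abv_iff (v : Place F k) (x y : k) : v.abv x ≤ v.abv y ↔ v.val x ≤ v.val y :=
  NNReal.coe_le_coe.trans (WithZeroMulInt.toNNReal_strictMono one_lt_two).le_iff_le

/-- Weak approximation. The absolute values of distinct places are inequivalent because equivalent
ones have the same unit ball, which is the valuation ring. -/
theorem exists_val_sub_le (S : Finset (Place F k)) (z : Place F k → k) (N : ℕ) :
    ∃ x, ∀ v ∈ S, v.val (x - z v) ≤ WithZero.exp (-(N : ℤ)) := by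
  have hnt : ∀ v : S, (v.1.abv).IsNontrivial := by
    intro v
    obtain ⟨y, hy, h0⟩ := v.1.exists_mem_nonunits
    refine ⟨y, h0, fun h => ?_⟩
    have := (v.1.abv_le_abv_iff 1 y).1 (by rw [h, map_one])
    rw [map_one] at this
    exact not_lt.2 this (val_lt_one_iff.2 hy)
  have hne : Pairwise fun v w : S => ¬ (v.1.abv).IsEquiv w.1.abv := by
    intro v w hvw h
    apply hvw
    refine Subtype.ext (ext_of_ring (ValuationSubring.ext _ _ fun x => ?_))
    have := h.le_one_iff (x := x)
    rw [← map_one v.1.abv] at this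
    conv at this => rhs; rw [map_one, ← map_one w.1.abv]
    rw [abv_le_abv_iff, abv_le_abv_iff, map_one, map_one,
      val_le_one_iff, val_le_one_iff] at this
    exact this
  choose p hp using fun v : S => v.1.exists_uniformizer
  have hd := AbsoluteValue.denseRange_algebraMap_pi hnt hne
  have hpos : ∀ v : S, 0 < v.1.abv (p v ^ N) := by
    intro v
    refine (v.1.abv.pos_iff).2 (pow_ne_zero _ fun h => ?_)
    have := hp v
    rw [h, map_zero] at this
    exact WithZero.exp_ne_zero this.symm
  rcases S.eq_empty_or_nonempty with rfl | hS
  · exact ⟨0, by simp⟩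
  have : Nonempty S := hS.to_subtype
  obtain ⟨v₀, hv₀⟩ := Finite.exists_min fun v : S => v.1.abv (p v ^ N)
  obtain ⟨x, hx⟩ := Metric.denseRange_iff.1 hd
    (fun v => (WithAbs.equiv v.1.abv).symm (z v)) _ (hpos v₀)
  refine ⟨x, fun v hv => ?_⟩
  have h1 := lt_of_le_of_lt (dist_le_pi_dist _ _ (⟨v, hv⟩ : S)) hx
  have h2 : v.abv (x - z v) < v.abv (p ⟨v, hv⟩ ^ N) := by
    refine lt_of_lt_of_le ?_ (hv₀ ⟨v, hv⟩)
    rw [dist_comm, dist_eq_norm] at h1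
    exact h1
  have h3 := (v.abv_le_abv_iff _ _).1 h2.le
  rw [map_pow, hp ⟨v, hv⟩, ← WithZero.exp_nsmul] at h3
  simpa using h3

theorem val_le_exp_neg_one {v : Place F k} {x : k} (h : v.val x < 1) :
    v.val x ≤ WithZero.exp (-1) := by
  rw [← WithZero.lt_mul_exp_iff_le WithZero.exp_ne_zero, ← WithZero.exp_add]
  simpa using h

/-- Uniqueness of the expansion in powers of a uniformizer modulo order `n`, with digits in the span
of the residue representatives. The digits vanish one after the other: after division by `p ^ a` the
lower ones are zero by induction and the higher ones are nonunits. -/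
theorem eq_zero_of_val_sum_le (v : Place F k) {p : k} (hp : v.val p = WithZero.exp (-1))
    {s : Fin v.deg → k} (hs : ∀ b, v.val (s b) ≤ 1)
    (hs' : ∀ c : Fin v.deg → F, v.val (∑ b, c b • s b) < 1 → c = 0) (n : ℕ)
    (c : Fin n × Fin v.deg → F)
    (hc : v.val (∑ i, c i • (p ^ (i.1 : ℕ) * s i.2)) ≤ WithZero.exp (-(n : ℤ))) : c = 0 := by
  have hp0 : p ≠ 0 := by
    rintro rfl
    rw [map_zero] at hp
    exact WithZero.exp_ne_zero hp.symm
  have hp1 : v.val p < 1 := by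
    rw [hp, ← WithZero.exp_zero, WithZero.exp_lt_exp]; norm_num
  suffices h : ∀ a : Fin n, ∀ b, c (a, b) = 0 from funext fun i => h i.1 i.2
  intro a
  induction a using WellFoundedLT.induction with
  | ind a ih => ?_
  refine congrFun (hs' (fun b => c (a, b)) ?_)
  have e : ∑ b, c (a, b) • s b = (∑ i, c i • (p ^ (i.1 : ℕ) * s i.2)) / p ^ (a : ℕ)
      - ∑ a' ∈ Finset.univ.erase a, ∑ b, c (a', b) • (p ^ (a' : ℕ) / p ^ (a : ℕ) * s b) := by
    rw [Fintype.sum_prod_type, ← Finset.add_sum_erase _ _ (Finset.mem_univ a), add_div,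
      Finset.sum_div, Finset.sum_div, add_sub_assoc]
    simp only [Finset.sum_div]
    rw [sub_eq_zero_of_eq, add_zero]
    · refine Finset.sum_congr rfl fun b _ => ?_
      rw [Algebra.smul_def, Algebra.smul_def]
      field_simp
    · refine Finset.sum_congr rfl fun a' _ => Finset.sum_congr rfl fun b _ => ?_
      rw [Algebra.smul_def, Algebra.smul_def]
      ring
  rw [e]
  refine lt_of_le_of_lt (v.val.map_sub _ _) (max_lt ?_ ?_)
  · rw [map_div₀, map_pow, hp, ← WithZero.exp_nsmul]
    refine lt_of_le_of_lt (div_le_div_of_nonneg_right hc zero_le) ?_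
    rw [← WithZero.exp_sub, ← WithZero.exp_zero, WithZero.exp_lt_exp]
    have := a.2
    simp
  · refine v.val.map_sum_lt one_ne_zero fun a' ha' => v.val.map_sum_lt one_ne_zero fun b _ => ?_
    rcases lt_or_gt_of_ne (Finset.ne_of_mem_erase ha') with h | h
    · rw [ih a' h b, zero_smul, map_zero]
      exact zero_lt_one
    · refine (v.val_smul_le _ _).trans_lt ?_
      rw [show p ^ (a' : ℕ) / p ^ (a : ℕ) = p ^ ((a' : ℕ) - a) by
        rw [pow_sub₀ _ hp0 (le_of_lt h), div_eq_mul_inv], map_mul, map_pow]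
      refine (mul_le_of_le_one_right' (hs b)).trans_lt (pow_lt_one₀ zero_le hp1 ?_)
      have : (a : ℕ) < a' := h
      omega

/-- A function has at most `[k : F(y)]` zeros, counted with multiplicity and degree. Each zero of
order `n v` gives `n v * v.deg` elements `p ^ a * s b`; weak approximation realizes these local
elements by elements of `k` which are independent modulo `y` in the intersection of the valuation
rings. -/
theorem sum_mul_deg_le {y : k} (hy : Transcendental F y) (S : Finset (Place F k))
    (n : Place F k → ℕ) (h : ∀ v ∈ S, v.val y ≤ WithZero.exp (-(n v : ℤ))) :
    ∑ v ∈ S, n v * v.deg ≤ Module.finrank F⟮y⟯ k := by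
  classical
  have := IsOneVariable.finite y hy
  choose p hp using fun v : Place F k => v.exists_uniformizer
  choose s hs hs' _ using fun v : Place F k => v.exists_residue_basis.2
  let I := Σ v : S, Fin (n v) × Fin v.1.deg
  -- The local targets: the prescribed element at its own place and zero at the other places of `S`.
  -- The accuracy `N` makes the errors negligible modulo `y` everywhere.
  let t : I → Place F k → k := fun (i : I) (w : Place F k) =>
    if i.1.1 = w then p i.1.1 ^ (i.2.1 : ℕ) * s i.1.1 i.2.2 else 0
  let N := S.sup n
  choose u hu using fun i : I => exists_val_sub_le S (t i) N
  have hN : ∀ v ∈ S, (WithZero.exp (-(N : ℤ)) : ℤᵐ⁰) ≤ WithZero.exp (-(n v : ℤ)) := by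
    intro v hv
    rw [WithZero.exp_le_exp]
    have : n v ≤ N := Finset.le_sup hv
    omega
  have hle1 : ∀ m : ℕ, (WithZero.exp (-(m : ℤ)) : ℤᵐ⁰) ≤ 1 := by
    intro m
    rw [← WithZero.exp_zero, WithZero.exp_le_exp]
    omega
  have hp1 : ∀ v : Place F k, v.val (p v) ≤ 1 := by
    intro v
    rw [hp, ← WithZero.exp_zero, WithZero.exp_le_exp]; norm_num
  let O : Subalgebra F k := ⨅ v : S, v.1.toSubalgebra
  have hO : ∀ x, x ∈ O ↔ ∀ v ∈ S, v.val x ≤ 1 := by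
    intro x
    simp only [O, Algebra.mem_iInf, mem_toSubalgebra, ← val_le_one_iff, Subtype.forall]
  have htv : ∀ i (w : Place F k), w.val (t i w) ≤ 1 := by
    intro i w
    simp only [t]
    split_ifs with e
    · subst e
      rw [map_mul, map_pow]
      exact mul_le_one' (pow_le_one' (hp1 _) _) (hs _ _)
    · simp
  have hli := linearIndependent_adjoin_of_quotient O (y := y)
    ((hO y).2 fun v hv => (h v hv).trans (hle1 _)) hy u (fun i => (hO _).2 fun v hv => by
      rw [← sub_add_cancel (u i) (t i v)]
      exact (v.val.map_add _ _).trans (max_le ((hu i v hv).trans (hle1 _)) (htv i v))) (by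
      rintro c ⟨z, hz, e⟩
      rw [finsum_eq_sum_of_fintype] at e
      funext ⟨w, ab⟩
      refine congrFun (w.1.eq_zero_of_val_sum_le (hp w) (hs w) (hs' w) (n w)
        (fun ab => c ⟨w, ab⟩) ?_) ab
      have e1 : ∑ i : I, c i • t i w
          = ∑ ab : Fin (n w) × Fin w.1.deg, c ⟨w, ab⟩ • (p w ^ (ab.1 : ℕ) * s w ab.2) := by
        rw [Fintype.sum_sigma, Finset.sum_eq_single w]
        · simp [t]
        · intro v _ hvw
          refine Finset.sum_eq_zero fun ab _ => ?_
          simp only [t]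
          rw [if_neg (fun h => hvw (Subtype.ext h)), smul_zero]
        · simp
      have e2 : ∑ i : I, c i • t i w = y * z - ∑ i : I, c i • (u i - t i w) := by
        rw [← e, ← Finset.sum_sub_distrib]
        exact Finset.sum_congr rfl fun i _ => by rw [smul_sub]; ring
      rw [← e1, e2]
      refine (w.1.val.map_sub _ _).trans (max_le ?_ ?_)
      · rw [map_mul]
        exact (mul_le_of_le_one_right' ((hO z).1 hz w w.2)).trans (h w w.2)
      · refine w.1.val.map_sum_le fun i _ => ?_
        exact (w.1.val_smul_le _ _).trans ((hu i w w.2).trans (hN w w.2)))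
  have hcard := hli.fintype_card_le_finrank
  rw [Fintype.card_sigma, Finset.sum_coe_sort S fun v => Fintype.card (Fin (n v) × Fin v.deg)] at hcard
  simpa using hcard

theorem finite_setOf_val_lt_one {y : k} (hy : y ≠ 0) :
    {v : Place F k | v.val y < 1}.Finite := by
  by_cases h : IsAlgebraic F y
  · convert Set.finite_empty
    ext v
    simp [v.val_eq_one_of_isAlgebraic h hy]
  · by_contra hinf
    obtain ⟨S, hS, hcard⟩ := Set.Infinite.exists_subset_card_eq hinf (Module.finrank F⟮y⟯ k + 1)
    have := sum_mul_deg_le h S (fun _ => 1) (fun v hv => by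
      exact_mod_cast val_le_exp_neg_one (hS hv))
    have h2 : S.card ≤ ∑ v ∈ S, 1 * v.deg := by
      rw [Finset.card_eq_sum_ones]
      exact Finset.sum_le_sum fun v _ => by rw [one_mul]; exact v.deg_pos
    omega

end Place

end

noncomputable section

/-! ### Divisors and Riemann's theorem -/

open scoped IntermediateField WithZero

theorem finrank_le_ker_add {F V W : Type*} [Field F] [AddCommGroup V] [Module F V]
    [AddCommGroup W] [Module F W] [FiniteDimensional F W] (φ : V →ₗ[F] W)
    [FiniteDimensional F (LinearMap.ker φ)] : FiniteDimensional F V ∧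
      Module.finrank F V ≤ Module.finrank F (LinearMap.ker φ) + Module.finrank F W := by
  have hQ : FiniteDimensional F (V ⧸ LinearMap.ker φ) :=
    LinearEquiv.finiteDimensional φ.quotKerEquivRange.symm
  have hV : FiniteDimensional F V := Module.Finite.of_submodule_quotient (LinearMap.ker φ)
  refine ⟨hV, ?_⟩
  rw [← LinearMap.finrank_range_add_finrank_ker φ, add_comm]
  exact Nat.add_le_add_left (Submodule.finrank_le _) _

variable {F k : Type*} [Field F] [Field k] [Algebra F k]

/-- A pole exists because `f⁻¹` generates a proper ideal of the polynomial ring `F[f⁻¹]`, and a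
proper ideal lies in the nonunits of some valuation ring of `k`. -/
theorem exists_place_one_lt {f : k} (hf : Transcendental F f) :
    ∃ v : Place F k, f ∉ v.ring := by
  have hf0 : f ≠ 0 := by
    rintro rfl
    exact hf isAlgebraic_zero
  have hg : Transcendental F f⁻¹ := fun h => hf (by simpa using h.inv)
  let A := Algebra.adjoin F {f⁻¹}
  let g : A := ⟨f⁻¹, Algebra.self_mem_adjoin_singleton F _⟩
  have hI : Ideal.span {g} ≠ ⊤ := by
    intro h
    obtain ⟨a, ha⟩ := Ideal.mem_span_singleton'.1 (h ▸ Submodule.mem_top : (1 : A) ∈ Ideal.span {g})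
    obtain ⟨p, hp⟩ : ∃ p : Polynomial F, Polynomial.aeval f⁻¹ p = (a : k) := by
      simpa only [A, Algebra.adjoin_singleton_eq_range_aeval, AlgHom.mem_range] using a.2
    refine hg ⟨p * Polynomial.X - 1, fun h => ?_, ?_⟩
    · have := congrArg (Polynomial.coeff · 0) h
      simp at this
    · have := congrArg Subtype.val ha
      simp only [map_sub, map_mul, Polynomial.aeval_X, map_one, hp]
      exact sub_eq_zero.2 this
  obtain ⟨B, hB, hB'⟩ := Ideal.image_subset_nonunits_valuationSubring
    (A := A.toSubring) (Ideal.span {g}) hI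
  have hfB : f ∉ B := by
    have h1 : f⁻¹ ∈ B.nonunits := hB' ⟨g, Ideal.mem_span_singleton_self g, rfl⟩
    exact (B.inv_mem_nonunits_iff.1 h1).resolve_left hf0
  refine ⟨⟨B, fun c => hB (A.algebraMap_mem c), ?_⟩, hfB⟩
  rintro rfl
  exact hfB trivial

/-- Divisors. -/
abbrev Divisor (F k : Type*) [Field F] [Field k] [Algebra F k] : Type _ := Place F k →₀ ℤ

namespace Divisor

/-- The degree of a divisor. -/
def degree : Divisor F k →+ ℤ :=
  Finsupp.liftAddHom fun v => AddMonoidHom.mulRight (v.deg : ℤ)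

theorem degree_apply (D : Divisor F k) : D.degree = D.sum fun v n => n * (v.deg : ℤ) := by
  rfl

@[simp]
theorem degree_single (v : Place F k) (n : ℤ) : degree (Finsupp.single v n) = n * v.deg := by
  simp [degree]

theorem degree_nonneg {D : Divisor F k} (h : 0 ≤ D) : 0 ≤ D.degree :=
  Finset.sum_nonneg fun v _ => mul_nonneg (h v) (Int.natCast_nonneg _)

variable [IsOneVariable F k]

/-- The space `L(D)`. -/
def space (D : Divisor F k) : Submodule F k where
  carrier := {f | ∀ v : Place F k, v.val f ≤ WithZero.exp (D v)}
  zero_mem' v := by simp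
  add_mem' hf hg v := (v.val.map_add _ _).trans (max_le (hf v) (hg v))
  smul_mem' c f hf v := (v.val_smul_le c f).trans (hf v)

theorem mem_space {D : Divisor F k} {f : k} :
    f ∈ D.space ↔ ∀ v : Place F k, v.val f ≤ WithZero.exp (D v) := Iff.rfl

theorem space_mono {D E : Divisor F k} (h : D ≤ E) : D.space ≤ E.space := fun _ hf v =>
  (hf v).trans (WithZero.exp_le_exp.2 (h v))

/-- The dimension of `L(D)`. -/
def ell (D : Divisor F k) : ℕ := Module.finrank F D.space

/-- A nonzero function with a zero is transcendental, so it has a pole, which the divisor forbids.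
This is the starting point for the finiteness of all the spaces `L(D)`. -/
theorem space_neg_single (v : Place F k) : space (Finsupp.single v (-1)) = ⊥ := by
  classical
  rw [eq_bot_iff]
  intro f hf
  by_contra h0
  have h1 : v.val f < 1 := by
    refine (hf v).trans_lt ?_
    rw [Finsupp.single_eq_same, ← WithZero.exp_zero, WithZero.exp_lt_exp]
    norm_num
  obtain ⟨w, hw⟩ := exists_place_one_lt
    (v.transcendental_of_mem_nonunits (Place.val_lt_one_iff.1 h1) h0)
  refine hw (Place.val_le_one_iff.1 ((hf w).trans ?_))
  rw [← WithZero.exp_zero, WithZero.exp_le_exp, Finsupp.single_apply]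
  split_ifs <;> norm_num

/-- Sending `f` to the residue of `f * q` at `v`, in coordinates, is a linear map to a space of
dimension `v.deg` whose kernel lies in `W`. -/
theorem finrank_le_add_deg (v : Place F k) (V W : Submodule F k) [FiniteDimensional F W] (q : k)
    (hV : ∀ f ∈ V, v.val (f * q) ≤ 1) (hW : ∀ f ∈ V, v.val (f * q) < 1 → f ∈ W) :
    FiniteDimensional F V ∧ Module.finrank F V ≤ Module.finrank F W + v.deg := by
  obtain ⟨-, s, hs, hs', hex⟩ := v.exists_residue_basis
  choose c hc using fun f : V => hex ((f : k) * q) (hV f f.2)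
  have huniq : ∀ (x : k) (c₁ c₂ : Fin v.deg → F), v.val (x - ∑ b, c₁ b • s b) < 1 →
      v.val (x - ∑ b, c₂ b • s b) < 1 → c₁ = c₂ := by
    intro x c₁ c₂ h₁ h₂
    refine sub_eq_zero.1 (hs' _ ?_)
    have : ∑ b, (c₁ - c₂) b • s b = (x - ∑ b, c₂ b • s b) - (x - ∑ b, c₁ b • s b) := by
      simp only [Pi.sub_apply, sub_smul, Finset.sum_sub_distrib]
      ring
    rw [this]
    exact (v.val.map_sub _ _).trans_lt (max_lt h₂ h₁)
  have hadd : ∀ f g : V, c (f + g) = c f + c g := by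
    intro f g
    refine huniq _ _ _ (hc _) ?_
    have : ((f + g : V) : k) * q - ∑ b, (c f + c g) b • s b
        = (f * q - ∑ b, c f b • s b) + (g * q - ∑ b, c g b • s b) := by
      simp only [Pi.add_apply, add_smul, Finset.sum_add_distrib, Submodule.coe_add]
      ring
    rw [this]
    exact (v.val.map_add _ _).trans_lt (max_lt (hc f) (hc g))
  have hsmul : ∀ (a : F) (f : V), c (a • f) = a • c f := by
    intro a f
    refine huniq _ _ _ (hc _) ?_
    have : ((a • f : V) : k) * q - ∑ b, (a • c f) b • s b
        = a • ((f : k) * q - ∑ b, c f b • s b) := by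
      simp only [Pi.smul_apply, smul_sub, Finset.smul_sum, Submodule.coe_smul, smul_mul_assoc,
        smul_assoc]
    rw [this]
    exact (v.val_smul_le _ _).trans_lt (hc f)
  let φ : V →ₗ[F] (Fin v.deg → F) := { toFun := c, map_add' := hadd, map_smul' := hsmul }
  have hker : ∀ f : V, f ∈ LinearMap.ker φ → (f : k) ∈ W := by
    intro f hf
    have h1 : c f = 0 := hf
    have h2 := hc f
    rw [h1] at h2
    simp only [Pi.zero_apply, zero_smul, Finset.sum_const_zero, sub_zero] at h2
    exact hW f f.2 h2
  let ψ : LinearMap.ker φ →ₗ[F] W :=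
    ((Submodule.subtype _).comp (Submodule.subtype _)).codRestrict W fun f => hker f.1 f.2
  have hψ : Function.Injective ψ := fun a b h =>
    Subtype.ext (Subtype.ext (congrArg (fun z : W => (z : k)) h))
  have : FiniteDimensional F (LinearMap.ker φ) := FiniteDimensional.of_injective ψ hψ
  obtain ⟨h1, h2⟩ := finrank_le_ker_add φ
  refine ⟨h1, h2.trans ?_⟩
  have := LinearMap.finrank_le_finrank_of_injective hψ
  simpa using this

theorem finite_and_ell_add_single_le (D : Divisor F k) (v : Place F k)
    [FiniteDimensional F D.space] : FiniteDimensional F (space (D + Finsupp.single v 1)) ∧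
      ell (D + Finsupp.single v 1) ≤ ell D + v.deg := by
  classical
  obtain ⟨p, hp⟩ := v.exists_uniformizer
  have hq : v.val (p ^ (D v + 1)) = WithZero.exp (-(D v + 1)) := by
    rw [map_zpow₀, hp, ← WithZero.exp_zsmul]
    simp
  -- Multiplication by this power of the uniformizer turns the leading coefficient at the newly
  -- allowed pole order into a residue.
  refine finrank_le_add_deg v _ D.space (p ^ (D v + 1)) (fun f hf => ?_) (fun f hf h2 w => ?_)
  · rw [map_mul, hq]
    have := hf v
    rw [Finsupp.add_apply, Finsupp.single_eq_same] at this
    refine (mul_le_mul_left this _).trans ?_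
    rw [← WithZero.exp_add]; simp
  · by_cases hwv : w = v
    · subst hwv
      have h3 := Place.val_le_exp_neg_one h2
      rw [map_mul, hq] at h3
      have h4 := mul_le_mul_left h3 (WithZero.exp (D w + 1))
      rw [mul_assoc, ← WithZero.exp_add, ← WithZero.exp_add] at h4
      simpa using h4
    · have := hf w
      rwa [Finsupp.add_apply, Finsupp.single_eq_of_ne hwv, add_zero] at this

theorem finite_and_ell_add_le (D : Divisor F k) (hD : FiniteDimensional F D.space)
    (E : Divisor F k) (hE : 0 ≤ E) : FiniteDimensional F (D + E).space ∧
      (ell (D + E) : ℤ) ≤ ell D + E.degree := by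
  obtain ⟨n, hn⟩ : ∃ n : ℕ, E.degree = n := ⟨_, (Int.toNat_of_nonneg (degree_nonneg hE)).symm⟩
  induction n using Nat.strong_induction_on generalizing E with
  | _ n ih =>
    by_cases h0 : E = 0
    · subst h0
      rw [add_zero]
      exact ⟨hD, by simp⟩
    · obtain ⟨v, hv⟩ : ∃ v, E v ≠ 0 := by
        by_contra! h
        exact h0 (Finsupp.ext h)
      have hE' : 0 ≤ E - Finsupp.single v 1 := by
        classical
        intro w
        have h1 := hE w
        simp only [Finsupp.coe_zero, Pi.zero_apply, Finsupp.sub_apply, Finsupp.single_apply] at h1 ⊢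
        split_ifs with h
        · subst h; omega
        · omega
      have hdeg := v.deg_pos
      have hd : degree (E - Finsupp.single v 1) = ((n - v.deg : ℕ) : ℤ) := by
        have h2 := degree_nonneg hE'
        rw [map_sub, degree_single] at *
        omega
      have hlt : n - v.deg < n := by
        have h2 := degree_nonneg hE'
        rw [map_sub, degree_single] at *
        omega
      obtain ⟨h1, h2⟩ := ih _ hlt _ hE' hd
      obtain ⟨h3, h4⟩ := finite_and_ell_add_single_le (D + (E - Finsupp.single v 1)) v
      have e : D + (E - Finsupp.single v 1) + Finsupp.single v 1 = D + E := by abel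
      rw [e] at h3 h4
      refine ⟨h3, ?_⟩
      rw [map_sub, degree_single] at h2
      have h5 : (ell (D + E) : ℤ) ≤ ell (D + (E - Finsupp.single v 1)) + v.deg := by exact_mod_cast h4
      linarith

instance finiteDimensional_space (D : Divisor F k) : FiniteDimensional F D.space := by
  obtain ⟨y, hy⟩ := IsOneVariable.exists_transcendental (F := F) (k := k)
  obtain ⟨v, -⟩ := exists_place_one_lt hy
  have h0 : FiniteDimensional F (space (Finsupp.single v (-1))) := by
    rw [space_neg_single]; infer_instance
  let E : Divisor F k := (D - Finsupp.single v (-1)) ⊔ 0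
  have h1 := (finite_and_ell_add_le _ h0 E le_sup_right).1
  have h2 : D ≤ Finsupp.single v (-1) + E := by
    have : D - Finsupp.single v (-1) ≤ E := le_sup_left
    rwa [sub_le_iff_le_add'] at this
  exact FiniteDimensional.of_injective (Submodule.inclusion (space_mono h2))
    (Submodule.inclusion_injective _)

/-- Adding a point raises the dimension by at most its degree. This monotonicity, together with
invariance under principal divisors, drives the proof of Riemann's theorem. -/
theorem degree_sub_ell_mono {D E : Divisor F k} (h : D ≤ E) :
    D.degree - ell D ≤ E.degree - ell E := by
  have := (finite_and_ell_add_le D inferInstance (E - D) (sub_nonneg.2 h)).2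
  rw [add_sub_cancel, map_sub] at this
  linarith

/-- The divisor of a function. -/
def div (f : k) : Divisor F k :=
  Finsupp.ofSupportFinite (fun v => -WithZero.log (v.val f)) (by
    by_cases hf : f = 0
    · simp [hf, Function.support]
    · refine ((Place.finite_setOf_val_lt_one (F := F) hf).union
        (Place.finite_setOf_val_lt_one (F := F) (inv_ne_zero hf))).subset fun v hv => ?_
      by_contra h
      simp only [Set.mem_union, Set.mem_ofPred_eq, not_or, not_lt, map_inv₀] at h
      have h2 : v.val f ≤ 1 := by
        have := h.2
        rwa [one_le_inv₀ (zero_lt_iff.2 ((Valuation.ne_zero_iff _).2 hf))] at this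
      exact hv (by simp [le_antisymm h2 h.1]))

theorem div_apply (f : k) (v : Place F k) : (div f : Divisor F k) v = -WithZero.log (v.val f) := rfl

theorem val_eq_exp_div {f : k} (hf : f ≠ 0) (v : Place F k) :
    v.val f = WithZero.exp (-(div f : Divisor F k) v) := by
  rw [div_apply, neg_neg, WithZero.exp_log ((Valuation.ne_zero_iff _).2 hf)]

theorem mem_space_iff_le {D : Divisor F k} {f : k} (hf : f ≠ 0) : f ∈ D.space ↔ 0 ≤ D + div f := by
  rw [mem_space, Finsupp.le_def]
  refine forall_congr' fun v => ?_
  rw [val_eq_exp_div hf, WithZero.exp_le_exp, Finsupp.coe_zero, Pi.zero_apply, Finsupp.add_apply]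
  constructor <;> intro h <;> linarith

theorem div_mul {f g : k} (hf : f ≠ 0) (hg : g ≠ 0) :
    (div (f * g) : Divisor F k) = div f + div g := by
  ext v
  rw [Finsupp.add_apply, div_apply, div_apply, div_apply, map_mul, WithZero.log_mul
    ((Valuation.ne_zero_iff _).2 hf) ((Valuation.ne_zero_iff _).2 hg)]
  ring

@[simp]
theorem div_inv (f : k) : (div f⁻¹ : Divisor F k) = -div f := by
  ext v
  rw [Finsupp.neg_apply, div_apply, div_apply, map_inv₀, WithZero.log_inv]

theorem ell_sub_div (D : Divisor F k) {z : k} (hz : z ≠ 0) : ell (D - div z) = ell D := by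
  have hle : ∀ (D : Divisor F k) {z : k}, z ≠ 0 → ell D ≤ ell (D - div z) := by
    intro D z hz
    have hmem : ∀ f : D.space, z * (f : k) ∈ (D - div z).space := by
      intro f
      by_cases hf : (f : k) = 0
      · simp [hf]
      · rw [mem_space_iff_le (mul_ne_zero hz hf), div_mul hz hf]
        have := (mem_space_iff_le hf).1 f.2
        convert this using 1
        abel
    let φ : D.space →ₗ[F] (D - div z).space :=
      ((LinearMap.mulLeft F z).comp (Submodule.subtype _)).codRestrict _ hmem
    refine LinearMap.finrank_le_finrank_of_injective (f := φ) fun a b h => ?_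
    exact Subtype.ext (mul_left_cancel₀ hz (congrArg Subtype.val h))
  refine le_antisymm ?_ (hle D hz)
  have := hle (D - div z) (inv_ne_zero hz)
  rwa [div_inv, sub_neg_eq_add, sub_add_cancel] at this

theorem exists_mem_space {D : Divisor F k} (h : 0 < ell D) : ∃ f, f ≠ 0 ∧ f ∈ D.space := by
  have : D.space ≠ ⊥ := by
    intro e
    rw [ell, e, finrank_bot] at h
    exact lt_irrefl 0 h
  obtain ⟨f, hf, h0⟩ := Submodule.exists_mem_ne_zero_of_ne_bot this
  exact ⟨f, h0, hf⟩

end Divisor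

end

/-! ### Principal divisors have degree zero; Riemann's theorem -/

noncomputable section

open scoped IntermediateField WithZero

variable {F k : Type*} [Field F] [Field k] [Algebra F k] [IsOneVariable F k]

namespace Divisor

theorem div_one : (div 1 : Divisor F k) = 0 := by
  ext v
  simp [div_apply]

theorem div_pow {f : k} (hf : f ≠ 0) (n : ℕ) : (div (f ^ n) : Divisor F k) = n • div f := by
  induction n with
  | zero => rw [pow_zero, div_one, zero_smul]
  | succ n ih => rw [pow_succ, div_mul (pow_ne_zero _ hf) hf, ih, succ_nsmul]

theorem degree_posPart_div_le {f : k} (hf : Transcendental F f) :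
    degree ((div f : Divisor F k) ⊔ 0) ≤ Module.finrank F⟮f⟯ k := by
  have hf0 : f ≠ 0 := by
    rintro rfl
    exact hf isAlgebraic_zero
  let D : Divisor F k := div f ⊔ 0
  have hD : ∀ v, D v = ((D v).toNat : ℤ) := fun v =>
    (Int.toNat_of_nonneg (show (0 : ℤ) ≤ D v from le_sup_right)).symm
  have h := Place.sum_mul_deg_le hf (D.support) (fun v => (D v).toNat) (fun v hv => by
    rw [val_eq_exp_div hf0, WithZero.exp_le_exp, ← hD]
    have h1 : D v = max ((div f : Divisor F k) v) 0 := rfl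
    have h2 := Finsupp.mem_support_iff.1 hv
    rw [h1] at h2 ⊢
    omega)
  have e : degree D = ((∑ v ∈ D.support, (D v).toNat * v.deg : ℕ) : ℤ) := by
    rw [degree_apply, Finsupp.sum]
    push_cast
    exact Finset.sum_congr rfl fun v _ => by rw [← hD]
  rw [e]
  exact_mod_cast h

/-- The spaces `L(C + l (f)_∞)` grow at least as fast as `[k : F(f)] l`. -/
theorem exists_le_ell {f : k} (hf : Transcendental F f) : ∃ C : Divisor F k, 0 ≤ C ∧ ∀ l : ℕ,
    Module.finrank F⟮f⟯ k * (l + 1) ≤ ell (C + l • ((-div f) ⊔ 0)) := by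
  have hf0 : f ≠ 0 := by
    rintro rfl
    exact hf isAlgebraic_zero
  have := IsOneVariable.finite f hf
  let b := Module.finBasis F⟮f⟯ k
  -- `C` bounds the poles of a basis of `k` over `F⟮f⟯`; the products of basis elements with `1, f,
  -- …, f ^ l` then lie in the space and are independent over `F`.
  let C : Divisor F k := ∑ i, ((-div (b i)) ⊔ 0)
  have hCi : ∀ i, (-div (b i) : Divisor F k) ≤ C := fun i => le_sup_left.trans
    (Finset.single_le_sum (f := fun i => ((-div (b i) : Divisor F k) ⊔ 0))
      (fun _ _ => le_sup_right) (Finset.mem_univ i))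
  refine ⟨C, Finset.sum_nonneg fun _ _ => le_sup_right, fun l => ?_⟩
  have hpow : LinearIndependent F fun j : Fin (l + 1) =>
      (IntermediateField.AdjoinSimple.gen F f) ^ (j : ℕ) := by
    have htr : Transcendental F (IntermediateField.AdjoinSimple.gen F f) := by
      rw [← transcendental_algebraMap_iff (algebraMap F⟮f⟯ k).injective]
      exact hf
    rw [Fintype.linearIndependent_iff]
    intro c hc j
    let p : Polynomial F := ∑ j : Fin (l + 1), Polynomial.monomial j (c j)
    have hp : p = 0 := by
      by_contra hp
      refine htr ⟨p, hp, ?_⟩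
      rw [← hc, map_sum]
      exact Finset.sum_congr rfl fun j _ => by rw [Polynomial.aeval_monomial, Algebra.smul_def]
    have h2 := congrArg (Polynomial.coeff · j) hp
    simpa [p, Polynomial.finsetSum_coeff, Polynomial.coeff_monomial, Fin.val_inj] using h2
  have hli := linearIndependent_smul hpow b.linearIndependent
  have hmem : ∀ p : Fin (l + 1) × Fin (Module.finrank F⟮f⟯ k),
      (IntermediateField.AdjoinSimple.gen F f) ^ (p.1 : ℕ) • b p.2
        ∈ (C + l • ((-div f) ⊔ 0)).space := by
    intro p
    have e : (IntermediateField.AdjoinSimple.gen F f) ^ (p.1 : ℕ) • b p.2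
        = f ^ (p.1 : ℕ) * b p.2 := by
      rw [Algebra.smul_def, map_pow, IntermediateField.AdjoinSimple.algebraMap_gen]
    have hb : b p.2 ≠ 0 := b.ne_zero _
    rw [e, mem_space_iff_le (mul_ne_zero (pow_ne_zero _ hf0) hb), div_mul (pow_ne_zero _ hf0) hb,
      div_pow hf0]
    have h1 := hCi p.2
    have h2 : (p.1 : ℕ) • (-div f : Divisor F k) ≤ l • ((-div f) ⊔ 0) :=
      (nsmul_le_nsmul_right le_sup_left _).trans
        (nsmul_le_nsmul_left le_sup_right (Nat.lt_succ_iff.1 p.1.2))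
    have h3 := add_le_add h1 h2
    rw [← sub_nonneg] at h3
    refine h3.trans_eq ?_
    rw [smul_neg]
    abel
  let u : Fin (l + 1) × Fin (Module.finrank F⟮f⟯ k) → (C + l • ((-div f) ⊔ 0)).space :=
    fun p => ⟨_, hmem p⟩
  have hu : LinearIndependent F u := LinearIndependent.of_comp (Submodule.subtype _) hli
  have := hu.fintype_card_le_finrank
  simp only [Fintype.card_prod, Fintype.card_fin] at this
  rw [mul_comm]
  exact this

/-- The dimension of `L(C + l B)`, with `B` the divisor of poles, is at least `[k : F(f)] * (l + 1)`
and at most a constant plus `l * deg B`. Comparing the growth in `l` gives the inequality. -/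
theorem finrank_le_degree_pole {f : k} (hf : Transcendental F f) :
    (Module.finrank F⟮f⟯ k : ℤ) ≤ degree ((-div f : Divisor F k) ⊔ 0) := by
  obtain ⟨C, hC, h⟩ := exists_le_ell (F := F) hf
  set B : Divisor F k := (-div f) ⊔ 0
  set m : ℤ := ((Module.finrank F⟮f⟯ k : ℕ) : ℤ)
  by_contra! hlt
  have h1 : ∀ l : ℕ, m * (l + 1) ≤ ell (0 : Divisor F k) + C.degree + l * degree B := by
    intro l
    have hB : 0 ≤ l • B := nsmul_nonneg le_sup_right _
    have h2 := (finite_and_ell_add_le (0 : Divisor F k) inferInstance (C + l • B)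
      (add_nonneg hC hB)).2
    rw [zero_add, map_add, map_nsmul, nsmul_eq_mul] at h2
    have h3 : m * (l + 1) ≤ ell (C + l • B) := by simp only [m]; exact_mod_cast h l
    linarith
  have h4 := h1 (ell (0 : Divisor F k) + C.degree).toNat
  have h5 := Int.self_le_toNat (ell (0 : Divisor F k) + C.degree)
  have hm : 0 < m := by
    have h0 : 0 ≤ degree B := degree_nonneg le_sup_right
    linarith
  nlinarith

/-- The zeros are at most, and the poles at least, `[k : F(f)]` in number. Applied to `f` and to
`f⁻¹` this shows that principal divisors have degree zero. -/
theorem degree_div_nonpos {f : k} (hf : f ≠ 0) : degree (div f : Divisor F k) ≤ 0 := by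
  by_cases h : IsAlgebraic F f
  · have : (div f : Divisor F k) = 0 := by
      ext v
      simp [div_apply, v.val_eq_one_of_isAlgebraic h hf]
    simp [this]
  · have h1 := degree_posPart_div_le (F := F) h
    have h2 := finrank_le_degree_pole (F := F) h
    have e : (div f : Divisor F k) = (div f ⊔ 0) - ((-div f) ⊔ 0) := by
      ext v
      have e1 : ((div f : Divisor F k) ⊔ 0) v = max ((div f : Divisor F k) v) 0 := rfl
      have e2 : ((-div f : Divisor F k) ⊔ 0) v = max (-(div f : Divisor F k) v) 0 := rfl
      rw [Finsupp.sub_apply, e1, e2]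
      omega
    rw [e, map_sub]
    linarith

@[simp]
theorem degree_div (f : k) : degree (div f : Divisor F k) = 0 := by
  by_cases hf : f = 0
  · have : (div f : Divisor F k) = 0 := by
      ext v
      simp [div_apply, hf]
    simp [this]
  · have h1 := degree_div_nonpos (F := F) hf
    have h2 := degree_div_nonpos (F := F) (inv_ne_zero hf)
    rw [div_inv, map_neg] at h2
    linarith

theorem div_eq_zero_of_mem_space {u : k} (hu : u ≠ 0) (h : u ∈ (0 : Divisor F k).space) :
    (div u : Divisor F k) = 0 := by
  have h1 : (0 : Divisor F k) ≤ div u := by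
    have := (mem_space_iff_le hu).1 h
    rwa [zero_add] at this
  by_contra hne
  obtain ⟨v, hv⟩ : ∃ v, (div u : Divisor F k) v ≠ 0 := by
    by_contra! h
    exact hne (Finsupp.ext h)
  have hlt : (0 : ℤ) < degree (div u : Divisor F k) := by
    rw [degree_apply, Finsupp.sum]
    refine Finset.sum_pos' (fun w _ => mul_nonneg (h1 w) (Int.natCast_nonneg _))
      ⟨v, Finsupp.mem_support_iff.2 hv, ?_⟩
    have h2 : (0 : ℤ) ≤ (div u : Divisor F k) v := h1 v
    have := v.deg_pos
    have h3 : (0 : ℤ) < (div u : Divisor F k) v := lt_of_le_of_ne h2 hv.symm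
    positivity
  rw [degree_div] at hlt
  exact lt_irrefl _ hlt

theorem ell_zero_pos : 0 < ell (0 : Divisor F k) := by
  have : (1 : k) ∈ (0 : Divisor F k).space := by
    rw [mem_space_iff_le one_ne_zero, div_one, add_zero]
  rw [ell, Module.finrank_pos_iff_exists_ne_zero]
  exact ⟨⟨1, this⟩, fun h => one_ne_zero (congrArg Subtype.val h)⟩

/-- **Riemann's theorem**. -/
theorem exists_ell_eq : ∃ ρ N : ℤ, ∀ D : Divisor F k, N ≤ D.degree →
    (ell D : ℤ) = D.degree - ρ := by
  obtain ⟨f, hf⟩ := IsOneVariable.exists_transcendental (F := F) (k := k)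
  obtain ⟨C, hC, h⟩ := exists_le_ell (F := F) hf
  have hBle := finrank_le_degree_pole (F := F) hf
  have hBge := degree_posPart_div_le (F := F) hf
  set B : Divisor F k := (-div f) ⊔ 0 with hB
  set m : ℤ := ((Module.finrank F⟮f⟯ k : ℕ) : ℤ)
  have hB0 : 0 ≤ B := le_sup_right
  have hBm : degree B = m := by
    have e : (div f : Divisor F k) = (div f ⊔ 0) - B := by
      ext v
      have e1 : ((div f : Divisor F k) ⊔ 0) v = max ((div f : Divisor F k) v) 0 := rfl
      have e2 : B v = max (-(div f : Divisor F k) v) 0 := rfl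
      rw [Finsupp.sub_apply, e1, e2]
      omega
    have := congrArg degree e
    rw [degree_div, map_sub] at this
    linarith
  have hm : 0 < m := by
    have := IsOneVariable.finite f hf
    simp only [m]
    exact_mod_cast Module.finrank_pos (R := F⟮f⟯) (M := k)
  have hl : ∀ l : ℕ, m * (l + 1) - C.degree ≤ ell (l • B) := by
    intro l
    have h1 : m * (l + 1) ≤ ell (C + l • B) := by simp only [m]; exact_mod_cast h l
    have h2 := (finite_and_ell_add_le (l • B) inferInstance C hC).2
    rw [add_comm] at h1
    rw [add_comm (l • B)] at h2
    linarith
  have hbound : ∀ A : Divisor F k, A.degree - ell A ≤ C.degree - m := by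
    intro A
    let A' := A ⊔ 0
    refine (degree_sub_ell_mono (le_sup_left : A ≤ A')).trans ?_
    -- For such `l` the space of `l • B - A'` is nonzero, so a divisor equivalent to `A'` lies below
    -- `l • B`. Monotonicity reduces the bound to multiples of `B`, where it is known.
    obtain ⟨l, hl'⟩ : ∃ l : ℕ, C.degree + A'.degree < m * (l + 1) := by
      refine ⟨(C.degree + A'.degree).toNat, ?_⟩
      have h5 := Int.self_le_toNat (C.degree + A'.degree)
      nlinarith
    have h1 := (finite_and_ell_add_le (l • B - A') inferInstance A' le_sup_right).2
    rw [sub_add_cancel] at h1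
    have h2 : (0 : ℤ) < ell (l • B - A') := by linarith [hl l]
    obtain ⟨z, hz, hzm⟩ := exists_mem_space (by exact_mod_cast h2)
    have h3 : A' - div z ≤ l • B := by
      have := (mem_space_iff_le hz).1 hzm
      rw [← sub_nonneg]
      convert this using 1
      abel
    have h4 := degree_sub_ell_mono h3
    rw [ell_sub_div _ hz, map_sub, degree_div, map_nsmul, hBm, nsmul_eq_mul] at h4
    linarith [hl l]
  obtain ⟨ρ, ⟨A₀, hA₀⟩, hmax⟩ : ∃ ρ : ℤ, (∃ A : Divisor F k, A.degree - ell A = ρ) ∧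
      ∀ A : Divisor F k, A.degree - ell A ≤ ρ := by
    obtain ⟨ρ, h1, h2⟩ := Int.exists_greatest_of_bdd
      (P := fun ρ => ∃ A : Divisor F k, A.degree - ell A = ρ)
      ⟨C.degree - m, by rintro _ ⟨A, rfl⟩; exact hbound A⟩ ⟨_, 0, rfl⟩
    exact ⟨ρ, h1, fun A => h2 _ ⟨A, rfl⟩⟩
  -- Above this degree `L(D - A₀)` is nonzero by the maximality of `ρ`. Hence `A₀` lies below a
  -- divisor equivalent to `D`, and monotonicity forces the maximal value `ρ` at `D` as well.
  refine ⟨ρ, A₀.degree + ρ + 1, fun D hD => ?_⟩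
  have h1 := hmax (D - A₀)
  rw [map_sub] at h1
  have h2 : (0 : ℤ) < ell (D - A₀) := by linarith
  obtain ⟨z, hz, hzm⟩ := exists_mem_space (by exact_mod_cast h2)
  have h3 : A₀ ≤ D - div z⁻¹ := by
    have := (mem_space_iff_le hz).1 hzm
    rw [← sub_nonneg, div_inv]
    convert this using 1
    abel
  have h4 := degree_sub_ell_mono h3
  rw [ell_sub_div _ (inv_ne_zero hz), map_sub, degree_div] at h4
  linarith [hmax D]

end Divisor

end

noncomputable section

/-! ### Counting effective divisors -/

open scoped IntermediateField WithZero

variable {F k : Type*} [Field F] [Fintype F] [Field k] [Algebra F k] [IsOneVariable F k]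

theorem Place.val_pow_sub_lt_one (v : Place F k) {x : k} (hx : v.val x ≤ 1) :
    v.val (x ^ Fintype.card F ^ v.deg - x) < 1 := by
  let := v.toResidueField.toAlgebra
  have hpos : 0 < Module.finrank F (IsLocalRing.ResidueField v.ring) := v.deg_pos
  have hfin : Module.Finite F (IsLocalRing.ResidueField v.ring) :=
    FiniteDimensional.of_finrank_pos hpos
  have : Finite (IsLocalRing.ResidueField v.ring) := Module.finite_of_finite F
  have := Fintype.ofFinite (IsLocalRing.ResidueField v.ring)
  have hcard : Fintype.card (IsLocalRing.ResidueField v.ring) = Fintype.card F ^ v.deg :=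
    Module.card_eq_pow_finrank
  let x' : v.ring := ⟨x, val_le_one_iff.1 hx⟩
  have h1 : IsLocalRing.residue v.ring (x' ^ Fintype.card F ^ v.deg - x') = 0 := by
    rw [map_sub, map_pow, ← hcard, FiniteField.pow_card, sub_self]
  rw [IsLocalRing.residue_eq_zero_iff, ← ValuationSubring.coe_mem_nonunits_iff] at h1
  exact val_lt_one_iff.2 h1

/-- A place of degree `n` is a pole of `x` or a zero of `x ^ (q ^ n) - x`, since its residue field
has `q ^ n` elements. -/
theorem Place.finite_setOf_deg_eq (n : ℕ) : {v : Place F k | v.deg = n}.Finite := by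
  obtain ⟨x, hx⟩ := IsOneVariable.exists_transcendental (F := F) (k := k)
  have hx0 : x ≠ 0 := by
    rintro rfl
    exact hx isAlgebraic_zero
  rcases Nat.eq_zero_or_pos n with rfl | hn
  · convert Set.finite_empty
    ext v
    have := v.deg_pos
    simp [this.ne']
  have hne : x ^ Fintype.card F ^ n - x ≠ 0 := by
    intro h
    have hQ : 1 < Fintype.card F ^ n := Nat.one_lt_pow hn.ne' Fintype.one_lt_card
    refine hx ⟨Polynomial.X ^ Fintype.card F ^ n - Polynomial.X,
      FiniteField.X_pow_card_pow_sub_X_ne_zero _ hn.ne' Fintype.one_lt_card, ?_⟩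
    simpa using h
  refine ((Place.finite_setOf_val_lt_one (F := F) hne).union
    (Place.finite_setOf_val_lt_one (F := F) (inv_ne_zero hx0))).subset ?_
  rintro v (rfl : v.deg = n)
  rcases le_or_gt (v.val x) 1 with h | h
  · exact Or.inl (v.val_pow_sub_lt_one h)
  · refine Or.inr ?_
    rw [Set.mem_ofPred_eq, map_inv₀]
    exact inv_lt_one_of_one_lt₀ h

namespace Divisor

/-- The effective divisors of degree `n`. -/
def effective (F k : Type*) [Field F] [Field k] [Algebra F k] (n : ℕ) : Set (Divisor F k) :=
  {D | 0 ≤ D ∧ D.degree = n}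

theorem finite_effective (n : ℕ) : (effective F k n).Finite := by
  classical
  have hP : {v : Place F k | v.deg ≤ n}.Finite := by
    have : {v : Place F k | v.deg ≤ n} = ⋃ m ∈ Finset.range (n + 1), {v | v.deg = m} := by
      ext v
      simp
    rw [this]
    exact (Finset.range (n + 1)).finite_toSet.biUnion fun m _ => Place.finite_setOf_deg_eq m
  refine ((hP.toFinset.finsupp fun _ => Finset.Icc (0 : ℤ) n).finite_toSet).subset ?_
  rintro D ⟨hD, hdeg⟩
  have hterm : ∀ v, D v * v.deg ≤ n := by
    intro v
    by_cases hv : v ∈ D.support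
    · rw [← hdeg, degree_apply, Finsupp.sum]
      exact Finset.single_le_sum (f := fun v => D v * (v.deg : ℤ))
        (fun w _ => mul_nonneg (hD w) (Int.natCast_nonneg _)) hv
    · rw [Finsupp.notMem_support_iff.1 hv]; simp
  have hle : ∀ v, D v ≤ n := fun v => by
    have h1 : (1 : ℤ) ≤ v.deg := by exact_mod_cast v.deg_pos
    have h2 : (0 : ℤ) ≤ D v := hD v
    nlinarith [hterm v]
  rw [Finset.mem_coe, Finset.mem_finsupp_iff]
  refine ⟨fun v hv => ?_, fun v _ => Finset.mem_Icc.2 ⟨hD v, hle v⟩⟩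
  rw [Set.Finite.mem_toFinset, Set.mem_ofPred_eq]
  have h1 : 1 ≤ D v := by
    have h3 : (0 : ℤ) ≤ D v := hD v
    have h2 := Finsupp.mem_support_iff.1 hv
    omega
  have h2 : (0 : ℤ) ≤ v.deg := Int.natCast_nonneg _
  have h3 := hterm v
  have : (v.deg : ℤ) ≤ n := by nlinarith
  exact_mod_cast this

/-- Principal divisors. -/
def principal (F k : Type*) [Field F] [Field k] [Algebra F k] [IsOneVariable F k] :
    AddSubgroup (Divisor F k) where
  carrier := {D | ∃ f : k, f ≠ 0 ∧ D = div f}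
  zero_mem' := ⟨1, one_ne_zero, div_one.symm⟩
  add_mem' := by
    rintro _ _ ⟨f, hf, rfl⟩ ⟨g, hg, rfl⟩
    exact ⟨f * g, mul_ne_zero hf hg, (div_mul hf hg).symm⟩
  neg_mem' := by
    rintro _ ⟨f, hf, rfl⟩
    exact ⟨f⁻¹, inv_ne_zero hf, (div_inv f).symm⟩

/-- The number of effective divisors in the class of `A`. -/
theorem card_class (A : Divisor F k) :
    Nat.card {D : Divisor F k // 0 ≤ D ∧ D - A ∈ principal F k}
        * (Fintype.card F ^ ell (0 : Divisor F k) - 1) = Fintype.card F ^ ell A - 1 := by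
  have hcard : ∀ B : Divisor F k, Nat.card {f : B.space // f ≠ 0} = Fintype.card F ^ ell B - 1 := by
    intro B
    have : Finite B.space := Module.finite_of_finite F
    have := Fintype.ofFinite B.space
    classical
    rw [Nat.card_eq_fintype_card, Fintype.card_subtype_compl, Fintype.card_subtype_eq,
      Module.card_eq_pow_finrank (K := F)]
    rfl
  rw [← hcard, ← hcard, ← Nat.card_prod]
  have hne : ∀ {B : Divisor F k} (f : {f : B.space // f ≠ 0}), (f.1 : k) ≠ 0 := fun f h =>
    f.2 (Subtype.ext h)
  choose g hg0 hg using fun D : {D : Divisor F k // 0 ≤ D ∧ D - A ∈ principal F k} => D.2.2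
  have hgA : ∀ D, A + div (g D) = D.1 := fun D => by rw [← hg D]; abel
  have hmem : ∀ (D : {D : Divisor F k // 0 ≤ D ∧ D - A ∈ principal F k})
      (u : {f : (0 : Divisor F k).space // f ≠ 0}), (div (g D * u.1) : Divisor F k) = div (g D) :=
    fun D u => by rw [div_mul (hg0 D) (hne u), div_eq_zero_of_mem_space (hne u) u.1.2, add_zero]
  -- A nonzero element of `L(A)` amounts to its divisor shifted by `A` and a nonzero element of
  -- `L(0)`. The latter space replaces `F` because `F` may be smaller than the field of constants.
  let Φ : {D : Divisor F k // 0 ≤ D ∧ D - A ∈ principal F k} ×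
      {f : (0 : Divisor F k).space // f ≠ 0} → {f : A.space // f ≠ 0} := fun p =>
    ⟨⟨g p.1 * p.2.1, by
      rw [mem_space_iff_le (mul_ne_zero (hg0 _) (hne _)), hmem, hgA]
      exact p.1.2.1⟩, fun h => mul_ne_zero (hg0 p.1) (hne p.2) (congrArg Subtype.val h)⟩
  refine Nat.card_congr (Equiv.ofBijective Φ ⟨?_, ?_⟩)
  · rintro ⟨D, u⟩ ⟨D', u'⟩ h
    have h1 : g D * u.1 = g D' * u'.1 := congrArg (fun f : {f : A.space // f ≠ 0} => (f.1 : k)) h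
    have h2 : D = D' := by
      have h3 := congrArg (div (F := F)) h1
      rw [hmem, hmem] at h3
      refine Subtype.ext ?_
      rw [← hgA, ← hgA, h3]
    subst h2
    have h3 : (u.1 : k) = u'.1 := mul_left_cancel₀ (hg0 D) h1
    rw [Prod.mk.injEq]
    exact ⟨rfl, Subtype.ext (Subtype.ext h3)⟩
  · intro f
    have hf := hne f
    let D : {D : Divisor F k // 0 ≤ D ∧ D - A ∈ principal F k} :=
      ⟨A + div (f.1 : k), (mem_space_iff_le hf).1 f.1.2, ⟨f.1, hf, by abel⟩⟩
    have hdiv : (div (f.1 / g D : k) : Divisor F k) = 0 := by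
      rw [div_eq_mul_inv, div_mul hf (inv_ne_zero (hg0 D)), div_inv]
      have := hgA D
      simp only [D] at this
      rw [add_right_inj] at this
      rw [← this]
      abel
    refine ⟨⟨D, ⟨⟨f.1 / g D, ?_⟩, ?_⟩⟩, ?_⟩
    · rw [mem_space_iff_le (div_ne_zero hf (hg0 D)), hdiv, add_zero]
    · intro h
      exact div_ne_zero hf (hg0 D) (congrArg Subtype.val h)
    · refine Subtype.ext (Subtype.ext ?_)
      exact mul_div_cancel₀ _ (hg0 D)

/-- The degree on divisor classes. -/
def classDegree : Divisor F k ⧸ principal F k →+ ℤ :=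
  QuotientAddGroup.lift _ degree (by
    rintro _ ⟨f, -, rfl⟩
    exact degree_div f)

/-- The number of effective divisors of large degree. -/
theorem exists_card_effective_eq : ∃ δ : ℕ, 0 < δ ∧ (∀ v : Place F k, δ ∣ v.deg) ∧
    ∃ (α β : ℝ) (M : ℕ), ∀ n, M ≤ n → (Nat.card (effective F k n) : ℝ)
      = if δ ∣ n then α * (Fintype.card F : ℝ) ^ n - β else 0 := by
  obtain ⟨ρ, N, hN⟩ := exists_ell_eq (F := F) (k := k)
  obtain ⟨g, hg⟩ := Int.subgroup_cyclic (AddMonoidHom.range (degree : Divisor F k →+ ℤ))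
  have hdvd : ∀ D : Divisor F k, g ∣ D.degree := by
    intro D
    have : D.degree ∈ AddSubgroup.closure {g} := hg ▸ ⟨D, rfl⟩
    rw [AddSubgroup.mem_closure_singleton] at this
    obtain ⟨m, hm⟩ := this
    exact ⟨m, by rw [← hm, smul_eq_mul, mul_comm]⟩
  obtain ⟨D₁, hD₁⟩ : g ∈ AddMonoidHom.range (degree : Divisor F k →+ ℤ) := by
    rw [hg]; exact AddSubgroup.subset_closure rfl
  have hδ : ∀ v : Place F k, g.natAbs ∣ v.deg := by
    intro v
    have := hdvd (Finsupp.single v 1)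
    rw [degree_single, one_mul] at this
    exact Int.natAbs_dvd_natAbs.2 this
  have hg0 : 0 < g.natAbs := by
    obtain ⟨y, hy⟩ := IsOneVariable.exists_transcendental (F := F) (k := k)
    obtain ⟨v, -⟩ := exists_place_one_lt hy
    exact Nat.pos_of_dvd_of_pos (hδ v) v.deg_pos
  refine ⟨g.natAbs, hg0, hδ, ?_⟩
  -- The effective divisors of degree `n ≥ M` are counted class by class. By Riemann's theorem all
  -- classes of degree `n` contain equally many.
  let Cl : ℤ → Set (Divisor F k ⧸ principal F k) := fun n => {c | classDegree c = n}
  set q := Fintype.card F with hq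
  have hq1 : 1 < q := Fintype.one_lt_card
  set w : ℕ := q ^ ell (0 : Divisor F k) - 1 with hw
  have hw0 : 0 < w := Nat.sub_pos_of_lt (Nat.one_lt_pow ell_zero_pos.ne' hq1)
  let h : ℕ := Nat.card (Cl 0)
  let M : ℕ := (max N (ρ + 1)).toNat
  have hfib : ∀ n : ℕ, M ≤ n → ∀ c ∈ Cl n,
      Nat.card {D : effective F k n // (QuotientAddGroup.mk D.1 : _ ⧸ principal F k) = c} * w
        = q ^ ((n : ℤ) - ρ).toNat - 1 := by
    intro n hn c hc
    obtain ⟨A, rfl⟩ := QuotientAddGroup.mk_surjective c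
    have hA : A.degree = n := hc
    have hMn : max N (ρ + 1) ≤ n := Int.toNat_le.1 hn
    have hell := hN A (by rw [hA]; exact (le_max_left _ _).trans hMn)
    have : ((n : ℤ) - ρ).toNat = ell A := by rw [← hA, ← hell, Int.toNat_natCast]
    rw [this, ← card_class A, hw]
    congr 1
    refine Nat.card_congr
      { toFun := fun D => ⟨D.1.1, D.1.2.1, ?_⟩
        invFun := fun D => ⟨⟨D.1, D.2.1, ?_⟩, ?_⟩
        left_inv := fun D => rfl
        right_inv := fun D => rfl }
    · have := QuotientAddGroup.eq.1 D.2.symm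
      rwa [neg_add_eq_sub] at this
    · obtain ⟨f, hf, e⟩ := D.2.2
      have := congrArg degree e
      rw [map_sub, degree_div, hA] at this
      linarith
    · refine (QuotientAddGroup.eq.2 ?_).symm
      rw [neg_add_eq_sub]
      exact D.2.2
  have hcount : ∀ n : ℕ, M ≤ n →
      Nat.card (effective F k n) * w = Nat.card (Cl n) * (q ^ ((n : ℤ) - ρ).toNat - 1) := by
    intro n hn
    have hfin : Finite (effective F k n) := (finite_effective n).to_subtype
    let π : effective F k n → Cl n := fun D => ⟨QuotientAddGroup.mk D.1, D.2.2⟩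
    have hMn : max N (ρ + 1) ≤ n := Int.toNat_le.1 hn
    have hpos : 0 < q ^ ((n : ℤ) - ρ).toNat - 1 := by
      refine Nat.sub_pos_of_lt (Nat.one_lt_pow ?_ hq1)
      have := (le_max_right N (ρ + 1)).trans hMn
      omega
    -- In large degree every class contains an effective divisor, so the finiteness of the set of
    -- classes follows from the finiteness of the set of effective divisors.
    have hsurj : Function.Surjective π := by
      intro c
      have h1 := hfib n hn c.1 c.2
      have h2 : Nat.card {D : effective F k n //
          (QuotientAddGroup.mk D.1 : _ ⧸ principal F k) = c.1} ≠ 0 := by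
        intro h0
        rw [h0, zero_mul] at h1
        omega
      obtain ⟨D, hD⟩ := (Nat.card_ne_zero.1 h2).1
      exact ⟨D, Subtype.ext hD⟩
    have : Finite (Cl n) := Finite.of_surjective π hsurj
    have := Fintype.ofFinite (Cl n)
    rw [Nat.card_congr (Equiv.sigmaFiberEquiv π).symm, Nat.card_sigma, Finset.sum_mul]
    rw [Finset.sum_congr rfl fun c _ => ?_, Finset.sum_const, Finset.card_univ,
      Nat.card_eq_fintype_card, smul_eq_mul]
    rw [← hfib n hn c.1 c.2]
    congr 1
    exact Nat.card_congr (Equiv.subtypeEquivRight fun D => by rw [Subtype.ext_iff])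
  have hCl : ∀ n : ℕ, Nat.card (Cl n) = if g.natAbs ∣ n then h else 0 := by
    intro n
    split_ifs with hd
    · obtain ⟨m, hm⟩ : g ∣ (n : ℤ) := Int.natAbs_dvd.1 (Int.natCast_dvd_natCast.2 hd)
      -- Translation by a multiple of the divisor `D₁` of minimal degree identifies the classes of
      -- degree `n` with those of degree `0`.
      refine Nat.card_congr ((Equiv.subRight (QuotientAddGroup.mk (m • D₁))).subtypeEquiv fun c => ?_)
      have e : classDegree (QuotientAddGroup.mk (m • D₁) : _ ⧸ principal F k) = (n : ℤ) := by
        rw [hm]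
        show degree (m • D₁) = _
        rw [map_zsmul, hD₁, smul_eq_mul, mul_comm]
      show classDegree c = n ↔ classDegree (c - _) = 0
      rw [map_sub, e, sub_eq_zero]
    · rw [Nat.card_eq_zero]
      left
      refine ⟨fun c => hd ?_⟩
      obtain ⟨c, hc⟩ := c
      obtain ⟨A, rfl⟩ := QuotientAddGroup.mk_surjective c
      have hA : A.degree = n := hc
      have := hdvd A
      rw [hA] at this
      exact Int.natCast_dvd_natCast.1 (Int.natAbs_dvd.2 this)
  refine ⟨h * (q : ℝ) ^ (-ρ) / w, h / w, M, fun n hn => ?_⟩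
  have h1 := hcount n hn
  rw [hCl] at h1
  have hwR : (w : ℝ) ≠ 0 := by exact_mod_cast hw0.ne'
  have hqR : (q : ℝ) ≠ 0 := by exact_mod_cast (by omega : q ≠ 0)
  split_ifs at h1 ⊢ with hd
  · have hMn : max N (ρ + 1) ≤ n := Int.toNat_le.1 hn
    have h2 : (0 : ℤ) ≤ n - ρ := by
      have := (le_max_right N (ρ + 1)).trans hMn
      omega
    have h3 : ((q ^ ((n : ℤ) - ρ).toNat - 1 : ℕ) : ℝ) = (q : ℝ) ^ (-ρ) * (q : ℝ) ^ n - 1 := by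
      rw [Nat.cast_sub (Nat.one_le_pow _ _ (by omega)), Nat.cast_pow, Nat.cast_one,
        ← zpow_natCast, Int.toNat_of_nonneg h2,
        show (n : ℤ) - ρ = -ρ + n by ring, zpow_add₀ hqR, zpow_natCast]
    have h4 : (Nat.card (effective F k n) : ℝ) * w = h * ((q : ℝ) ^ (-ρ) * (q : ℝ) ^ n - 1) := by
      rw [← h3]; exact_mod_cast h1
    field_simp
    rw [h4]
  · rw [zero_mul] at h1
    have := (Nat.mul_eq_zero.1 h1).resolve_right hw0.ne'
    exact_mod_cast this

end Divisor

end

noncomputable section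

/-! ### Euler products over free commutative monoids -/

section EulerProduct

variable {P : Type*}

/-- The degree of a finitely supported function, with weights `d`. -/
def weightedDegree (d : P → ℕ) (D : P →₀ ℕ) : ℕ := D.sum fun v m => m * d v

theorem weightedDegree_add (d : P → ℕ) (D E : P →₀ ℕ) :
    weightedDegree d (D + E) = weightedDegree d D + weightedDegree d E :=
  Finsupp.sum_add_index' (fun _ => zero_mul _) fun _ _ _ => add_mul _ _ _

theorem weightedDegree_single (d : P → ℕ) (v : P) (m : ℕ) :
    weightedDegree d (Finsupp.single v m) = m * d v :=
  Finsupp.sum_single_index (zero_mul _)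

theorem hasSum_support_subset (d : P → ℕ) (hd : ∀ v, 0 < d v) {T : ℂ} (hT : ‖T‖ < 1)
    (S : Finset P) : HasSum (fun D : {D : P →₀ ℕ // D.support ⊆ S} => T ^ weightedDegree d D.1)
      (∏ v ∈ S, (1 - T ^ d v)⁻¹) ∧
      Summable fun D : {D : P →₀ ℕ // D.support ⊆ S} => ‖T ^ weightedDegree d D.1‖ := by
  classical
  induction S using Finset.induction_on with
  | empty =>
    have hu : ∀ D : {D : P →₀ ℕ // D.support ⊆ (∅ : Finset P)}, D = ⟨0, by simp⟩ := by
      rintro ⟨D, hD⟩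
      exact Subtype.ext (Finsupp.support_eq_empty.1 (Finset.subset_empty.1 hD))
    have : Unique {D : P →₀ ℕ // D.support ⊆ (∅ : Finset P)} := ⟨⟨⟨0, by simp⟩⟩, hu⟩
    refine ⟨?_, Summable.of_finite⟩
    convert hasSum_fintype _
    rw [Fintype.sum_unique, hu default]
    simp [weightedDegree]
  | insert v S hv ih =>
    have hgeo : HasSum (fun m : ℕ => (T ^ d v) ^ m) (1 - T ^ d v)⁻¹ := by
      apply hasSum_geometric_of_norm_lt_one
      rw [norm_pow]
      exact pow_lt_one₀ (norm_nonneg _) hT (hd v).ne'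
    have hgeo' : Summable fun m : ℕ => ‖(T ^ d v) ^ m‖ := by
      simp only [norm_pow]
      apply summable_geometric_of_lt_one (by positivity)
      exact pow_lt_one₀ (norm_nonneg _) hT (hd v).ne'
    let e : ℕ × {D : P →₀ ℕ // D.support ⊆ S} ≃ {D : P →₀ ℕ // D.support ⊆ insert v S} :=
      { toFun := fun p => ⟨Finsupp.single v p.1 + p.2.1, by
          refine Finsupp.support_add.trans (Finset.union_subset ?_ ?_)
          · exact Finsupp.support_single_subset.trans (by simp)
          · exact p.2.2.trans (Finset.subset_insert _ _)⟩
        invFun := fun D => (D.1 v, ⟨D.1.erase v, by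
          rw [Finsupp.support_erase]
          intro w hw
          rw [Finset.mem_erase] at hw
          exact (Finset.mem_insert.1 (D.2 hw.2)).resolve_left hw.1⟩)
        left_inv := by
          rintro ⟨m, D, hD⟩
          have h0 : D v = 0 := Finsupp.notMem_support_iff.1 fun h => hv (hD h)
          refine Prod.ext (by simp [h0]) (Subtype.ext ?_)
          ext w
          by_cases hw : w = v
          · subst hw; simp [h0]
          · simp [Finsupp.erase_ne hw]
        right_inv := fun D => Subtype.ext (Finsupp.single_add_erase v D.1) }
    have hval : ∀ p, T ^ weightedDegree d (e p).1 = (T ^ d v) ^ p.1 * T ^ weightedDegree d p.2.1 := by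
      intro p
      rw [← pow_mul, ← pow_add]
      congr 1
      show weightedDegree d (Finsupp.single v p.1 + p.2.1) = _
      rw [weightedDegree_add, weightedDegree_single, mul_comm]
    have hs := summable_mul_of_summable_norm hgeo' ih.2
    have hs' := hgeo'.mul_norm ih.2
    rw [Finset.prod_insert hv, ← e.hasSum_iff, ← e.summable_iff]
    refine ⟨?_, ?_⟩
    · have := hgeo.mul ih.1 hs
      rw [show (fun D : {D : P →₀ ℕ // D.support ⊆ insert v S} => T ^ weightedDegree d D.1) ∘ e
          = fun p => (T ^ d v) ^ p.1 * T ^ weightedDegree d p.2.1 from funext hval]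
      exact this
    · exact (summable_congr fun p => by rw [Function.comp_apply, hval]).2 hs'

/-- A finite partial product is the sum over the `D` supported in that finite set, by multiplying
geometric series. Dominated convergence passes to the sum over all `D`. -/
theorem hasProd_of_summable (d : P → ℕ) (hd : ∀ v, 0 < d v) {T : ℂ} (hT : ‖T‖ < 1)
    (hs : Summable fun D : P →₀ ℕ => ‖T‖ ^ weightedDegree d D) :
    HasProd (fun v => (1 - T ^ d v)⁻¹) (∑' D : P →₀ ℕ, T ^ weightedDegree d D) := by
  classical
  let f : (P →₀ ℕ) → ℂ := fun D => T ^ weightedDegree d D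
  let s : Finset P → Set (P →₀ ℕ) := fun S => {D | D.support ⊆ S}
  have h2 : ∀ S : Finset P, ∑' D : P →₀ ℕ, (s S).indicator f D = ∏ v ∈ S, (1 - T ^ d v)⁻¹ := by
    intro S
    have h : HasSum (f ∘ ((↑) : s S → P →₀ ℕ)) (∏ v ∈ S, (1 - T ^ d v)⁻¹) :=
      (hasSum_support_subset d hd hT S).1
    exact (hasSum_subtype_iff_indicator.1 h).tsum_eq
  have h : Filter.Tendsto (fun S : Finset P => ∑' D : P →₀ ℕ, (s S).indicator f D)
      Filter.atTop (𝓝 (∑' D : P →₀ ℕ, f D)) := by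
    refine tendsto_tsum_of_dominated_convergence (bound := fun D => ‖T‖ ^ weightedDegree d D)
      hs (fun D => ?_) (Filter.Eventually.of_forall fun S D => ?_)
    · refine tendsto_const_nhds.congr' ?_
      filter_upwards [Filter.eventually_ge_atTop D.support] with S hS
      have hm : D ∈ s S := hS
      exact (Set.indicator_of_mem hm f).symm
    · have h1 := norm_indicator_le_norm_self (s := s S) f D
      have h3 : ‖f D‖ = ‖T‖ ^ weightedDegree d D := norm_pow _ _
      exact h1.trans h3.le
  rw [HasProd, SummationFilter.unconditional_filter]
  exact h.congr h2

theorem summable_weightedDegree (d : P → ℕ) (b : ℕ → ℕ)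
    (hfin : ∀ n, Finite {D : P →₀ ℕ // weightedDegree d D = n})
    (hb : ∀ n, Nat.card {D : P →₀ ℕ // weightedDegree d D = n} = b n) {x : ℝ} (hx : 0 ≤ x)
    (hs : Summable fun n => (b n : ℝ) * x ^ n) :
    Summable fun D : P →₀ ℕ => x ^ weightedDegree d D := by
  let e := Equiv.sigmaFiberEquiv (weightedDegree d)
  rw [← e.summable_iff]
  have he : (fun D : P →₀ ℕ => x ^ weightedDegree d D) ∘ e = fun p => x ^ p.1 :=
    funext fun p => congrArg (x ^ ·) p.2.2
  rw [he, summable_sigma_of_nonneg (fun _ => pow_nonneg hx _)]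
  refine ⟨fun n => Summable.of_finite, hs.congr fun n => ?_⟩
  dsimp only
  rw [tsum_const, nsmul_eq_mul, hb]

theorem tsum_weightedDegree (d : P → ℕ) (b : ℕ → ℕ)
    (hb : ∀ n, Nat.card {D : P →₀ ℕ // weightedDegree d D = n} = b n) {x : ℂ}
    (hs : Summable fun D : P →₀ ℕ => x ^ weightedDegree d D) :
    ∑' D : P →₀ ℕ, x ^ weightedDegree d D = ∑' n, (b n : ℂ) * x ^ n := by
  let e := Equiv.sigmaFiberEquiv (weightedDegree d)
  have he : (fun D : P →₀ ℕ => x ^ weightedDegree d D) ∘ e = fun p => x ^ p.1 :=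
    funext fun p => congrArg (x ^ ·) p.2.2
  rw [← e.summable_iff, he] at hs
  have h := e.tsum_eq (fun D : P →₀ ℕ => x ^ weightedDegree d D)
  rw [← h, show (fun p => x ^ weightedDegree d (e p)) = fun p => x ^ p.1 from he, hs.tsum_sigma]
  refine tsum_congr fun n => ?_
  dsimp only
  rw [tsum_const, nsmul_eq_mul, hb]

theorem summable_of_eventually_eq (b : ℕ → ℝ) (q α β : ℝ) (hq : 1 < q) (δ M : ℕ)
    (h : ∀ n ≥ M, b n = if δ ∣ n then α * q ^ n - β else 0) {x : ℝ} (hx : 0 ≤ x)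
    (hxq : x < q⁻¹) : Summable fun n => b n * x ^ n := by
  have hq0 : 0 < q := one_pos.trans hq
  have hx1 : x < 1 := hxq.trans (inv_lt_one_of_one_lt₀ hq)
  have hqx : q * x < 1 := by
    rw [← mul_inv_cancel₀ hq0.ne']
    exact mul_lt_mul_of_pos_left hxq hq0
  refine Summable.of_norm_bounded_eventually_nat
    (g := fun n => |α| * (q * x) ^ n + |β| * x ^ n) ?_ ?_
  · exact ((summable_geometric_of_lt_one (by positivity) hqx).mul_left _).add
      ((summable_geometric_of_lt_one hx hx1).mul_left _)
  · filter_upwards [Filter.eventually_ge_atTop M] with n hn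
    rw [norm_mul, norm_pow, Real.norm_of_nonneg hx, mul_pow, ← mul_assoc, ← add_mul]
    refine mul_le_mul_of_nonneg_right ?_ (pow_nonneg hx _)
    rw [h n hn, Real.norm_eq_abs]
    split_ifs
    · refine (abs_sub _ _).trans ?_
      rw [abs_mul, abs_of_nonneg (pow_nonneg hq0.le n)]
    · rw [abs_zero]; positivity

/-- The tail begins at `δ * M` rather than `M`, so the nonzero terms are exactly those with `i`
divisible by `δ`, and two geometric series result. -/
theorem hasSum_tail_of_eventually_eq (b : ℕ → ℝ) (q α β : ℝ) (hq : 1 < q) (δ M : ℕ) (hδ : 0 < δ)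
    (h : ∀ n ≥ M, b n = if δ ∣ n then α * q ^ n - β else 0) {T : ℂ} (hT : ‖T‖ < q⁻¹) :
    HasSum (fun i => (b (i + δ * M) : ℂ) * T ^ (i + δ * M))
      ((α : ℂ) * (q : ℂ) ^ (δ * M) * T ^ (δ * M) / (1 - ((q : ℂ) * T) ^ δ)
        - β * T ^ (δ * M) / (1 - T ^ δ)) := by
  have hq0 : 0 < q := one_pos.trans hq
  have hT1 : ‖T‖ < 1 := hT.trans (inv_lt_one_of_one_lt₀ hq)
  have hqT : q * ‖T‖ < 1 := by
    rw [← mul_inv_cancel₀ hq0.ne']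
    exact mul_lt_mul_of_pos_left hT hq0
  have hMM : M ≤ δ * M := Nat.le_mul_of_pos_left _ hδ
  have hinj : Function.Injective fun j : ℕ => δ * j := fun i j h =>
    Nat.eq_of_mul_eq_mul_left hδ h
  rw [← hinj.hasSum_iff]
  · have h1 : HasSum (fun j : ℕ => (((q : ℂ) * T) ^ δ) ^ j) (1 - ((q : ℂ) * T) ^ δ)⁻¹ := by
      apply hasSum_geometric_of_norm_lt_one
      rw [norm_pow, norm_mul, Complex.norm_real, Real.norm_of_nonneg hq0.le]
      exact pow_lt_one₀ (mul_nonneg hq0.le (norm_nonneg _)) hqT hδ.ne'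
    have h2 : HasSum (fun j : ℕ => (T ^ δ) ^ j) (1 - T ^ δ)⁻¹ := by
      apply hasSum_geometric_of_norm_lt_one
      rw [norm_pow]
      exact pow_lt_one₀ (norm_nonneg _) hT1 hδ.ne'
    have h3 := (h1.mul_left ((α : ℂ) * (q : ℂ) ^ (δ * M) * T ^ (δ * M))).sub
      (h2.mul_left (β * T ^ (δ * M)))
    rw [← div_eq_mul_inv, ← div_eq_mul_inv] at h3
    refine h3.congr_fun fun j => ?_
    rw [Function.comp_apply, h _ (hMM.trans (Nat.le_add_left _ _)), if_pos ⟨j + M, by ring⟩]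
    push_cast
    rw [mul_pow, pow_add, pow_add, ← pow_mul, mul_pow, ← pow_mul, ← pow_mul]
    ring
  · intro i hi
    have hd : ¬ δ ∣ i + δ * M := by
      rw [Nat.dvd_add_left (Dvd.intro _ rfl)]
      rintro ⟨j, rfl⟩
      exact hi ⟨j, rfl⟩
    rw [h _ (hMM.trans (Nat.le_add_left _ _)), if_neg hd]
    simp

end EulerProduct

/-! ### The zeta function of a function field -/

variable {F k : Type*} [Field F] [Fintype F] [Field k] [Algebra F k] [IsOneVariable F k]

/-- Effective divisors as functions with values in `ℕ`. -/
def Divisor.effectiveEquiv (n : ℕ) :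
    {D : Place F k →₀ ℕ // weightedDegree Place.deg D = n} ≃ Divisor.effective F k n where
  toFun D := ⟨D.1.mapRange (fun m : ℕ => (m : ℤ)) rfl, fun v => by simp, by
    have h : ((weightedDegree Place.deg D.1 : ℕ) : ℤ) = n := by rw [D.2]
    rw [← h, weightedDegree, Divisor.degree_apply, Finsupp.sum_mapRange_index (by simp),
      Finsupp.sum, Finsupp.sum]
    push_cast
    rfl⟩
  invFun D := ⟨D.1.mapRange Int.toNat rfl, by
    have h := D.2.2
    rw [Divisor.degree_apply] at h
    zify
    rw [← h, weightedDegree, Finsupp.sum_mapRange_index (by simp), Finsupp.sum, Finsupp.sum]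
    push_cast
    refine Finset.sum_congr rfl fun v _ => ?_
    rw [Int.toNat_of_nonneg (D.2.1 v)]⟩
  left_inv D := by
    refine Subtype.ext (Finsupp.ext fun v => ?_)
    simp
  right_inv D := by
    refine Subtype.ext (Finsupp.ext fun v => ?_)
    have : (0 : ℤ) ≤ D.1 v := D.2.1 v
    simp [this]

/-- The Euler product is the generating series of effective divisors: the finitely many small
degrees give the polynomial `N` and the others two geometric series. Only the shape of the
denominators, and `δ ∣ v.deg`, matter for the value at `s = 0`; the functional equation and `δ = 1`
do not. -/
theorem exists_zeta (F k : Type*) [Field F] [Fintype F] [Field k] [Algebra F k]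
    [IsOneVariable F k] : ∃ (δ : ℕ) (N : Polynomial ℂ) (A B : Polynomial ℂ), 0 < δ ∧
    (∀ v : Place F k, δ ∣ v.deg) ∧ ∀ T : ℂ, ‖T‖ < (Fintype.card F : ℝ)⁻¹ →
      HasProd (fun v : Place F k => (1 - T ^ v.deg)⁻¹)
        (N.eval T + A.eval T / (1 - ((Fintype.card F : ℂ) * T) ^ δ) + B.eval T / (1 - T ^ δ)) := by
  obtain ⟨δ, hδ0, hδ, α, β, M, hM⟩ := Divisor.exists_card_effective_eq (F := F) (k := k)
  have hq1 : (1 : ℝ) < (Fintype.card F : ℝ) := by exact_mod_cast Fintype.one_lt_card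
  generalize hq : Fintype.card F = q at *
  let b : ℕ → ℕ := fun n => Nat.card (Divisor.effective F k n)
  refine ⟨δ, ∑ n ∈ Finset.range (δ * M), Polynomial.C (b n : ℂ) * Polynomial.X ^ n,
    Polynomial.C ((α : ℂ) * (q : ℂ) ^ (δ * M)) * Polynomial.X ^ (δ * M),
    -(Polynomial.C (β : ℂ) * Polynomial.X ^ (δ * M)), hδ0, hδ, fun T hT => ?_⟩
  have hT1 : ‖T‖ < 1 := hT.trans (inv_lt_one_of_one_lt₀ hq1)
  have hfib : ∀ n, Nat.card {D : Place F k →₀ ℕ // weightedDegree Place.deg D = n} = b n := fun n =>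
    Nat.card_congr (Divisor.effectiveEquiv n)
  have hfin : ∀ n, Finite {D : Place F k →₀ ℕ // weightedDegree Place.deg D = n} := fun n =>
    have := (Divisor.finite_effective (F := F) (k := k) n).to_subtype
    Finite.of_equiv _ (Divisor.effectiveEquiv n).symm
  have hbsum : Summable fun n => (b n : ℝ) * ‖T‖ ^ n :=
    summable_of_eventually_eq (fun n => (b n : ℝ)) q α β hq1 δ M hM (norm_nonneg T) hT
  have hs := summable_weightedDegree (Place.deg (F := F) (k := k)) b hfin hfib (norm_nonneg T) hbsum
  have hsT : Summable fun D : Place F k →₀ ℕ => T ^ weightedDegree Place.deg D :=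
    Summable.of_norm (by simpa only [norm_pow] using hs)
  have hbT : Summable fun n => (b n : ℂ) * T ^ n := by
    refine Summable.of_norm (hbsum.congr fun n => ?_)
    rw [norm_mul, norm_pow, Complex.norm_natCast]
  have htail := hasSum_tail_of_eventually_eq (fun n => (b n : ℝ)) q α β hq1 δ M hδ0 hM hT
  simp only [Complex.ofReal_natCast] at htail
  have := hasProd_of_summable (Place.deg (F := F) (k := k)) Place.deg_pos hT1 hs
  rw [tsum_weightedDegree _ b hfib hsT, ← hbT.sum_add_tsum_nat_add (δ * M), htail.tsum_eq] at this
  convert this using 1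
  simp only [Polynomial.eval_finsetSum, Polynomial.eval_mul, Polynomial.eval_C,
    Polynomial.eval_pow, Polynomial.eval_X, Polynomial.eval_neg]
  ring

end

noncomputable section

/-! ### Primitive invariants of Young subgroups -/

section YoungAction

variable {E : Type*} [AddCommGroup E] [Module ℚ E] {ι Λ : Type*} [Fintype ι] [DecidableEq ι]
  [DecidableEq Λ]

/-- `W` acts on `E`, which is spanned by vectors `x i` with the only relation `∑ x i = 0`,
by the permutations of the index set which preserve the fibres of `lam`. -/
structure IsYoungAction (W : Set (E →ₗ[ℚ] E)) (x : ι → E) (lam : ι → Λ) : Prop where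
  span_eq_top : Submodule.span ℚ (Set.range x) = ⊤
  sum_eq_zero : ∑ i, x i = 0
  exists_functional : ∀ c : ι → ℂ, ∑ i, c i = 0 → ∃ l : E →ₗ[ℚ] ℂ, ∀ i, l (x i) = c i
  exists_perm : ∀ w ∈ W, ∃ ρ : Equiv.Perm ι, (∀ i, lam (ρ i) = lam i) ∧ ∀ i, w (x i) = x (ρ i)
  exists_mem : ∀ ρ : Equiv.Perm ι, (∀ i, lam (ρ i) = lam i) → ∃ w ∈ W, ∀ i, w (x i) = x (ρ i)

/-- The power sum of degree `d` of the vectors in a fibre of `lam`. -/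
def blockSum (x : ι → E) (lam : ι → Λ) (d : ℕ) (μ : Λ) : SymmetricAlgebra ℚ E :=
  ∑ i with lam i = μ, SymmetricAlgebra.ι ℚ E (x i) ^ d

/-- The sum of the translates of a monomial under the Young subgroup. -/
def orbitSum (x : ι → E) (lam : ι → Λ) (e : ι → ℕ) : SymmetricAlgebra ℚ E :=
  ∑ ρ : Equiv.Perm ι with ∀ i, lam (ρ i) = lam i, ∏ i, SymmetricAlgebra.ι ℚ E (x (ρ i)) ^ e i

theorem symMap_ι (f : E →ₗ[ℚ] E) (y : E) :
    symMap f (SymmetricAlgebra.ι ℚ E y) = SymmetricAlgebra.ι ℚ E (f y) := by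
  simp [symMap]

theorem _root_.MvPolynomial.esymm_isHomogeneous (σ R : Type*) [Fintype σ] [CommSemiring R] (k : ℕ) :
    (MvPolynomial.esymm σ R k).IsHomogeneous k := by
  refine MvPolynomial.IsHomogeneous.sum _ _ _ fun s hs => ?_
  rw [← (Finset.mem_powersetCard.1 hs).2, Finset.card_eq_sum_ones]
  exact MvPolynomial.IsHomogeneous.prod _ _ _ fun i _ => MvPolynomial.isHomogeneous_X _ _

theorem _root_.MvPolynomial.psum_isHomogeneous (σ R : Type*) [Fintype σ] [CommSemiring R] (k : ℕ) :
    (MvPolynomial.psum σ R k).IsHomogeneous k :=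
  MvPolynomial.IsHomogeneous.sum _ _ _ fun i _ => MvPolynomial.isHomogeneous_X_pow i k

theorem prod_ι_pow_mem (y : ι → E) (e : ι → ℕ) (s : Finset ι) :
    ∏ i ∈ s, SymmetricAlgebra.ι ℚ E (y i) ^ e i
      ∈ (LinearMap.range (SymmetricAlgebra.ι ℚ E)) ^ (∑ i ∈ s, e i) := by
  induction s using Finset.induction_on with
  | empty => simp
  | insert i s hi ih =>
    rw [Finset.prod_insert hi, Finset.sum_insert hi, pow_add]
    exact Submodule.mul_mem_mul (Submodule.pow_mem_pow _ (LinearMap.mem_range_self _ _) _) ih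

theorem mul_mem_decomposablesDeg {W : Set (E →ₗ[ℚ] E)} {a b d : ℕ} (ha : 1 ≤ a) (hb : 1 ≤ b)
    (hd : a + b = d) {r s : SymmetricAlgebra ℚ E} (hr : r ∈ invariantsDeg W a)
    (hs : s ∈ invariantsDeg W b) : r * s ∈ decomposablesDeg W d :=
  Submodule.mem_iSup_of_mem (p := fun ij : {ij : ℕ × ℕ // 1 ≤ ij.1 ∧ 1 ≤ ij.2 ∧ ij.1 + ij.2 = d} =>
    invariantsDeg W ij.1.1 * invariantsDeg W ij.1.2) ⟨(a, b), ha, hb, hd⟩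
    (Submodule.mul_mem_mul hr hs)

variable {W : Set (E →ₗ[ℚ] E)} {x : ι → E} {lam : ι → Λ}

theorem orbitSum_comp (e : ι → ℕ) (π : Equiv.Perm ι) (hπ : ∀ i, lam (π i) = lam i) :
    orbitSum x lam (e ∘ π) = orbitSum x lam e := by
  unfold orbitSum
  refine Finset.sum_bij' (fun ρ _ => ρ * π⁻¹) (fun ρ _ => ρ * π) ?_ ?_ (by simp) (by simp) ?_
  · intro ρ hρ
    simp only [Finset.mem_filter, Finset.mem_univ, true_and] at hρ ⊢
    intro i
    rw [Equiv.Perm.mul_apply, hρ, ← hπ]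
    simp
  · intro ρ hρ
    simp only [Finset.mem_filter, Finset.mem_univ, true_and] at hρ ⊢
    intro i
    rw [Equiv.Perm.mul_apply, hρ, hπ]
  · intro ρ _
    rw [← Equiv.prod_comp π fun i => SymmetricAlgebra.ι ℚ E (x ((ρ * π⁻¹) i)) ^ e i]
    simp

theorem blockSum_perm (d : ℕ) (μ : Λ) (ρ : Equiv.Perm ι) (hρ : ∀ i, lam (ρ i) = lam i) :
    ∑ i with lam i = μ, SymmetricAlgebra.ι ℚ E (x (ρ i)) ^ d = blockSum x lam d μ := by
  unfold blockSum
  refine Finset.sum_bij' (fun i _ => ρ i) (fun i _ => ρ.symm i) ?_ ?_ (by simp) (by simp) (by simp)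
  · intro i hi
    simpa [hρ] using hi
  · intro i hi
    rw [Finset.mem_filter] at hi ⊢
    refine ⟨Finset.mem_univ _, ?_⟩
    rw [← hρ, Equiv.apply_symm_apply, hi.2]

/-- A power sum is invariant under the Young subgroup, so it can be moved inside the orbit sum,
where its `j`-th term raises the exponent at `j` by `k`. -/
theorem blockSum_mul_orbitSum (k : ℕ) (μ : Λ) (e : ι → ℕ) :
    blockSum x lam k μ * orbitSum x lam e
      = ∑ j with lam j = μ, orbitSum x lam (e + Pi.single j k) := by
  unfold orbitSum
  rw [Finset.sum_comm, Finset.mul_sum]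
  refine Finset.sum_congr rfl fun ρ hρ => ?_
  rw [← blockSum_perm k μ ρ (Finset.mem_filter.1 hρ).2, Finset.sum_mul]
  refine Finset.sum_congr rfl fun j _ => ?_
  simp only [Pi.add_apply, pow_add, Finset.prod_mul_distrib]
  rw [mul_comm]
  congr 1
  rw [Finset.prod_eq_single j (fun i _ hi => by simp [hi]) (by simp)]
  simp

theorem apply_swap_eq {i j : ι} (h : lam i = lam j) (l : ι) : lam (Equiv.swap i j l) = lam l := by
  rw [Equiv.swap_apply_def]
  split_ifs with h1 h2
  · rw [h1, h]
  · rw [h2, h]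
  · rfl

theorem orbitSum_add_single (k : ℕ) {i j : ι} (e : ι → ℕ) (h : lam i = lam j) (hi : e i = 0)
    (hj : e j = 0) :
    orbitSum x lam (e + Pi.single j k) = orbitSum x lam (e + Pi.single i k) := by
  have h0 : e + Pi.single j k = (e + Pi.single i k : ι → ℕ) ∘ Equiv.swap i j := by
    funext l
    rcases eq_or_ne l i with rfl | h1
    · simp [hi, hj, Pi.single_apply, eq_comm]
    · rcases eq_or_ne l j with rfl | h2
      · simp [hi, hj]
      · simp [Equiv.swap_apply_of_ne_of_ne h1 h2, h1, h2]
  rw [h0]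
  exact orbitSum_comp _ _ (apply_swap_eq h)

theorem symMap_orbitSum {w : E →ₗ[ℚ] E} {π : Equiv.Perm ι} (hπ : ∀ i, lam (π i) = lam i)
    (hw : ∀ i, w (x i) = x (π i)) (e : ι → ℕ) :
    symMap w (orbitSum x lam e) = orbitSum x lam e := by
  unfold orbitSum
  rw [map_sum]
  refine Finset.sum_bij' (fun ρ _ => π * ρ) (fun ρ _ => π⁻¹ * ρ) ?_ ?_ (by simp) (by simp) ?_
  · intro ρ hρ
    simp only [Finset.mem_filter, Finset.mem_univ, true_and] at hρ ⊢
    intro i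
    rw [Equiv.Perm.mul_apply, hπ, hρ]
  · intro ρ hρ
    simp only [Finset.mem_filter, Finset.mem_univ, true_and] at hρ ⊢
    intro i
    rw [← hπ, ← hρ i]
    simp
  · intro ρ _
    rw [map_prod]
    refine Finset.prod_congr rfl fun i _ => ?_
    rw [map_pow, symMap_ι, hw]
    rfl

namespace IsYoungAction

variable (hW : IsYoungAction W x lam)
include hW

theorem orbitSum_mem (e : ι → ℕ) : orbitSum x lam e ∈ invariantsDeg W (∑ i, e i) := by
  refine ⟨Submodule.sum_mem _ fun ρ _ => prod_ι_pow_mem _ _ _, fun w hw => ?_⟩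
  obtain ⟨π, hπ, h⟩ := hW.exists_perm w hw
  exact symMap_orbitSum hπ h e

theorem blockSum_mem (d : ℕ) (μ : Λ) : blockSum x lam d μ ∈ invariantsDeg W d := by
  refine ⟨Submodule.sum_mem _ fun i _ => Submodule.pow_mem_pow _ (LinearMap.mem_range_self _ _) _,
    fun w hw => ?_⟩
  obtain ⟨π, hπ, h⟩ := hW.exists_perm w hw
  refine Eq.trans ?_ (blockSum_perm d μ π hπ)
  rw [blockSum, map_sum]
  simp [symMap_ι, h]

/-- Induction on the number of nonzero exponents. Splitting off one exponent `k` leaves `f`; the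
product of the power sum of degree `k` and the orbit sum of `f` is a positive multiple of the wanted
orbit sum plus orbit sums with fewer nonzero exponents. -/
theorem orbitSum_mem_sup (e : ι → ℕ) (he : e ≠ 0) : orbitSum x lam e ∈
    decomposablesDeg W (∑ i, e i) ⊔ Submodule.span ℚ (Set.range (blockSum x lam (∑ i, e i))) := by
  induction hc : (Finset.univ.filter fun i => e i ≠ 0).card using Nat.strong_induction_on
    generalizing e with
  | _ c ih =>
    obtain ⟨i, hi⟩ := Function.ne_iff.1 he
    rw [Pi.zero_apply] at hi
    set k := e i with hk
    set f := Function.update e i 0 with hf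
    have hfi : f i = 0 := by simp [hf]
    have hef : e = f + Pi.single i k := by
      funext l
      rcases eq_or_ne l i with rfl | hl
      · simp [hf, hk]
      · simp [hf, hl]
    have hsum : ∀ j, ∑ l, (f + Pi.single j k : ι → ℕ) l = ∑ l, e l := by
      intro j
      rw [hef]
      simp [Finset.sum_add_distrib]
    have hmul := blockSum_mul_orbitSum (x := x) (lam := lam) k (lam i) f
    -- If `f j = 0`, placing `k` at `j` gives the same orbit sum as placing it at `i`; otherwise two
    -- exponents have merged and the induction applies.
    rw [← Finset.sum_filter_add_sum_filter_not _ (fun j => f j = 0)] at hmul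
    rw [Finset.sum_congr rfl (g := fun _ => orbitSum x lam e) (fun j hj => by
      rw [Finset.mem_filter, Finset.mem_filter] at hj
      rw [hef, orbitSum_add_single k f hj.1.2.symm hfi hj.2]), Finset.sum_const] at hmul
    have hpos : 0 < ((Finset.univ.filter (fun j => lam j = lam i)).filter (fun j => f j = 0)).card :=
      Finset.card_pos.2 ⟨i, by simp [hfi]⟩
    set N := ((Finset.univ.filter (fun j => lam j = lam i)).filter (fun j => f j = 0)).card
    set U := decomposablesDeg W (∑ i, e i) ⊔
      Submodule.span ℚ (Set.range (blockSum x lam (∑ i, e i)))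
    have hrest : ∀ j ∈ (Finset.univ.filter (fun j => lam j = lam i)).filter (fun j => ¬ f j = 0),
        orbitSum x lam (f + Pi.single j k) ∈ U := by
      intro j hj
      rw [Finset.mem_filter, Finset.mem_filter] at hj
      have h := ih _ ?_ (f + Pi.single j k) ?_ rfl
      · rwa [hsum] at h
      · rw [← hc]
        refine Finset.card_lt_card ⟨fun l hl => ?_, fun h => ?_⟩
        · simp only [Finset.mem_filter, Finset.mem_univ, true_and, Pi.add_apply] at hl ⊢
          rcases eq_or_ne l i with rfl | h1
          · exact hi
          · rcases eq_or_ne l j with rfl | h2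
            · have := hj.2
              simpa [hf, h1] using this
            · simpa [hf, h1, h2] using hl
        · have h1 : i ∈ Finset.univ.filter fun l => e l ≠ 0 := by simpa using hi
          have h2 := h h1
          have hij : i ≠ j := by
            rintro rfl
            exact hj.2 hfi
          simp [hfi, hij] at h2
      · intro h
        have := congrFun h j
        simp [hj.2] at this
    have hprod : blockSum x lam k (lam i) * orbitSum x lam f ∈ U := by
      -- With no other exponent the product is not decomposable: the orbit sum of `0` is the order
      -- of the group, and a multiple of a power sum remains.
      by_cases hf0 : f = 0
      · have h0 : orbitSum x lam 0 = algebraMap ℚ (SymmetricAlgebra ℚ E)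
            (Finset.univ.filter fun ρ : Equiv.Perm ι => ∀ i, lam (ρ i) = lam i).card := by
          simp [orbitSum]
        have hk' : ∑ l, e l = k := by
          rw [hef, hf0]
          simp
        rw [hf0, h0, mul_comm, ← Algebra.smul_def]
        refine Submodule.smul_mem _ _ (Submodule.mem_sup_right (Submodule.subset_span ⟨lam i, ?_⟩))
        rw [hk']
      · refine Submodule.mem_sup_left (mul_mem_decomposablesDeg (Nat.one_le_iff_ne_zero.2 hi) ?_ ?_
          (hW.blockSum_mem k (lam i)) (hW.orbitSum_mem f))
        · obtain ⟨j, hj⟩ := Function.ne_iff.1 hf0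
          exact (Nat.one_le_iff_ne_zero.2 hj).trans
            (Finset.single_le_sum (f := f) (fun _ _ => Nat.zero_le _) (Finset.mem_univ j))
        · rw [hef]
          simp [Finset.sum_add_distrib, add_comm]
    have hN : N • orbitSum x lam e ∈ U := by
      rw [eq_sub_of_add_eq hmul.symm]
      exact sub_mem hprod (Submodule.sum_mem _ hrest)
    rw [← Nat.cast_smul_eq_nsmul ℚ] at hN
    exact (Submodule.smul_mem_iff _ (by exact_mod_cast hpos.ne')).1 hN

theorem aeval_mem_iff {d : ℕ} : Submodule.map (MvPolynomial.aeval (R := ℚ)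
      fun i => SymmetricAlgebra.ι ℚ E (x i)).toLinearMap (MvPolynomial.homogeneousSubmodule ι ℚ d)
      = (LinearMap.range (SymmetricAlgebra.ι ℚ E)) ^ d := by
  rw [← MvPolynomial.homogeneousSubmodule_one_pow, Submodule.map_pow]
  congr 1
  rw [MvPolynomial.homogeneousSubmodule_one_eq_span_X, Submodule.map_span, ← Set.range_comp,
    ← Submodule.map_top, ← hW.span_eq_top, Submodule.map_span, ← Set.range_comp]
  congr 2
  funext i
  simp

/-- Averaging over the Young subgroup: an invariant, lifted to a polynomial in the `x i`, is equal
to each of its translates, so the order of the group times it is a combination of orbit sums. -/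
theorem le_span_orbitSum (d : ℕ) : invariantsDeg W d ≤
    Submodule.span ℚ (orbitSum x lam '' {e | ∑ i, e i = d}) := by
  rintro r ⟨hr, hinv⟩
  rw [← hW.aeval_mem_iff] at hr
  obtain ⟨p, hp, rfl⟩ := hr
  set G := Finset.univ.filter fun ρ : Equiv.Perm ι => ∀ i, lam (ρ i) = lam i with hG
  set r := MvPolynomial.aeval (R := ℚ) (fun i => SymmetricAlgebra.ι ℚ E (x i)) p with hr
  have h1 : ∀ ρ ∈ G, r = ∑ m ∈ p.support, p.coeff m •
      ∏ i, SymmetricAlgebra.ι ℚ E (x (ρ i)) ^ m i := by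
    intro ρ hρ
    obtain ⟨w, hw, hx⟩ := hW.exists_mem ρ (Finset.mem_filter.1 hρ).2
    have := hinv w hw
    refine this.symm.trans ?_
    change symMap w r = _
    rw [hr, MvPolynomial.aeval_def, MvPolynomial.eval₂_eq', map_sum]
    refine Finset.sum_congr rfl fun m _ => ?_
    rw [map_mul, AlgHom.commutes, ← Algebra.smul_def, map_prod]
    simp [symMap_ι, hx]
  have h2 : G.card • r = ∑ m ∈ p.support, p.coeff m • orbitSum x lam m := by
    rw [← Finset.sum_const, Finset.sum_congr rfl h1, Finset.sum_comm]
    simp only [orbitSum, Finset.smul_sum]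
    rfl
  have h3 : 0 < G.card := Finset.card_pos.2 ⟨1, by simp [hG]⟩
  have h4 : G.card • r ∈ Submodule.span ℚ (orbitSum x lam '' {e | ∑ i, e i = d}) := by
    rw [h2]
    refine Submodule.sum_mem _ fun m hm => Submodule.smul_mem _ _ (Submodule.subset_span ⟨m, ?_, rfl⟩)
    have := hp (MvPolynomial.mem_support_iff.1 hm)
    rw [Finsupp.weight_apply] at this
    rw [Set.mem_ofPred_eq, ← this, Finsupp.sum_fintype _ _ (by simp)]
    simp
  rw [← Nat.cast_smul_eq_nsmul ℚ] at h4
  exact (Submodule.smul_mem_iff _ (by exact_mod_cast h3.ne')).1 h4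

theorem le_sup (d : ℕ) (hd : 1 ≤ d) : invariantsDeg W d ≤
    decomposablesDeg W d ⊔ Submodule.span ℚ (Set.range (blockSum x lam d)) := by
  refine (hW.le_span_orbitSum d).trans (Submodule.span_le.2 ?_)
  rintro _ ⟨e, rfl, rfl⟩
  refine hW.orbitSum_mem_sup e ?_
  rintro rfl
  simp at hd

open MvPolynomial in
theorem aeval_mem_invariantsDeg {μ : Λ} {k : ℕ} {p : MvPolynomial {i // lam i = μ} ℚ}
    (hp : p.IsSymmetric) (hk : p.IsHomogeneous k) :
    aeval (R := ℚ) (fun i : {i // lam i = μ} => SymmetricAlgebra.ι ℚ E (x i)) p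
      ∈ invariantsDeg W k := by
  constructor
  · have h1 : (homogeneousSubmodule {i // lam i = μ} ℚ 1).map (aeval (R := ℚ)
        fun i : {i // lam i = μ} => SymmetricAlgebra.ι ℚ E (x i)).toLinearMap
        ≤ LinearMap.range (SymmetricAlgebra.ι ℚ E) := by
      rw [homogeneousSubmodule_one_eq_span_X, Submodule.map_span, Submodule.span_le]
      rintro _ ⟨_, ⟨i, rfl⟩, rfl⟩
      exact ⟨x i, by simp⟩
    have h2 := pow_le_pow_left' h1 k
    rw [← Submodule.map_pow, homogeneousSubmodule_one_pow] at h2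
    exact h2 (Submodule.mem_map_of_mem hk)
  · intro w hw
    obtain ⟨π, hπ, h⟩ := hW.exists_perm w hw
    let π' : Equiv.Perm {i // lam i = μ} := π.subtypePerm fun i => by rw [hπ]
    conv_rhs => rw [← hp π']
    rw [aeval_rename, ← AlgHom.comp_apply]
    congr 1
    ext i
    simp [symMap_ι, h, π']

/-- Newton's identity: the elementary symmetric polynomial of degree `d` in fewer than `d` variables
is zero, so the power sum is a combination of products of invariants of lower positive degree. -/
theorem blockSum_mem_decomposablesDeg {d : ℕ} (hd : 1 ≤ d) {μ : Λ}
    (hμ : Fintype.card {i // lam i = μ} < d) : blockSum x lam d μ ∈ decomposablesDeg W d := by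
  have h1 := MvPolynomial.psum_eq_mul_esymm_sub_sum {i // lam i = μ} ℚ d hd
  have h2 : MvPolynomial.esymm {i // lam i = μ} ℚ d = 0 := by
    rw [MvPolynomial.esymm, Finset.powersetCard_eq_empty.2 (by simpa using hμ), Finset.sum_empty]
  have h3 : blockSum x lam d μ = MvPolynomial.aeval (R := ℚ)
      (fun i : {i // lam i = μ} => SymmetricAlgebra.ι ℚ E (x i)) (MvPolynomial.psum _ ℚ d) := by
    rw [MvPolynomial.psum, map_sum, blockSum, Finset.sum_subtype (p := fun i => lam i = μ)
      (F := inferInstance) _ (by simp)]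
    simp
  rw [h3, h1, h2, mul_zero, zero_sub, map_neg, map_sum]
  refine neg_mem (Submodule.sum_mem _ fun a ha => ?_)
  rw [Finset.mem_filter, Finset.HasAntidiagonal.mem_antidiagonal] at ha
  rw [mul_assoc, map_mul, map_pow, map_neg, map_one]
  have h4 := mul_mem_decomposablesDeg (W := W) (Nat.one_le_iff_ne_zero.2 ha.2.1.ne')
    (by have := ha.2.2; omega : 1 ≤ a.2) ha.1
    (hW.aeval_mem_invariantsDeg (μ := μ) (MvPolynomial.esymm_isSymmetric _ ℚ a.1)
      (MvPolynomial.esymm_isHomogeneous _ ℚ a.1))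
    (hW.aeval_mem_invariantsDeg (μ := μ) (MvPolynomial.psum_isSymmetric _ ℚ a.2)
      (MvPolynomial.psum_isHomogeneous _ ℚ a.2))
  rw [map_mul]
  rcases neg_one_pow_eq_or (SymmetricAlgebra ℚ E) a.1 with h | h
  · rw [h, one_mul]
    exact h4
  · rw [h, neg_one_mul]
    exact neg_mem h4

end IsYoungAction

end YoungAction
end

/-! ### Independence of the power sums modulo decomposables -/

noncomputable section

section YoungAction

variable {E : Type*} [AddCommGroup E] [Module ℚ E] {ι Λ : Type*} [Fintype ι] [DecidableEq ι]
  [DecidableEq Λ] {W : Set (E →ₗ[ℚ] E)} {x : ι → E} {lam : ι → Λ}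

/-- A linear functional on the primitive invariants, given by evaluation at a point where the
decomposable invariants vanish. -/
def primitivesEval (d : ℕ) (l : E →ₗ[ℚ] ℂ)
    (h : ∀ r ∈ decomposablesDeg W d, SymmetricAlgebra.lift l r = 0) : primitives W d →ₗ[ℚ] ℂ :=
  Submodule.liftQ _ ((SymmetricAlgebra.lift l).toLinearMap ∘ₗ (invariantsDeg W d).subtype)
    fun r hr => h r.1 hr

theorem lift_blockSum (l : E →ₗ[ℚ] ℂ) (d : ℕ) (μ : Λ) :
    SymmetricAlgebra.lift l (blockSum x lam d μ) = ∑ i with lam i = μ, l (x i) ^ d := by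
  simp [blockSum]

theorem lift_symMap_of_mem_pow (l : E →ₗ[ℚ] ℂ) (w : E →ₗ[ℚ] E) (c : ℂ) (h : ∀ y, l (w y) = c * l y)
    (k : ℕ) (r : SymmetricAlgebra ℚ E) (hr : r ∈ LinearMap.range (SymmetricAlgebra.ι ℚ E) ^ k) :
    SymmetricAlgebra.lift l (symMap w r) = c ^ k * SymmetricAlgebra.lift l r := by
  induction hr using Submodule.pow_induction_on_left' with
  | algebraMap r => simp
  | add a b k ha hb h1 h2 => simp only [map_add, h1, h2, mul_add]
  | mem_mul m hm k a ha ih =>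
    obtain ⟨y, rfl⟩ := hm
    simp only [map_mul, ih, symMap_ι, SymmetricAlgebra.lift_ι_apply, h, pow_succ]
    ring

theorem algHom_eq_zero_of_mem_decomposablesDeg (φ : SymmetricAlgebra ℚ E →ₐ[ℚ] ℂ) {d : ℕ}
    (h : ∀ k, 0 < k → k < d → ∀ r ∈ invariantsDeg W k, φ r = 0) :
    ∀ r ∈ decomposablesDeg W d, φ r = 0 := by
  suffices hle : decomposablesDeg W d ≤ LinearMap.ker φ.toLinearMap from fun r hr => hle hr
  unfold decomposablesDeg
  refine iSup_le fun ij => Submodule.mul_le.2 fun r hr s hs => ?_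
  have h0 := ij.2
  rw [LinearMap.mem_ker, AlgHom.toLinearMap_apply, map_mul, h ij.1.1 h0.1 (by omega) r hr, zero_mul]

namespace IsYoungAction

variable (hW : IsYoungAction W x lam)
include hW

/-- The class of a power sum in the primitive invariants. -/
def primitiveSum (hW : IsYoungAction W x lam) (d : ℕ) (μ : Λ) : primitives W d :=
  Submodule.Quotient.mk ⟨blockSum x lam d μ, hW.blockSum_mem d μ⟩

theorem primitivesEval_primitiveSum (d : ℕ) (l : E →ₗ[ℚ] ℂ)
    (h : ∀ r ∈ decomposablesDeg W d, SymmetricAlgebra.lift l r = 0) (μ : Λ) :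
    primitivesEval d l h (hW.primitiveSum d μ) = ∑ i with lam i = μ, l (x i) ^ d :=
  lift_blockSum l d μ

theorem span_primitiveSum (d : ℕ) (hd : 1 ≤ d) :
    Submodule.span ℚ (Set.range (hW.primitiveSum d)) = ⊤ := by
  rw [eq_top_iff]
  rintro y -
  obtain ⟨⟨r, hr⟩, rfl⟩ := Submodule.Quotient.mk_surjective _ y
  obtain ⟨a, ha, b, hb, hab⟩ := Submodule.mem_sup.1 (hW.le_sup d hd hr)
  have hb' := hb
  rw [← Set.image_univ, Submodule.mem_span_image_iff_exists_fun] at hb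
  obtain ⟨t, -, c, rfl⟩ := hb
  have h : (Submodule.Quotient.mk ⟨r, hr⟩ : primitives W d)
      = ∑ μ : t, c μ • hW.primitiveSum d μ := by
    have h1 : ∑ μ : t, c μ • hW.primitiveSum d μ = (Submodule.Quotient.mk
        (∑ μ : t, c μ • ⟨blockSum x lam d μ, hW.blockSum_mem d μ⟩) : primitives W d) := by
      simp only [← Submodule.mkQ_apply, map_sum, map_smul]
      rfl
    rw [h1, Submodule.Quotient.eq, Submodule.mem_comap]
    have h2 : (invariantsDeg W d).subtype (⟨r, hr⟩ - ∑ μ : t, c μ •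
        (⟨blockSum x lam d μ, hW.blockSum_mem d μ⟩ : invariantsDeg W d)) = a := by
      rw [map_sub, map_sum]
      simp [← hab]
    rwa [h2]
  rw [h]
  exact Submodule.sum_mem _ fun μ _ => Submodule.smul_mem _ _ (Submodule.subset_span ⟨_, rfl⟩)

theorem primitiveSum_eq_zero {d : ℕ} (hd : 1 ≤ d) {μ : Λ}
    (hμ : Fintype.card {i // lam i = μ} < d) : hW.primitiveSum d μ = 0 :=
  (Submodule.Quotient.mk_eq_zero _).2 (hW.blockSum_mem_decomposablesDeg hd hμ)

theorem primitivesMap_primitiveSum {f : E →ₗ[ℚ] E} (hf : Normalizes W f) (π : Equiv.Perm ι)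
    (τ : Equiv.Perm Λ) (hx : ∀ i, f (x i) = x (π i)) (hlam : ∀ i, lam (π i) = τ (lam i)) (d : ℕ)
    (μ : Λ) : primitivesMap W f hf d (hW.primitiveSum d μ) = hW.primitiveSum d (τ μ) := by
  have h : symMap f (blockSum x lam d μ) = blockSum x lam d (τ μ) := by
    rw [blockSum, blockSum, map_sum]
    refine Finset.sum_equiv π (fun i => ?_) fun i _ => ?_
    · simp [hlam]
    · rw [map_pow, symMap_ι, hx]
  exact congrArg Submodule.Quotient.mk (Subtype.ext h)

/-- There are no decomposables in degree one, so every functional of coordinate sum zero is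
admissible. These functionals show that the coefficients of a linear relation among the block sums
are all equal. -/
theorem sum_eval_sub_eq_zero (i j : ι) : ∃ Φ : primitives W 1 →ₗ[ℚ] ℂ, ∀ μ,
    Φ (hW.primitiveSum 1 μ) = (if lam i = μ then 1 else 0) - (if lam j = μ then 1 else 0) := by
  obtain ⟨l, hl⟩ := hW.exists_functional (Pi.single i 1 - Pi.single j 1) (by simp)
  refine ⟨primitivesEval 1 l (algHom_eq_zero_of_mem_decomposablesDeg _ fun k _ _ => by omega),
    fun μ => ?_⟩
  rw [primitivesEval_primitiveSum]
  simp only [hl, pow_one, Pi.sub_apply, Finset.sum_sub_distrib, Pi.single_apply, Finset.sum_filter]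
  congr 1
  · rw [Finset.sum_eq_single i] <;> simp +contextual
  · rw [Finset.sum_eq_single j] <;> simp +contextual

/-- Evaluation at the point whose coordinates are the `d`-th roots of unity on `d` indices of the
block `μ` and zero elsewhere. A cyclic permutation multiplies the point by a primitive root `ζ`, so
an invariant of degree `k` takes a value equal to `ζ ^ k` times itself and vanishes for `0 < k < d`;
hence decomposables of degree `d` vanish too. For `d ≥ 2` the roots sum to zero, as the relation
among the `x i` requires. -/
theorem exists_eval_primitiveSum {d : ℕ} (hd : 2 ≤ d) {μ : Λ}
    (hμ : d ≤ Fintype.card {i // lam i = μ}) : ∃ Φ : primitives W d →ₗ[ℚ] ℂ, ∀ μ',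
    Φ (hW.primitiveSum d μ') = if μ' = μ then (d : ℂ) else 0 := by
  have : NeZero d := ⟨by omega⟩
  obtain ⟨f⟩ : Nonempty (ZMod d ↪ {i // lam i = μ}) :=
    Function.Embedding.nonempty_of_card_le (by rwa [ZMod.card])
  let g : ZMod d ↪ ι := f.trans (Function.Embedding.subtype _)
  have hg : ∀ k, lam (g k) = μ := fun k => (f k).2
  let χ : AddChar (ZMod d) ℂ := ZMod.stdAddChar
  have hχ : Function.Injective χ := ZMod.injective_stdAddChar
  let c : ι → ℂ := Function.extend g χ 0
  have hcg : ∀ k, c (g k) = χ k := fun k => g.injective.extend_apply _ _ k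
  have hc0 : ∀ i, i ∉ Set.range g → c i = 0 := fun i hi => Function.extend_apply' _ _ _ hi
  have hχ1 : χ 1 ≠ 1 := by
    intro h
    have : (1 : ZMod d) = 0 := hχ (by rw [h, AddChar.map_zero_eq_one])
    have := (ZMod.natCast_eq_zero_iff 1 d).1 (by exact_mod_cast this)
    have := Nat.le_of_dvd one_pos this
    omega
  have hsum : ∀ (s : ι → ℂ), (∀ i, i ∉ Set.range g → s i = 0) → ∑ i, s i = ∑ k, s (g k) := by
    intro s hs
    rw [← Finset.sum_map Finset.univ g s]
    refine (Finset.sum_subset (Finset.subset_univ _) fun i _ hi => hs i ?_).symm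
    simpa using hi
  obtain ⟨l, hl⟩ := hW.exists_functional c (by
    rw [hsum c hc0]
    simp only [hcg]
    exact AddChar.sum_eq_zero_of_ne_one (by
      rintro h
      exact hχ1 (by rw [h]; rfl)))
  let ρ : Equiv.Perm ι := (Equiv.addRight (1 : ZMod d)).viaEmbedding g
  have hρg : ∀ k, ρ (g k) = g (k + 1) := fun k => Equiv.Perm.viaEmbedding_apply _ g k
  have hρ0 : ∀ i, i ∉ Set.range g → ρ i = i := fun i hi =>
    Equiv.Perm.viaEmbedding_apply_of_notMem _ g i hi
  have hlρ : ∀ i, lam (ρ i) = lam i := by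
    intro i
    by_cases hi : i ∈ Set.range g
    · obtain ⟨k, rfl⟩ := hi
      rw [hρg, hg, hg]
    · rw [hρ0 i hi]
  obtain ⟨w, hw, hwx⟩ := hW.exists_mem ρ hlρ
  have hlw : l ∘ₗ w = (LinearMap.mulLeft ℚ (χ 1)) ∘ₗ l := by
    refine LinearMap.ext_on_range hW.span_eq_top fun i => ?_
    simp only [LinearMap.comp_apply, LinearMap.mulLeft_apply, hwx, hl]
    by_cases hi : i ∈ Set.range g
    · obtain ⟨k, rfl⟩ := hi
      rw [hρg, hcg, hcg, add_comm, AddChar.map_add_eq_mul]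
    · rw [hρ0 i hi, hc0 i hi, mul_zero]
  have hkill : ∀ k, 0 < k → k < d → ∀ r ∈ invariantsDeg W k, SymmetricAlgebra.lift l r = 0 := by
    rintro k hk0 hkd r ⟨hr, hinv⟩
    have h1 := lift_symMap_of_mem_pow l w (χ 1) (fun y => LinearMap.congr_fun hlw y) k r hr
    rw [hinv w hw, ← AddChar.map_nsmul_eq_pow, nsmul_one] at h1
    have h2 : χ (k : ZMod d) ≠ 1 := by
      intro h
      have h3 : (k : ZMod d) = 0 := hχ (by rw [h, AddChar.map_zero_eq_one])
      have := Nat.le_of_dvd hk0 ((ZMod.natCast_eq_zero_iff k d).1 h3)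
      omega
    by_contra h3
    exact h2 (mul_right_cancel₀ h3 (by rw [one_mul]; exact h1.symm))
  refine ⟨primitivesEval d l (algHom_eq_zero_of_mem_decomposablesDeg _ hkill), fun μ' => ?_⟩
  rw [primitivesEval_primitiveSum, Finset.sum_filter]
  simp only [hl]
  rw [hsum _ fun i hi => by rw [hc0 i hi, zero_pow (by omega), ite_self]]
  simp only [hg, hcg]
  have h1 : ∀ k, χ k ^ d = 1 := fun k => by
    rw [← AddChar.map_nsmul_eq_pow]
    simp
  simp only [h1, eq_comm (a := μ)]
  split_ifs <;> simp

end IsYoungAction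

end YoungAction
end

noncomputable section

/-! ### Determinants of permutation maps -/

section Shift

theorem ZMod.sum_stdAddChar_mul (d : ℕ) [NeZero d] (k : ZMod d) :
    ∑ l : ZMod d, ZMod.stdAddChar (l * k) = if k = 0 then (d : ℂ) else 0 := by
  rw [AddChar.sum_mulShift k (ZMod.isPrimitive_stdAddChar d), ZMod.card]
  push_cast
  rfl

/-- The discrete Fourier matrix `Φ` diagonalizes every cyclic shift; it is invertible by
orthogonality of characters. -/
theorem Matrix.det_one_sub_smul_shift (d : ℕ) [NeZero d] (s : ZMod d) (x : ℂ) :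
    (1 - x • Matrix.of fun k l : ZMod d => if k = l + s then (1 : ℂ) else 0).det
      = ∏ j : ZMod d, (1 - x * ZMod.stdAddChar (j * s)) := by
  let Φ : Matrix (ZMod d) (ZMod d) ℂ := Matrix.of fun j k => ZMod.stdAddChar (j * k)
  let Φ' : Matrix (ZMod d) (ZMod d) ℂ := Matrix.of fun j k => ZMod.stdAddChar (-(j * k))
  have hd : (d : ℂ) ≠ 0 := by exact_mod_cast NeZero.ne d
  have h1 : Φ * Φ' = (d : ℂ) • 1 := by
    ext j k
    have : ∀ l, Φ j l * Φ' l k = ZMod.stdAddChar (l * (j - k)) := fun l => by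
      simp only [Φ, Φ', Matrix.of_apply]
      rw [← AddChar.map_add_eq_mul]
      congr 1
      ring
    rw [Matrix.mul_apply, Finset.sum_congr rfl fun l _ => this l, ZMod.sum_stdAddChar_mul]
    simp [Matrix.one_apply, sub_eq_zero]
  have hΦ : Φ.det ≠ 0 := by
    have h2 := congrArg Matrix.det h1
    rw [Matrix.det_mul, Matrix.det_smul, Matrix.det_one, mul_one] at h2
    exact left_ne_zero_of_mul (h2 ▸ pow_ne_zero _ hd)
  have h2 : Φ * (1 - x • Matrix.of fun k l : ZMod d => if k = l + s then (1 : ℂ) else 0)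
      = Matrix.diagonal (fun j => 1 - x * ZMod.stdAddChar (j * s)) * Φ := by
    ext j k
    rw [Matrix.diagonal_mul, mul_sub, mul_one, Matrix.sub_apply, Matrix.mul_smul, Matrix.smul_apply,
      Matrix.mul_apply]
    simp only [Matrix.of_apply, mul_ite, mul_one, mul_zero, Finset.sum_ite_eq', Finset.mem_univ,
      if_true, Φ, smul_eq_mul]
    rw [mul_add, AddChar.map_add_eq_mul]
    ring
  have h3 := congrArg Matrix.det h2
  rw [Matrix.det_mul, Matrix.det_mul, Matrix.det_diagonal, mul_comm] at h3
  exact mul_right_cancel₀ hΦ h3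

theorem Matrix.det_blockDiagonal'_eq_prod {o R : Type*} [CommRing R] [Fintype o] [DecidableEq o]
    {m : o → Type*} [∀ i, Fintype (m i)] [∀ i, DecidableEq (m i)]
    (M : ∀ i, Matrix (m i) (m i) R) : (Matrix.blockDiagonal' M).det = ∏ i, (M i).det := by
  let : LinearOrder o := LinearOrder.lift' (Fintype.equivFin o) (Fintype.equivFin o).injective
  rw [(Matrix.blockTriangular_blockDiagonal' M).det_fintype]
  refine Finset.prod_congr rfl fun i _ => ?_
  let e : m i ≃ {a : Sigma m // a.1 = i} := Equiv.ofBijective (fun k => ⟨⟨i, k⟩, rfl⟩)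
    ⟨fun k l h => by simpa using h, by rintro ⟨⟨_, k⟩, rfl⟩; exact ⟨k, rfl⟩⟩
  rw [← Matrix.det_submatrix_equiv_self e]
  congr 1
  ext k l
  exact Matrix.blockDiagonal'_apply_eq M i k l

theorem LinearMap.det_one_sub_smul_of_shift {P : Type*} [Fintype P] [DecidableEq P] (δ : P → ℕ)
    [∀ p, NeZero (δ p)] {V : Type*} [AddCommGroup V] [Module ℂ V]
    (b : Module.Basis (Σ p, ZMod (δ p)) ℂ V) (g : V →ₗ[ℂ] V) (m : ℕ)
    (hg : ∀ p k, g (b ⟨p, k⟩) = b ⟨p, k - m⟩) (x : ℂ) :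
    LinearMap.det ((1 : Module.End ℂ V) - x • g)
      = ∏ p, ∏ j : ZMod (δ p), (1 - x * ZMod.stdAddChar j ^ m) := by
  have h : LinearMap.toMatrix b b ((1 : Module.End ℂ V) - x • g) = Matrix.blockDiagonal'
      fun p => 1 - x • Matrix.of fun k l : ZMod (δ p) => if k = l + (-m) then (1 : ℂ) else 0 := by
    ext ⟨p, k⟩ ⟨p', l⟩
    rw [LinearMap.toMatrix_apply, LinearMap.sub_apply, LinearMap.smul_apply, hg, map_sub, map_smul,
      Module.End.one_apply, Module.Basis.repr_self, Module.Basis.repr_self, Finsupp.sub_apply,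
      Finsupp.smul_apply, Matrix.blockDiagonal'_apply]
    by_cases hp : p = p'
    · subst hp
      rw [dif_pos rfl]
      simp only [cast_eq, Matrix.sub_apply, Matrix.smul_apply, Matrix.of_apply, Finsupp.single_apply,
        Sigma.mk.injEq, heq_eq_eq, true_and, Matrix.one_apply, sub_eq_add_neg]
      simp only [eq_comm]
    · rw [dif_neg hp, Finsupp.single_eq_of_ne (by simp [hp]), Finsupp.single_eq_of_ne (by simp [hp])]
      simp
  rw [← LinearMap.det_toMatrix b, h, Matrix.det_blockDiagonal'_eq_prod]
  refine Finset.prod_congr rfl fun p _ => ?_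
  -- The shift by `-m` gives the inverse roots of unity; negating the index removes the inverse.
  rw [Matrix.det_one_sub_smul_shift, ← Equiv.prod_comp (Equiv.neg (ZMod (δ p)))]
  refine Finset.prod_congr rfl fun j _ => ?_
  rw [← AddChar.map_nsmul_eq_pow, nsmul_eq_mul]
  simp [mul_comm]

end Shift

/-! ### Permutation action on the power sums -/

section YoungAction

variable {E : Type*} [AddCommGroup E] [Module ℚ E] {ι Λ : Type*} [Fintype ι] [DecidableEq ι]
  [DecidableEq Λ] {W : Set (E →ₗ[ℚ] E)} {x : ι → E} {lam : ι → Λ}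

namespace IsYoungAction

theorem span_tmul_primitiveSum (hW : IsYoungAction W x lam) (d : ℕ) (hd : 1 ≤ d) :
    Submodule.span ℂ (Set.range fun μ : {μ : Λ // d ≤ Fintype.card {i // lam i = μ}} =>
      (1 : ℂ) ⊗ₜ[ℚ] hW.primitiveSum d μ.1) = ⊤ := by
  rw [← Submodule.baseChange_top, ← hW.span_primitiveSum d hd, Submodule.baseChange_span]
  refine le_antisymm (Submodule.span_mono ?_) (Submodule.span_le.2 ?_)
  · rintro _ ⟨μ, rfl⟩
    exact ⟨_, ⟨μ.1, rfl⟩, rfl⟩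
  · rintro _ ⟨_, ⟨μ, rfl⟩, rfl⟩
    by_cases hμ : d ≤ Fintype.card {i // lam i = μ}
    · exact Submodule.subset_span ⟨⟨μ, hμ⟩, rfl⟩
    · rw [hW.primitiveSum_eq_zero hd (not_le.1 hμ)]
      simp

theorem linearIndependent_tmul_primitiveSum (hW : IsYoungAction W x lam) {d : ℕ} (hd : 2 ≤ d) :
    LinearIndependent ℂ fun μ : {μ : Λ // d ≤ Fintype.card {i // lam i = μ}} =>
      (1 : ℂ) ⊗ₜ[ℚ] hW.primitiveSum d μ.1 := by
  rw [linearIndependent_iff']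
  intro s c hc μ hμ
  obtain ⟨Φ, hΦ⟩ := hW.exists_eval_primitiveSum hd μ.2
  have h := congrArg (LinearMap.liftBaseChange ℂ Φ) hc
  simp only [map_sum, map_smul, LinearMap.liftBaseChange_tmul, hΦ, map_zero,
    smul_eq_mul, one_mul, ← Subtype.ext_iff] at h
  rw [Finset.sum_eq_single μ (fun μ' _ h' => by simp [h']) (fun h' => (h' hμ).elim),
    if_pos rfl] at h
  exact (mul_eq_zero.1 h).resolve_right (by exact_mod_cast (by omega : d ≠ 0))

/-- The classes of the power sums are a basis of the primitive invariants of degree `d ≥ 2`. -/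
def basis (hW : IsYoungAction W x lam) {d : ℕ} (hd : 2 ≤ d) :
    Module.Basis {μ : Λ // d ≤ Fintype.card {i // lam i = μ}} ℂ (ℂ ⊗[ℚ] primitives W d) :=
  Module.Basis.mk (hW.linearIndependent_tmul_primitiveSum hd)
    (hW.span_tmul_primitiveSum d (by omega)).ge

theorem basis_apply (hW : IsYoungAction W x lam) {d : ℕ} (hd : 2 ≤ d)
    (μ : {μ : Λ // d ≤ Fintype.card {i // lam i = μ}}) :
    hW.basis hd μ = (1 : ℂ) ⊗ₜ[ℚ] hW.primitiveSum d μ.1 :=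
  Module.Basis.mk_apply _ _ _

/-- The permutation of the blocks of size at least `d` induced by a permutation of the labels. -/
def blockPerm (π : Equiv.Perm ι) (τ : Equiv.Perm Λ) (hlam : ∀ i, lam (π i) = τ (lam i)) (d : ℕ) :
    Equiv.Perm {μ : Λ // d ≤ Fintype.card {i // lam i = μ}} :=
  τ.subtypePerm fun μ => by
    have : Fintype.card {i // lam i = μ} = Fintype.card {i // lam i = τ μ} :=
      Fintype.card_congr (π.subtypeEquiv fun i => by rw [hlam, τ.injective.eq_iff])
    rw [this]

theorem baseChange_tmul_primitiveSum (hW : IsYoungAction W x lam) {f : E →ₗ[ℚ] E}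
    (hf : Normalizes W f) (π : Equiv.Perm ι) (τ : Equiv.Perm Λ) (hx : ∀ i, f (x i) = x (π i))
    (hlam : ∀ i, lam (π i) = τ (lam i)) (d : ℕ)
    (μ : {μ : Λ // d ≤ Fintype.card {i // lam i = μ}}) :
    (primitivesMap W f hf d).baseChange ℂ ((1 : ℂ) ⊗ₜ[ℚ] hW.primitiveSum d μ.1)
      = (1 : ℂ) ⊗ₜ[ℚ] hW.primitiveSum d (blockPerm π τ hlam d μ).1 := by
  rw [LinearMap.baseChange_tmul, hW.primitivesMap_primitiveSum hf π τ hx hlam]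
  rfl

theorem ker_linearCombination (hW : IsYoungAction W x lam)
    [Fintype {μ : Λ // 1 ≤ Fintype.card {i // lam i = μ}}] :
    LinearMap.ker (Fintype.linearCombination ℂ fun μ : {μ : Λ // 1 ≤ Fintype.card {i // lam i = μ}} =>
      (1 : ℂ) ⊗ₜ[ℚ] hW.primitiveSum 1 μ.1) = Submodule.span ℂ {1} := by
  refine le_antisymm (fun c hc => ?_) ?_
  · have hc' : ∀ μ ν, c μ = c ν := by
      rintro ⟨μ, hμ⟩ ⟨ν, hν⟩
      obtain ⟨i, hi⟩ := Fintype.card_pos_iff.1 hμ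
      obtain ⟨j, hj⟩ := Fintype.card_pos_iff.1 hν
      obtain ⟨Φ, hΦ⟩ := hW.sum_eval_sub_eq_zero i j
      have h := congrArg (LinearMap.liftBaseChange ℂ Φ) (LinearMap.mem_ker.1 hc)
      rw [Fintype.linearCombination_apply] at h
      simp only [map_sum, map_smul, LinearMap.liftBaseChange_tmul, hΦ, map_zero,
        smul_eq_mul, one_mul, mul_sub, Finset.sum_sub_distrib, sub_eq_zero] at h
      subst hi hj
      have h' : ∀ i (hi : 1 ≤ Fintype.card {j // lam j = lam i}),
          ∑ μ : {μ : Λ // 1 ≤ Fintype.card {i // lam i = μ}},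
            c μ * (if lam i = μ.1 then (1 : ℂ) else 0) = c ⟨lam i, hi⟩ := by
        intro i hi
        rw [Finset.sum_eq_single ⟨lam i, hi⟩ (fun μ _ h => by
          rw [if_neg, mul_zero]
          exact fun h1 => h (Subtype.ext h1.symm)) (by simp)]
        simp
      rwa [h', h'] at h
    rcases isEmpty_or_nonempty {μ : Λ // 1 ≤ Fintype.card {i // lam i = μ}} with h | ⟨⟨μ⟩⟩
    · rw [Subsingleton.elim c 0]
      exact zero_mem _
    · refine Submodule.mem_span_singleton.2 ⟨c μ, funext fun ν => ?_⟩
      simp [hc' μ ν]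
  · rw [Submodule.span_singleton_le_iff_mem, LinearMap.mem_ker, Fintype.linearCombination_apply]
    simp only [Pi.one_apply, one_smul]
    rw [← TensorProduct.tmul_sum]
    have h : ∑ μ : {μ : Λ // 1 ≤ Fintype.card {i // lam i = μ}}, hW.primitiveSum 1 μ.1
        = (Submodule.Quotient.mk (∑ μ : {μ : Λ // 1 ≤ Fintype.card {i // lam i = μ}},
          (⟨blockSum x lam 1 μ.1, hW.blockSum_mem 1 μ.1⟩ : invariantsDeg W 1)) : primitives W 1) := by
      simp only [← Submodule.mkQ_apply, map_sum]
      rfl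
    have h0 : ∑ μ : {μ : Λ // 1 ≤ Fintype.card {i // lam i = μ}},
        (⟨blockSum x lam 1 μ.1, hW.blockSum_mem 1 μ.1⟩ : invariantsDeg W 1) = 0 := by
      apply Subtype.ext
      rw [Submodule.coe_sum]
      simp only [blockSum, pow_one]
      have h1 : ∀ i, 1 ≤ Fintype.card {j // lam j = lam i} := fun i => Fintype.card_pos_iff.2 ⟨i, rfl⟩
      have h2 := Finset.sum_fiberwise (Finset.univ : Finset ι)
        (fun i => (⟨lam i, h1 i⟩ : {μ : Λ // 1 ≤ Fintype.card {i // lam i = μ}}))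
        (fun i => SymmetricAlgebra.ι ℚ E (x i))
      simp only [Subtype.ext_iff] at h2
      rw [h2, ← map_sum, hW.sum_eq_zero, map_zero]
      rfl
    rw [h, h0]
    simp

/-- In degree one the primitives are the quotient of the permutation representation `g` on the
occurring labels by the line of constant vectors. This line is fixed, which accounts for the factor
`1 - t`. -/
theorem mul_det_primitives_one [Nonempty ι] (hW : IsYoungAction W x lam)
    [Fintype {μ : Λ // 1 ≤ Fintype.card {i // lam i = μ}}] {f : E →ₗ[ℚ] E}
    (hf : Normalizes W f) (π : Equiv.Perm ι) (τ : Equiv.Perm Λ) (hx : ∀ i, f (x i) = x (π i))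
    (hlam : ∀ i, lam (π i) = τ (lam i)) (t : ℂ)
    (g : Module.End ℂ ({μ : Λ // 1 ≤ Fintype.card {i // lam i = μ}} → ℂ))
    (hg : ∀ μ, g (Pi.basisFun ℂ _ μ) = Pi.basisFun ℂ _ (blockPerm π τ hlam 1 μ)) :
    (1 - t) * LinearMap.det ((1 : Module.End ℂ (ℂ ⊗[ℚ] primitives W 1)) -
      t • (primitivesMap W f hf 1).baseChange ℂ) = LinearMap.det (1 - t • g) := by
  let I := {μ : Λ // 1 ≤ Fintype.card {i // lam i = μ}}
  let v : I → ℂ ⊗[ℚ] primitives W 1 := fun μ => (1 : ℂ) ⊗ₜ[ℚ] hW.primitiveSum 1 μ.1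
  let L := Fintype.linearCombination ℂ v
  let ρ : Equiv.Perm I := blockPerm π τ hlam 1
  have hgI : ∀ μ : I, g (Pi.basisFun ℂ I μ) = Pi.basisFun ℂ I (ρ μ) := hg
  have hL : ∀ μ, L (Pi.basisFun ℂ I μ) = v μ := fun μ => by
    simp [L]
  let f' := (primitivesMap W f hf 1).baseChange ℂ
  have hcomm : L ∘ₗ (1 - t • g) = (1 - t • f') ∘ₗ L := by
    refine (Pi.basisFun ℂ I).ext fun μ => ?_
    simp only [LinearMap.comp_apply, LinearMap.sub_apply, LinearMap.smul_apply,
      Module.End.one_apply, map_sub, map_smul, hL]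
    rw [hgI, hL]
    exact congrArg (fun y => v μ - t • y)
      (hW.baseChange_tmul_primitiveSum hf π τ hx hlam 1 μ).symm
  have hsurj : Function.Surjective L := by
    rw [← LinearMap.range_eq_top, Fintype.range_linearCombination]
    exact hW.span_tmul_primitiveSum 1 le_rfl
  have hker : LinearMap.ker L = Submodule.span ℂ {1} := hW.ker_linearCombination
  have hle : LinearMap.ker L ≤ (LinearMap.ker L).comap (1 - t • g) := by
    intro c hc
    rw [Submodule.mem_comap, LinearMap.mem_ker, ← LinearMap.comp_apply, hcomm, LinearMap.comp_apply,
      LinearMap.mem_ker.1 hc, map_zero]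
  have : Nonempty I := by
    obtain ⟨i⟩ := ‹Nonempty ι›
    exact ⟨⟨lam i, Fintype.card_pos_iff.2 ⟨i, rfl⟩⟩⟩
  have hg1 : g 1 = 1 := by
    have h1 : (1 : I → ℂ) = ∑ μ, Pi.basisFun ℂ I μ := by
      funext ν
      simp [Finset.sum_apply]
    rw [h1, map_sum]
    simp only [hgI]
    exact Equiv.sum_comp ρ fun μ => Pi.basisFun ℂ I μ
  rw [LinearMap.det_eq_det_mul_det (LinearMap.ker L) _ hle]
  congr 1
  · have h1 : LinearMap.restrict (p := LinearMap.ker L) (q := LinearMap.ker L) (1 - t • g) hle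
        = (1 - t) • LinearMap.id := by
      refine LinearMap.ext fun c => Subtype.ext ?_
      have hc : c.1 ∈ Submodule.span ℂ {1} := hker.le c.2
      obtain ⟨a, ha⟩ := Submodule.mem_span_singleton.1 hc
      simp only [LinearMap.coe_restrict_apply, LinearMap.smul_apply, LinearMap.id_apply,
        Submodule.coe_smul, LinearMap.sub_apply, Module.End.one_apply, ← ha, map_smul, hg1]
      module
    rw [h1, LinearMap.det_smul, LinearMap.det_id, mul_one, hker,
      finrank_span_singleton (one_ne_zero), pow_one]
  · let e := L.quotKerEquivOfSurjective hsurj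
    rw [← LinearMap.det_conj _ e]
    congr 1
    refine LinearMap.ext fun y => ?_
    obtain ⟨c, rfl⟩ := hsurj y
    have h1 : e.symm (L c) = Submodule.Quotient.mk c := by
      rw [LinearEquiv.symm_apply_eq]
      rfl
    simp only [LinearMap.comp_apply, LinearEquiv.coe_coe, h1, Submodule.mapQ_apply]
    exact (LinearMap.congr_fun hcomm c).symm

end IsYoungAction

end YoungAction
end

noncomputable section

/-! ### Frobenius orbits -/

section Frobenius

variable {F K : Type*} [Field F] [Fintype F] [Field K] [Algebra F K]

open Polynomial

/-- An irreducible polynomial divides `X ^ (q ^ n) - X` exactly when its degree divides `n`. -/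
theorem pow_card_pow_eq_self_iff [Algebra.IsAlgebraic F K] (μ : K) (n : ℕ) :
    μ ^ Fintype.card F ^ n = μ ↔ (minpoly F μ).natDegree ∣ n := by
  have hi := minpoly.irreducible (Algebra.IsAlgebraic.isAlgebraic (R := F) μ).isIntegral
  rw [hi.natDegree_dvd_iff_dvd_X_pow_card_pow_sub_X, minpoly.dvd_iff, Nat.card_eq_fintype_card]
  simp [sub_eq_zero]

theorem pow_card_pow_injective (n : ℕ) :
    Function.Injective fun x : K => x ^ Fintype.card F ^ n := by
  have h : (fun x : K => x ^ Fintype.card F ^ n) = (FiniteField.frobeniusAlgHom F K)^[n] := by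
    rw [FiniteField.coe_frobeniusAlgHom, pow_iterate]
  rw [h]
  exact (RingHom.injective _).iterate n

theorem pow_card_pow_eq_iff [Algebra.IsAlgebraic F K] (μ : K) (a b : ℕ) :
    μ ^ Fintype.card F ^ a = μ ^ Fintype.card F ^ b ↔
      (a : ZMod (minpoly F μ).natDegree) = b := by
  rcases le_total a b with h | h
  · obtain ⟨c, rfl⟩ := Nat.exists_eq_add_of_le h
    rw [pow_add, mul_comm (Fintype.card F ^ a), pow_mul,
      (pow_card_pow_injective (F := F) (K := K) a).eq_iff, eq_comm, pow_card_pow_eq_self_iff,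
      ← ZMod.natCast_eq_zero_iff]
    simp
  · obtain ⟨c, rfl⟩ := Nat.exists_eq_add_of_le h
    rw [pow_add, mul_comm (Fintype.card F ^ b), pow_mul,
      (pow_card_pow_injective (F := F) (K := K) b).eq_iff, pow_card_pow_eq_self_iff,
      ← ZMod.natCast_eq_zero_iff]
    simp

theorem minpoly_pow_card_pow [Algebra.IsAlgebraic F K] (μ : K) (n : ℕ) :
    minpoly F (μ ^ Fintype.card F ^ n) = minpoly F μ := by
  have h : μ ^ Fintype.card F ^ n = (FiniteField.frobeniusAlgEquivOfAlgebraic F K ^ n) μ := by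
    rw [AlgEquiv.coe_pow, FiniteField.coe_frobeniusAlgEquivOfAlgebraic_iterate]
  rw [h, minpoly.algEquiv_eq]

/-- The roots of an irreducible polynomial over a finite field form one Frobenius orbit. -/
theorem bijective_pow_card_pow [IsAlgClosure F K] (p : F[X]) (hm : p.Monic) (hp : Irreducible p)
    (r : K) (hr : minpoly F r = p) : Function.Bijective fun k : ZMod p.natDegree =>
      (⟨r ^ Fintype.card F ^ k.val, by
        have := (IsAlgClosure.isAlgebraic : Algebra.IsAlgebraic F K)
        rw [minpoly_pow_card_pow, hr]⟩ : {μ : K // minpoly F μ = p}) := by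
  have := (IsAlgClosure.isAlgebraic : Algebra.IsAlgebraic F K)
  have := (IsAlgClosure.isAlgClosed F : IsAlgClosed K)
  have : NeZero p.natDegree := ⟨hp.natDegree_pos.ne'⟩
  have h : ∀ μ : K, minpoly F μ = p ↔ μ ∈ p.rootSet K := by
    intro μ
    rw [mem_rootSet, and_iff_right hp.ne_zero]
    constructor
    · rintro rfl
      exact minpoly.aeval _ _
    · exact fun h => (minpoly.eq_of_irreducible_of_monic hp h hm).symm
  let e : {μ : K // minpoly F μ = p} ≃ p.rootSet K := Equiv.subtypeEquivRight h
  let : Fintype {μ : K // minpoly F μ = p} := Fintype.ofEquiv _ e.symm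
  rw [Fintype.bijective_iff_injective_and_card]
  constructor
  · intro k l hkl
    have h1 := (pow_card_pow_eq_iff (F := F) r _ _).1 (congrArg Subtype.val hkl)
    rw [hr] at h1
    simpa using h1
  · rw [ZMod.card, Fintype.card_congr e, card_rootSet_eq_natDegree
      (PerfectField.separable_of_irreducible hp) (IsAlgClosed.splits _)]

theorem geomFrob_pow_apply [Algebra.IsAlgebraic F K] (m : ℕ) (y : K) :
    (geomFrob F K ^ m) (y ^ Fintype.card F ^ m) = y := by
  have h : y ^ Fintype.card F ^ m = (FiniteField.frobeniusAlgEquivOfAlgebraic F K ^ m) y := by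
    rw [AlgEquiv.coe_pow, FiniteField.coe_frobeniusAlgEquivOfAlgebraic_iterate]
  rw [h, geomFrob, ← AlgEquiv.mul_apply, inv_pow, inv_mul_cancel,
    AlgEquiv.one_apply]

/-- The orbit is indexed by powers of the arithmetic Frobenius, so its inverse acts by subtraction;
this is the shift required by `LinearMap.det_one_sub_smul_of_shift`. -/
theorem geomFrob_pow_orbit [Algebra.IsAlgebraic F K] (p : F[X]) [NeZero p.natDegree]
    (r : K) (hr : minpoly F r = p) (m : ℕ) (k : ZMod p.natDegree) :
    (geomFrob F K ^ m) (r ^ Fintype.card F ^ k.val) = r ^ Fintype.card F ^ (k - m).val := by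
  have h : (r ^ Fintype.card F ^ (k - m).val) ^ Fintype.card F ^ m = r ^ Fintype.card F ^ k.val := by
    rw [← pow_mul, ← pow_add, pow_card_pow_eq_iff, hr]
    simp
  rw [← h, geomFrob_pow_apply]

end Frobenius

/-! ### The characteristic polynomial of a cycle -/

section CycleDet

/-- `∏ (1 - x ζ ^ m)` over the `d`-th roots of unity `ζ`. -/
def cycleDet (d m : ℕ) (x : ℂ) : ℂ :=
  ∏ j ∈ Finset.range d, (1 - x * (Complex.exp (2 * Real.pi * Complex.I / d) ^ j) ^ m)

theorem prod_stdAddChar (d m : ℕ) [NeZero d] (x : ℂ) :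
    ∏ j : ZMod d, (1 - x * ZMod.stdAddChar j ^ m) = cycleDet d m x := by
  obtain ⟨n, rfl⟩ := Nat.exists_eq_succ_of_ne_zero (NeZero.ne d)
  unfold cycleDet
  rw [Finset.prod_range]
  refine Fintype.prod_congr _ _ fun j : Fin (n + 1) => ?_
  let k : ZMod (n + 1) := j
  have h1 : ((j.val : ℤ) : ZMod (n + 1)) = k := by
    rw [Int.cast_natCast]
    exact Fin.cast_val_eq_self j
  have h : ZMod.stdAddChar k = Complex.exp (2 * Real.pi * Complex.I / (n + 1 : ℕ)) ^ j.val := by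
    rw [← h1, ZMod.stdAddChar_coe, ← Complex.exp_nat_mul]
    congr 1
    push_cast
    ring
  exact congrArg (fun y => 1 - x * y ^ m) h

end CycleDet

/-! ### Frobenius on the primitive invariants -/

section YoungAction

variable {E : Type*} [AddCommGroup E] [Module ℚ E] {ι : Type*} [Fintype ι] [DecidableEq ι]
  {W : Set (E →ₗ[ℚ] E)} {x : ι → E} {F K : Type*} [Field F] [Fintype F] [Field K] [Algebra F K]
  [DecidableEq K] {lam : ι → K}

open Polynomial

/-- The labels which occur at least `d` times, if the number of occurrences of `μ` is the
multiplicity of its minimal polynomial in `M`. -/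
theorem exists_sigma_equiv [IsAlgClosure F K] [DecidableEq F[X]] (M : Multiset F[X])
    (hM : ∀ p ∈ M, p.Monic ∧ Irreducible p) {d : ℕ} (hd : 1 ≤ d)
    (hcard : ∀ μ : K, Fintype.card {i // lam i = μ} = M.count (minpoly F μ)) :
    ∃ e : (Σ p : {p // p ∈ M.toFinset.filter fun p => d ≤ M.count p}, ZMod p.1.natDegree) ≃
      {μ : K // d ≤ Fintype.card {i // lam i = μ}},
      ∀ (m : ℕ) p k, (e ⟨p, k - m⟩).1
        = haveI := (IsAlgClosure.isAlgebraic : Algebra.IsAlgebraic F K)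
          (geomFrob F K ^ m) (e ⟨p, k⟩).1 := by
  have := (IsAlgClosure.isAlgebraic : Algebra.IsAlgebraic F K)
  have := (IsAlgClosure.isAlgClosed F : IsAlgClosed K)
  have hP : ∀ p : {p // p ∈ M.toFinset.filter fun p => d ≤ M.count p}, p.1.Monic ∧ Irreducible p.1 :=
    fun p => hM _ (Multiset.mem_toFinset.1 (Finset.mem_filter.1 p.2).1)
  have hr : ∀ p : {p // p ∈ M.toFinset.filter fun p => d ≤ M.count p}, ∃ r : K, minpoly F r = p.1 := by
    intro p
    obtain ⟨r, hr⟩ := IsAlgClosed.exists_aeval_eq_zero K p.1 (hP p).2.degree_pos.ne'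
    exact ⟨r, (minpoly.eq_of_irreducible_of_monic (hP p).2 hr (hP p).1).symm⟩
  choose r hr using hr
  let e1 : ∀ p : {p // p ∈ M.toFinset.filter fun p => d ≤ M.count p},
      ZMod p.1.natDegree ≃ {μ : K // minpoly F μ = p.1} := fun p =>
    Equiv.ofBijective _ (bijective_pow_card_pow p.1 (hP p).1 (hP p).2 (r p) (hr p))
  have hmem : ∀ μ : {μ : K // d ≤ Fintype.card {i // lam i = μ}},
      minpoly F μ.1 ∈ M.toFinset.filter fun p => d ≤ M.count p := by
    rintro ⟨μ, hμ⟩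
    rw [hcard] at hμ
    rw [Finset.mem_filter, Multiset.mem_toFinset, ← Multiset.count_pos]
    exact ⟨hd.trans hμ, hμ⟩
  let e2 : (Σ p : {p // p ∈ M.toFinset.filter fun p => d ≤ M.count p}, {μ : K // minpoly F μ = p.1}) ≃
      {μ : K // d ≤ Fintype.card {i // lam i = μ}} :=
    { toFun := fun a => ⟨a.2.1, by
        rw [hcard, a.2.2]
        exact (Finset.mem_filter.1 a.1.2).2⟩
      invFun := fun μ => ⟨⟨minpoly F μ.1, hmem μ⟩, ⟨μ.1, rfl⟩⟩
      left_inv := by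
        rintro ⟨⟨p, hp⟩, ⟨μ, hμ⟩⟩
        simp only at hμ
        subst hμ
        rfl
      right_inv := fun μ => rfl }
  refine ⟨(Equiv.sigmaCongrRight e1).trans e2, fun m p k => ?_⟩
  have : NeZero p.1.natDegree := ⟨(hP p).2.natDegree_pos.ne'⟩
  exact (geomFrob_pow_orbit p.1 (r p) (hr p) m k).symm

variable [Algebra.IsAlgebraic F K]

theorem IsYoungAction.det_primitives [IsAlgClosure F K] [DecidableEq F[X]]
    (hW : IsYoungAction W x lam) (M : Multiset F[X])
    (hM : ∀ p ∈ M, p.Monic ∧ Irreducible p)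
    (hcard : ∀ μ : K, Fintype.card {i // lam i = μ} = M.count (minpoly F μ)) {f : E →ₗ[ℚ] E}
    (hf : Normalizes W f) (m : ℕ) (π : Equiv.Perm ι) (hx : ∀ i, f (x i) = x (π i))
    (hlam : ∀ i, lam (π i) = (geomFrob F K ^ m) (lam i)) (t : ℂ) {d : ℕ} (hd : 2 ≤ d) :
    LinearMap.det ((1 : Module.End ℂ (ℂ ⊗[ℚ] primitives W d)) -
      t • (primitivesMap W f hf d).baseChange ℂ)
      = ∏ p ∈ M.toFinset with d ≤ M.count p, cycleDet p.natDegree m t := by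
  obtain ⟨e, he⟩ := exists_sigma_equiv M hM (by omega : 1 ≤ d) hcard
  have : ∀ p : {p // p ∈ M.toFinset.filter fun p => d ≤ M.count p}, NeZero p.1.natDegree := fun p =>
    ⟨(hM _ (Multiset.mem_toFinset.1 (Finset.mem_filter.1 p.2).1)).2.natDegree_pos.ne'⟩
  have h := LinearMap.det_one_sub_smul_of_shift (fun p : {p // p ∈ M.toFinset.filter
    fun p => d ≤ M.count p} => p.1.natDegree) ((hW.basis hd).reindex e.symm)
    ((primitivesMap W f hf d).baseChange ℂ) m (fun p k => by
      rw [Module.Basis.reindex_apply, Module.Basis.reindex_apply, hW.basis_apply, hW.basis_apply,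
        Equiv.symm_symm, hW.baseChange_tmul_primitiveSum hf π
          (geomFrob F K ^ m : Gal(K/F)).toEquiv hx hlam, he]
      rfl) t
  refine (h.trans (Fintype.prod_congr _ _ fun p => ?_)).trans
    (Finset.prod_coe_sort _ fun p : F[X] => cycleDet p.natDegree m t)
  exact prod_stdAddChar p.1.natDegree m t

theorem IsYoungAction.mul_det_primitives [IsAlgClosure F K] [DecidableEq F[X]] [Nonempty ι]
    (hW : IsYoungAction W x lam) (M : Multiset F[X])
    (hM : ∀ p ∈ M, p.Monic ∧ Irreducible p)
    (hcard : ∀ μ : K, Fintype.card {i // lam i = μ} = M.count (minpoly F μ)) {f : E →ₗ[ℚ] E}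
    (hf : Normalizes W f) (m : ℕ) (π : Equiv.Perm ι) (hx : ∀ i, f (x i) = x (π i))
    (hlam : ∀ i, lam (π i) = (geomFrob F K ^ m) (lam i)) (t : ℂ) :
    (1 - t) * LinearMap.det ((1 : Module.End ℂ (ℂ ⊗[ℚ] primitives W 1)) -
      t • (primitivesMap W f hf 1).baseChange ℂ)
      = ∏ p ∈ M.toFinset, cycleDet p.natDegree m t := by
  obtain ⟨e, he⟩ := exists_sigma_equiv M hM le_rfl hcard
  have : ∀ p : {p // p ∈ M.toFinset.filter fun p => 1 ≤ M.count p}, NeZero p.1.natDegree := fun p =>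
    ⟨(hM _ (Multiset.mem_toFinset.1 (Finset.mem_filter.1 p.2).1)).2.natDegree_pos.ne'⟩
  let : Fintype {μ : K // 1 ≤ Fintype.card {i // lam i = μ}} := Fintype.ofEquiv _ e
  let τ : Equiv.Perm {μ : K // 1 ≤ Fintype.card {i // lam i = μ}} :=
    IsYoungAction.blockPerm π (geomFrob F K ^ m : Gal(K/F)).toEquiv hlam 1
  let B := Pi.basisFun ℂ {μ : K // 1 ≤ Fintype.card {i // lam i = μ}}
  let g := B.constr ℂ fun μ => B (τ μ)
  have hg : ∀ μ, g (B μ) = B (τ μ) := fun μ => B.constr_basis ℂ _ μ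
  rw [hW.mul_det_primitives_one hf π _ hx hlam t g hg]
  have h := LinearMap.det_one_sub_smul_of_shift (fun p : {p // p ∈ M.toFinset.filter
    fun p => 1 ≤ M.count p} => p.1.natDegree) (B.reindex e.symm) g m (fun p k => by
      rw [Module.Basis.reindex_apply, Module.Basis.reindex_apply, Equiv.symm_symm, hg]
      congr 1
      exact Subtype.ext (he m p k).symm) t
  have hfil : M.toFinset.filter (fun p => 1 ≤ M.count p) = M.toFinset :=
    Finset.filter_true_of_mem fun p hp => Multiset.count_pos.2 (Multiset.mem_toFinset.1 hp)
  refine (h.trans (Fintype.prod_congr _ _ fun p => ?_)).trans ((Finset.prod_coe_sort _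
    fun p : F[X] => cycleDet p.natDegree m t).trans (congrArg
      (fun s : Finset F[X] => ∏ p ∈ s, cycleDet p.natDegree m t) hfil))
  exact prod_stdAddChar p.1.natDegree m t

end YoungAction
end

/-! ### Frobenius eigenvalues on the motive -/

noncomputable section

open Polynomial

theorem LinearMap.continuous_det_one_sub_smul {V : Type*} [AddCommGroup V] [Module ℂ V]
    (f : V →ₗ[ℂ] V) : Continuous fun t : ℂ => LinearMap.det ((1 : Module.End ℂ V) - t • f) := by
  by_cases h : Module.Finite ℂ V
  · let b := Module.finBasis ℂ V
    have : (fun t : ℂ => LinearMap.det ((1 : Module.End ℂ V) - t • f))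
        = fun t : ℂ => (1 - t • LinearMap.toMatrix b b f).det := by
      funext t
      rw [← LinearMap.det_toMatrix b, map_sub, map_smul, LinearMap.toMatrix_one]
    rw [this]
    fun_prop
  -- In infinite dimension `LinearMap.det` has the default value `1`, so continuity needs no
  -- finiteness assumption.
  · have : (fun t : ℂ => LinearMap.det ((1 : Module.End ℂ V) - t • f)) = fun _ => 1 := by
      funext t
      exact LinearMap.det_eq_one_of_not_module_finite h _
    rw [this]
    exact continuous_const

/-- The eigenvalues of Frobenius on the motive, together with the eigenvalue `1`, which are
indexed by the irreducible factors `p`, the exponents `e` less than the multiplicity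
of `p`, and the `deg p`-th roots of unity. -/
def weightIndex {F : Type*} [Field F] [DecidableEq F[X]] (M : Multiset F[X]) :
    Finset (Σ _ : F[X], ℕ × ℕ) :=
  M.toFinset.sigma fun p => Finset.range (M.count p) ×ˢ Finset.range p.natDegree

/-- The root of unity belonging to an index. -/
def weightRoot {F : Type*} [Field F] (a : Σ _ : F[X], ℕ × ℕ) : ℂ :=
  Complex.exp (2 * Real.pi * Complex.I / a.1.natDegree) ^ a.2.2

/-- Interchange of the degree `e + 1` and the factor `p`: the factor occurs in the degrees up to its
multiplicity. -/
theorem prod_weightIndex {F : Type*} [Field F] [DecidableEq F[X]] (M : Multiset F[X])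
    (q : ℂ) (m : ℕ) (t : ℂ) :
    ∏ e ∈ Finset.range (Multiset.card M), ∏ p ∈ M.toFinset with e + 1 ≤ M.count p,
      cycleDet p.natDegree m (t * q ^ (e * m))
      = ∏ a ∈ weightIndex M, (1 - t * q ^ (a.2.1 * m) * weightRoot a ^ m) := by
  rw [weightIndex, Finset.prod_sigma, Finset.prod_comm' (t' := M.toFinset)
    (s' := fun p => Finset.range (M.count p))]
  · refine Finset.prod_congr rfl fun p _ => ?_
    rw [Finset.prod_product]
    rfl
  · intro e p
    simp only [Finset.mem_range, Finset.mem_filter]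
    constructor
    · rintro ⟨-, hp, h⟩
      exact ⟨h, hp⟩
    · rintro ⟨h, hp⟩
      exact ⟨h.trans_le (Multiset.count_le_card p M), hp, h⟩

/-- The characteristic polynomial of the action of `f` on the primitive invariants. -/
def primitivesDet {E : Type*} [AddCommGroup E] [Module ℚ E] (W : Set (E →ₗ[ℚ] E)) (f : E →ₗ[ℚ] E)
    (hf : Normalizes W f) (d : ℕ) (t : ℂ) : ℂ :=
  LinearMap.det ((1 : Module.End ℂ (ℂ ⊗[ℚ] primitives W d)) -
    t • (primitivesMap W f hf d).baseChange ℂ)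

theorem continuous_primitivesDet {E : Type*} [AddCommGroup E] [Module ℚ E] (W : Set (E →ₗ[ℚ] E))
    (f : E →ₗ[ℚ] E) (hf : Normalizes W f) (d : ℕ) : Continuous (primitivesDet W f hf d) :=
  LinearMap.continuous_det_one_sub_smul _

/-- The removed index `⟨p, (0, 0)⟩` stands for the eigenvalue `1`, so any factor `p` may be used. It
compensates for the factor `1 - t` of degree one. -/
theorem IsYoungAction.finprod_primitivesDet {F K : Type*} [Field F] [Fintype F] [Field K]
    [Algebra F K] [Algebra.IsAlgebraic F K] [IsAlgClosure F K] [DecidableEq K] [DecidableEq F[X]]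
    {E : Type*} [AddCommGroup E] [Module ℚ E] {W : Set (E →ₗ[ℚ] E)} {ι : Type*} [Fintype ι]
    [DecidableEq ι] [Nonempty ι] {x : ι → E} {lam : ι → K} (hW : IsYoungAction W x lam)
    (M : Multiset F[X]) (hM : ∀ p ∈ M, p.Monic ∧ Irreducible p)
    (hcard : ∀ μ : K, Fintype.card {i // lam i = μ} = M.count (minpoly F μ)) {p : F[X]} (hp : p ∈ M)
    {f : E →ₗ[ℚ] E} (hf : Normalizes W f) (m : ℕ) (π : Equiv.Perm ι) (hx : ∀ i, f (x i) = x (π i))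
    (hlam : ∀ i, lam (π i) = (geomFrob F K ^ m) (lam i)) (t : ℂ) :
    ∏ᶠ e : ℕ, primitivesDet W f hf (e + 1) (t * (Fintype.card F : ℂ) ^ (e * m))
      = ∏ a ∈ (weightIndex M).erase ⟨p, (0, 0)⟩,
        (1 - t * (Fintype.card F : ℂ) ^ (a.2.1 * m) * weightRoot a ^ m) := by
  have h2 : ∀ (t : ℂ) (e : ℕ), 1 ≤ e → primitivesDet W f hf (e + 1) t
      = ∏ p ∈ M.toFinset with e + 1 ≤ M.count p, cycleDet p.natDegree m t := fun t e he =>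
    hW.det_primitives M hM hcard hf m π hx hlam _ (by omega)
  have h1 : ∀ t : ℂ, (1 - t) * primitivesDet W f hf 1 t
      = ∏ p ∈ M.toFinset with 0 + 1 ≤ M.count p, cycleDet p.natDegree m t := by
    intro t
    have hfil : M.toFinset.filter (fun p => 0 + 1 ≤ M.count p) = M.toFinset :=
      Finset.filter_true_of_mem fun p hp => Multiset.count_pos.2 (Multiset.mem_toFinset.1 hp)
    rw [hfil]
    exact hW.mul_det_primitives M hM hcard hf m π hx hlam t
  obtain ⟨N, hN⟩ : ∃ N, Multiset.card M = N + 1 :=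
    Nat.exists_eq_succ_of_ne_zero (Multiset.card_pos_iff_exists_mem.2 ⟨p, hp⟩).ne'
  have hfin : ∀ t, ∏ᶠ e : ℕ, primitivesDet W f hf (e + 1) (t * (Fintype.card F : ℂ) ^ (e * m))
      = ∏ e ∈ Finset.range (N + 1),
        primitivesDet W f hf (e + 1) (t * (Fintype.card F : ℂ) ^ (e * m)) := by
    intro t
    refine finprod_eq_prod_of_mulSupport_subset _ fun e he => ?_
    rw [Finset.coe_range, Set.mem_Iio]
    by_contra h
    refine he ?_
    dsimp only
    rw [h2 _ e (by omega), Finset.filter_false_of_mem, Finset.prod_empty]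
    intro p _
    have := Multiset.count_le_card p M
    omega
  have hcont : Continuous fun t => ∏ᶠ e : ℕ,
      primitivesDet W f hf (e + 1) (t * (Fintype.card F : ℂ) ^ (e * m)) := by
    simp only [hfin]
    refine continuous_finsetProd _ fun e _ => ?_
    exact (continuous_primitivesDet W f hf _).comp (continuous_id.mul continuous_const)
  have hmem : (⟨p, (0, 0)⟩ : Σ _ : F[X], ℕ × ℕ) ∈ weightIndex M := by
    rw [weightIndex, Finset.mem_sigma, Finset.mem_product, Finset.mem_range, Finset.mem_range]
    exact ⟨Multiset.mem_toFinset.2 hp, Multiset.count_pos.2 hp, (hM p hp).2.natDegree_pos⟩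
  have hmul : ∀ t, (1 - t) * ∏ᶠ e : ℕ,
      primitivesDet W f hf (e + 1) (t * (Fintype.card F : ℂ) ^ (e * m)) = (1 - t) *
      ∏ a ∈ (weightIndex M).erase ⟨p, (0, 0)⟩,
        (1 - t * (Fintype.card F : ℂ) ^ (a.2.1 * m) * weightRoot a ^ m) := by
    intro t
    have h3 := Finset.mul_prod_erase (weightIndex M)
      (fun a => 1 - t * (Fintype.card F : ℂ) ^ (a.2.1 * m) * weightRoot a ^ m) hmem
    have h4 : (1 - t * (Fintype.card F : ℂ) ^ ((⟨p, (0, 0)⟩ : Σ _ : F[X], ℕ × ℕ).2.1 * m)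
        * weightRoot (⟨p, (0, 0)⟩ : Σ _ : F[X], ℕ × ℕ) ^ m) = 1 - t := by
      simp [weightRoot]
    rw [h4] at h3
    rw [h3, ← prod_weightIndex, hN, hfin t, Finset.prod_range_succ', Finset.prod_range_succ',
      zero_mul, pow_zero, mul_one, ← h1 t, Finset.prod_congr rfl fun e _ =>
      h2 (t * (Fintype.card F : ℂ) ^ ((e + 1) * m)) (e + 1) (by omega)]
    ring
  -- The factor `1 - t` can be cancelled only for `t ≠ 1`; the value at `t = 1`, which the theorem
  -- needs, follows by continuity.
  have := Continuous.ext_on (dense_compl_singleton (1 : ℂ)) hcont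
    (g := fun t => ∏ a ∈ (weightIndex M).erase ⟨p, (0, 0)⟩,
        (1 - t * (Fintype.card F : ℂ) ^ (a.2.1 * m) * weightRoot a ^ m)) (by fun_prop)
    (fun t ht => mul_left_cancel₀ (sub_ne_zero.2 (Ne.symm ht)) (hmul t))
  exact congrFun this t

theorem motiveDet_eq_finprod {F K : Type*} [Field F] [Fintype F] [Field K] [Algebra F K]
    [Algebra.IsAlgebraic F K] {n : ℕ} (G S₀ : LinAlgGroup F K n) (m : ℕ) (t : ℂ) :
    motiveDet G S₀ m t = ∏ᶠ e : ℕ, primitivesDet (weylSet G (G.centralizer S₀))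
      (ratMap _ (galChar (G.centralizer S₀) (geomFrob F K ^ m))) (normalizes_galChar _ _ _) (e + 1)
      (t * (Fintype.card F : ℂ) ^ (e * m)) :=
  rfl

theorem motiveDet_eq_prod {F K : Type*} [Field F] [Fintype F] [Field K] [Algebra F K]
    [Algebra.IsAlgebraic F K] [IsAlgClosure F K] [DecidableEq K] [DecidableEq F[X]] {n : ℕ}
    {G S₀ : LinAlgGroup F K n} {ι : Type*} [Fintype ι] [DecidableEq ι] [Nonempty ι]
    {x : ι → ratChar (G.centralizer S₀)} {lam : ι → K}
    (hW : IsYoungAction (weylSet G (G.centralizer S₀)) x lam)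
    (hgal : ∀ σ : Gal(K/F), ∃ π : Equiv.Perm ι,
      (∀ i, ratMap _ (galChar (G.centralizer S₀) σ) (x i) = x (π i)) ∧ ∀ i, lam (π i) = σ (lam i))
    (M : Multiset F[X]) (hM : ∀ p ∈ M, p.Monic ∧ Irreducible p)
    (hcard : ∀ μ : K, Fintype.card {i // lam i = μ} = M.count (minpoly F μ)) {p : F[X]} (hp : p ∈ M)
    (m : ℕ) (t : ℂ) :
    motiveDet G S₀ m t = ∏ a ∈ (weightIndex M).erase ⟨p, (0, 0)⟩,
      (1 - t * (Fintype.card F : ℂ) ^ (a.2.1 * m) * weightRoot a ^ m) := by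
  obtain ⟨π, hx, hlam⟩ := hgal (geomFrob F K ^ m)
  rw [motiveDet_eq_finprod]
  exact hW.finprod_primitivesDet M hM hcard hp _ m π hx hlam t

/-- The factorization of `X ^ d - 1` over the roots of unity, evaluated at `x⁻¹` and multiplied by
`x ^ d`. -/
theorem cycleDet_one (d : ℕ) (hd : 0 < d) (x : ℂ) : cycleDet d 1 x = 1 - x ^ d := by
  have hζ := Complex.isPrimitiveRoot_exp d hd.ne'
  have h := X_pow_sub_C_eq_prod hζ hd (one_pow d)
  rcases eq_or_ne x 0 with rfl | hx
  · simp [cycleDet, hd.ne']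
  have h1 := congrArg (Polynomial.eval x⁻¹) h
  rw [Polynomial.eval_prod] at h1
  have h2 : cycleDet d 1 x = ∏ j ∈ Finset.range d, x * (Polynomial.eval x⁻¹ (Polynomial.X -
      Polynomial.C (Complex.exp (2 * Real.pi * Complex.I / d) ^ j * 1))) := by
    refine Finset.prod_congr rfl fun j _ => ?_
    simp
    field_simp
  rw [h2, Finset.prod_mul_distrib, ← h1]
  simp
  field_simp

end

/-! ### The determinants at `t = 1` and `t = q` -/

noncomputable section

open Polynomial

section Weights

variable {F : Type*} [Field F] [DecidableEq F[X]]

theorem norm_weightRoot {M : Multiset F[X]} {a : Σ _ : F[X], ℕ × ℕ} (ha : a ∈ weightIndex M) :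
    ‖weightRoot a‖ = 1 := by
  rw [weightIndex, Finset.mem_sigma, Finset.mem_product, Finset.mem_range, Finset.mem_range] at ha
  have hd : a.1.natDegree ≠ 0 := by omega
  rw [weightRoot, norm_pow, (Complex.isPrimitiveRoot_exp _ hd).norm'_eq_one hd, one_pow]

theorem norm_weight {M : Multiset F[X]} {a : Σ _ : F[X], ℕ × ℕ} (ha : a ∈ weightIndex M) (q : ℕ)
    (e : ℕ) : ‖(q : ℂ) ^ e * weightRoot a‖ = (q : ℝ) ^ e := by
  rw [norm_mul, norm_weightRoot ha, mul_one, norm_pow, Complex.norm_natCast]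

theorem prod_weight_ne_zero {M : Multiset F[X]} (s : Finset (Σ _ : F[X], ℕ × ℕ))
    (hs : s ⊆ weightIndex M) {q : ℕ} (hq : 1 < q) :
    ∏ a ∈ s, (1 - (q : ℂ) * (q : ℂ) ^ (a.2.1 * 1) * weightRoot a ^ 1) ≠ 0 := by
  refine Finset.prod_ne_zero_iff.2 fun a ha h => ?_
  have h1 := norm_weight (hs ha) q (a.2.1 + 1)
  rw [mul_one, pow_one, ← pow_succ'] at h
  rw [← sub_eq_zero.1 h, norm_one] at h1
  have h2 : (1 : ℝ) < (q : ℝ) ^ (a.2.1 + 1) := one_lt_pow₀ (by exact_mod_cast hq) (by omega)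
  exact h2.ne h1

theorem mem_weightIndex {M : Multiset F[X]} (hM : ∀ p ∈ M, p.Monic ∧ Irreducible p) {p : F[X]}
    (hp : p ∈ M) : (⟨p, (0, 0)⟩ : Σ _ : F[X], ℕ × ℕ) ∈ weightIndex M := by
  rw [weightIndex, Finset.mem_sigma, Finset.mem_product, Finset.mem_range, Finset.mem_range]
  exact ⟨Multiset.mem_toFinset.2 hp, Multiset.count_pos.2 hp, (hM p hp).2.natDegree_pos⟩

/-- Only one eigenvalue `1` was removed, and the second factor `p'` supplies another. -/
theorem prod_weight_eq_zero {M : Multiset F[X]} (hM : ∀ p ∈ M, p.Monic ∧ Irreducible p)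
    {p p' : F[X]} (hp' : p' ∈ M) (h : p' ≠ p) (q : ℂ) :
    ∏ a ∈ (weightIndex M).erase ⟨p, (0, 0)⟩, (1 - 1 * q ^ (a.2.1 * 1) * weightRoot a ^ 1) = 0 := by
  refine Finset.prod_eq_zero (Finset.mem_erase.2 ⟨?_, mem_weightIndex hM hp'⟩) ?_
  · simpa using h
  · simp [weightRoot]

theorem mul_prod_weight {M : Multiset F[X]} (hM : ∀ p ∈ M, p.Monic ∧ Irreducible p) {p : F[X]}
    (hp : p ∈ M) (hsub : M.toFinset = {p}) (q t : ℂ) :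
    (1 - t) * ∏ a ∈ (weightIndex M).erase ⟨p, (0, 0)⟩, (1 - t * q ^ (a.2.1 * 1) * weightRoot a ^ 1)
      = ∏ e ∈ Finset.range (M.count p), (1 - (t * q ^ e) ^ p.natDegree) := by
  have h := Finset.mul_prod_erase (weightIndex M)
    (fun a => 1 - t * q ^ (a.2.1 * 1) * weightRoot a ^ 1) (mem_weightIndex hM hp)
  have h4 : (1 - t * q ^ ((⟨p, (0, 0)⟩ : Σ _ : F[X], ℕ × ℕ).2.1 * 1)
      * weightRoot (⟨p, (0, 0)⟩ : Σ _ : F[X], ℕ × ℕ) ^ 1) = 1 - t := by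
    simp [weightRoot]
  rw [h4] at h
  rw [h, weightIndex, hsub, Finset.prod_sigma, Finset.prod_singleton, Finset.prod_product]
  refine Finset.prod_congr rfl fun e _ => ?_
  have h5 := cycleDet_one p.natDegree (hM p hp).2.natDegree_pos (t * q ^ e)
  rw [← h5, cycleDet]
  simp [weightRoot]

/-- For `e = 0` the removal of the eigenvalue `1` leaves `(1 - t ^ d) / (1 - t)`, a geometric sum
with value `d` at `t = 1`. The identity is proved for `t ≠ 1` and extended by continuity. -/
theorem prod_weight_one {M : Multiset F[X]} (hM : ∀ p ∈ M, p.Monic ∧ Irreducible p) {p : F[X]}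
    (hp : p ∈ M) (hsub : M.toFinset = {p}) (q : ℂ) {c : ℕ} (hc : M.count p = c + 1) :
    ∏ a ∈ (weightIndex M).erase ⟨p, (0, 0)⟩, (1 - 1 * q ^ (a.2.1 * 1) * weightRoot a ^ 1)
      = p.natDegree * ∏ e ∈ Finset.range c, (1 - (q ^ (e + 1)) ^ p.natDegree) := by
  have h : (fun t : ℂ => ∏ a ∈ (weightIndex M).erase ⟨p, (0, 0)⟩,
      (1 - t * q ^ (a.2.1 * 1) * weightRoot a ^ 1)) = fun t => (∑ i ∈ Finset.range p.natDegree, t ^ i)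
      * ∏ e ∈ Finset.range c, (1 - (t * q ^ (e + 1)) ^ p.natDegree) := by
    refine Continuous.ext_on (dense_compl_singleton (1 : ℂ)) (by fun_prop) (by fun_prop) ?_
    intro t ht
    refine mul_left_cancel₀ (sub_ne_zero.2 (Ne.symm ht)) ((mul_prod_weight hM hp hsub q t).trans ?_)
    rw [hc, Finset.prod_range_succ', pow_zero, mul_one, ← mul_neg_geom_sum t]
    ring
  have h1 := congrFun h 1
  simpa using h1

/-- The products of `1 - q ^ (e * d)` run over `1 ≤ e < a` above and over `1 ≤ e ≤ a` below, where
there is also a division by `1 - q`; only `e = a` survives, and `a * d = n`. -/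
theorem prod_weight_div {M : Multiset F[X]} (hM : ∀ p ∈ M, p.Monic ∧ Irreducible p) {p : F[X]}
    (hp : p ∈ M) (hsub : M.toFinset = {p}) {q : ℕ} (hq : 1 < q) {n : ℕ}
    (hn : M.count p * p.natDegree = n) :
    (∏ a ∈ (weightIndex M).erase ⟨p, (0, 0)⟩, (1 - 1 * (q : ℂ) ^ (a.2.1 * 1) * weightRoot a ^ 1)) /
      (∏ a ∈ (weightIndex M).erase ⟨p, (0, 0)⟩,
        (1 - (q : ℂ) * (q : ℂ) ^ (a.2.1 * 1) * weightRoot a ^ 1))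
      = p.natDegree * ((1 - (q : ℂ)) / (1 - (q : ℂ) ^ n)) := by
  obtain ⟨c, hc⟩ := Nat.exists_eq_succ_of_ne_zero (Multiset.count_pos.2 hp).ne'
  have hne := prod_weight_ne_zero ((weightIndex M).erase ⟨p, (0, 0)⟩) (Finset.erase_subset _ _) hq
  have hmul := mul_prod_weight hM hp hsub (q : ℂ) q
  have hpow : ∀ k : ℕ, 0 < k → (1 - (q : ℂ) ^ k) ≠ 0 := by
    intro k hk h
    have h1 : ((q ^ k : ℕ) : ℂ) = (1 : ℕ) := by
      push_cast
      exact (sub_eq_zero.1 h).symm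
    exact (Nat.one_lt_pow hk.ne' hq).ne' (by exact_mod_cast h1)
  rw [prod_weight_one hM hp hsub q hc]
  have hn0 : 0 < n := by
    rw [← hn]
    exact Nat.mul_pos (Multiset.count_pos.2 hp) (hM p hp).2.natDegree_pos
  generalize ∏ a ∈ (weightIndex M).erase ⟨p, (0, 0)⟩,
    (1 - (q : ℂ) * (q : ℂ) ^ (a.2.1 * 1) * weightRoot a ^ 1) = X at *
  rw [div_eq_iff hne]
  rw [hc, Nat.succ_eq_add_one, Finset.prod_range_succ, ← pow_succ', ← pow_mul, ← Nat.succ_eq_add_one,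
    ← hc, hn, Finset.prod_congr rfl fun e _ => by rw [← pow_succ']] at hmul
  have hn' := hpow n hn0
  field_simp
  rw [mul_assoc, mul_assoc, hmul]

end Weights

/-! ### Vanishing of the L-value -/

section LValue

theorem Meromorphic.polynomial_eval (p : ℂ[X]) {f : ℂ → ℂ} (hf : Meromorphic f) :
    Meromorphic fun s : ℂ => p.eval (f s) := by
  have h : (fun s : ℂ => p.eval (f s)) = fun s => ∑ i ∈ p.support, p.coeff i * f s ^ i := by
    funext s
    rw [Polynomial.eval_eq_sum, Polynomial.sum]
  rw [h]
  fun_prop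

theorem meromorphic_natCast_cpow_neg {q : ℕ} (hq : 1 < q) : Meromorphic fun s : ℂ => (q : ℂ) ^ (-s) := by
  intro s
  refine AnalyticAt.meromorphicAt ?_
  have hq0 : (q : ℂ) ≠ 0 := by exact_mod_cast (by omega : q ≠ 0)
  have h : (fun s : ℂ => (q : ℂ) ^ (-s)) = fun s => Complex.exp (Complex.log q * (-s)) := by
    funext s
    rw [Complex.cpow_def_of_ne_zero hq0]
  rw [h]
  fun_prop

/-- For `1 ≤ ‖T₀‖` the first denominator does not vanish, and the factor of one place `v` in `S`
cancels the second because `δ ∣ deg v`. A further place makes the result vanish where the pole was.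
-/
theorem continuousAt_zeta_mul_prod {V : Type*} [DecidableEq V] (deg : V → ℕ) (q δ : ℕ) (hq : 1 < q)
    (hδ : 0 < δ) (hdeg : ∀ v, δ ∣ deg v) (N A B : ℂ[X]) (S : Finset V) (hS : 2 ≤ S.card) {T₀ : ℂ}
    (hT₀ : 1 ≤ ‖T₀‖) :
    ContinuousAt (fun T : ℂ => (N.eval T + A.eval T / (1 - ((q : ℂ) * T) ^ δ) + B.eval T / (1 - T ^ δ))
      * ∏ v ∈ S, (1 - T ^ deg v)) T₀ ∧
    (T₀ = 1 → (N.eval T₀ + A.eval T₀ / (1 - ((q : ℂ) * T₀) ^ δ) + B.eval T₀ / (1 - T₀ ^ δ))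
      * ∏ v ∈ S, (1 - T₀ ^ deg v) = 0) := by
  obtain ⟨v, hv, w, hw, hvw⟩ := Finset.one_lt_card.1 hS
  obtain ⟨k, hk⟩ := hdeg v
  have hne : 1 - ((q : ℂ) * T₀) ^ δ ≠ 0 := by
    intro h
    have h1 := congrArg norm (sub_eq_zero.1 h)
    rw [norm_one, norm_pow, norm_mul, Complex.norm_natCast] at h1
    have hq' : (1 : ℝ) < q := by exact_mod_cast hq
    have h2 : (1 : ℝ) < q * ‖T₀‖ := by nlinarith
    exact (one_lt_pow₀ h2 hδ.ne').ne h1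
  have h : (fun T : ℂ => (N.eval T + A.eval T / (1 - ((q : ℂ) * T) ^ δ) + B.eval T / (1 - T ^ δ))
      * ∏ v ∈ S, (1 - T ^ deg v)) = fun T : ℂ => (N.eval T + A.eval T / (1 - ((q : ℂ) * T) ^ δ))
      * ∏ v ∈ S, (1 - T ^ deg v) + B.eval T * (∑ i ∈ Finset.range k, (T ^ δ) ^ i)
      * ∏ v ∈ S.erase v, (1 - T ^ deg v) := by
    funext T
    rw [add_mul (N.eval T + _)]
    congr 1
    rw [← Finset.mul_prod_erase S _ hv, hk, pow_mul]
    -- At the poles the quotient has the default value `0`. The formula without denominator agrees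
    -- there because the factor of `w` vanishes, so the two functions are equal everywhere.
    by_cases hT : T ^ δ = 1
    · obtain ⟨l, hl⟩ := hdeg w
      rw [Finset.prod_eq_zero (Finset.mem_erase.2 ⟨hvw.symm, hw⟩) (by rw [hl, pow_mul, hT]; simp)]
      simp
    · rw [← mul_neg_geom_sum (T ^ δ) k]
      have : 1 - T ^ δ ≠ 0 := sub_ne_zero.2 (Ne.symm hT)
      field_simp
  constructor
  · rw [h]
    have hN := N.continuous.continuousAt (x := T₀)
    have hA := A.continuous.continuousAt (x := T₀)
    have hB := B.continuous.continuousAt (x := T₀)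
    refine ((hN.add (hA.div (by fun_prop) hne)).mul (by fun_prop)).add
      ((hB.mul (by fun_prop)).mul (by fun_prop))
  · rintro rfl
    rw [Finset.prod_eq_zero hv (by simp), mul_zero]

theorem hasModifiedLValue_zero {F K k : Type*} [Field F] [Fintype F] [Field K] [Algebra F K]
    [Algebra.IsAlgebraic F K] [Field k] [Algebra F k] [IsOneVariable F k] {n : ℕ}
    [DecidableEq F[X]] {G S₀ : LinAlgGroup F K n} {M : Multiset F[X]}
    (J : Finset (Σ _ : F[X], ℕ × ℕ)) (hJ : J ⊆ weightIndex M)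
    (hdet : ∀ (m : ℕ) (t : ℂ), motiveDet G S₀ m t
      = ∏ a ∈ J, (1 - t * (Fintype.card F : ℂ) ^ (a.2.1 * m) * weightRoot a ^ m))
    {p : F[X]} (hp : ⟨p, (0, 0)⟩ ∈ J) (S : Finset (Place F k)) (hS : 2 ≤ S.card) :
    HasModifiedLValue G S₀ S ∅ 0 := by
  classical
  obtain ⟨δ, N, A, B, hδ, hdeg, hZ⟩ := exists_zeta F k
  have hq : 1 < Fintype.card F := Fintype.one_lt_card
  generalize hqF : Fintype.card F = q at *
  let T : (Σ _ : F[X], ℕ × ℕ) → ℂ → ℂ := fun a s => (q : ℂ) ^ (-s) * ((q : ℂ) ^ a.2.1 * weightRoot a)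
  let Z : ℂ → ℂ := fun T => N.eval T + A.eval T / (1 - ((q : ℂ) * T) ^ δ) + B.eval T / (1 - T ^ δ)
  have hloc : ∀ (v : Place F k) (s : ℂ),
      localL G S₀ v s = ∏ a ∈ J, (1 - T a s ^ v.deg)⁻¹ := by
    intro v s
    rw [localL, hdet, Finset.prod_inv_distrib, hqF]
    congr 1
    refine Finset.prod_congr rfl fun a _ => ?_
    simp only [T]
    rw [Complex.cpow_mul_nat, mul_pow, mul_pow, ← pow_mul]
    ring
  -- The exponents `a.2.1` are less than `card M`, so for `Re s` beyond this bound all arguments `T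
  -- a s` lie in the disc of radius `q⁻¹` where the Euler product for `Z` converges.
  refine ⟨fun s => ∏ a ∈ J, Z (T a s), ⟨?_, Multiset.card M + 1, fun s hs => ?_⟩, ?_⟩
  · refine Meromorphic.fun_prod fun a _ => ?_
    have hT : Meromorphic (T a) := (meromorphic_natCast_cpow_neg hq).mul (Meromorphic.const _)
    have h1 := hT.polynomial_eval N
    have h2 := hT.polynomial_eval A
    have h3 := hT.polynomial_eval B
    have h4 : Meromorphic fun s => 1 - ((q : ℂ) * T a s) ^ δ := by fun_prop
    have h5 : Meromorphic fun s => 1 - T a s ^ δ := by fun_prop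
    exact (h1.add (h2.div h4)).add (h3.div h5)
  · simp only [hloc]
    refine hasProd_prod fun a ha => hZ (T a s) ?_
    have ha' := hJ ha
    have hlt : a.2.1 < Multiset.card M := by
      rw [weightIndex, Finset.mem_sigma, Finset.mem_product, Finset.mem_range] at ha'
      exact ha'.2.1.trans_le (Multiset.count_le_card _ _)
    have hq0 : (0 : ℝ) < q := by exact_mod_cast (by omega : 0 < q)
    simp only [T]
    rw [norm_mul, norm_weight ha', Complex.norm_natCast_cpow_of_pos (by omega), Complex.neg_re,
      ← Real.rpow_natCast, ← Real.rpow_add hq0, ← Real.rpow_neg_one]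
    refine Real.rpow_lt_rpow_of_exponent_lt (by exact_mod_cast hq) ?_
    have : ((a.2.1 + 1 : ℕ) : ℝ) ≤ Multiset.card M := by exact_mod_cast hlt
    push_cast at this
    linarith
  · have hprod : ∀ s, (∏ a ∈ J, Z (T a s)) / ((∏ v ∈ S, localL G S₀ v s) *
        ∏ v ∈ (∅ : Finset (Place F k)), localL G S₀ v (s - 1))
        = ∏ a ∈ J, (Z (T a s) * ∏ v ∈ S, (1 - T a s ^ v.deg)) := by
      intro s
      rw [Finset.prod_empty, mul_one, Finset.prod_mul_distrib, div_eq_mul_inv]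
      congr 1
      simp only [hloc]
      rw [Finset.prod_comm, ← Finset.prod_inv_distrib]
      simp only [Finset.prod_inv_distrib, inv_inv]
    have hT0 : ∀ a, T a 0 = (q : ℂ) ^ a.2.1 * weightRoot a := fun a => by simp [T]
    have hTc : ∀ a, ContinuousAt (T a) 0 := by
      intro a
      have hq0 : (q : ℂ) ≠ 0 := by exact_mod_cast (by omega : q ≠ 0)
      exact ((continuous_neg.const_cpow (Or.inl hq0)).mul continuous_const).continuousAt
    have key : ∀ a ∈ J, 1 ≤ ‖T a 0‖ := by
      intro a ha
      rw [hT0, norm_weight (hJ ha)]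
      exact one_le_pow₀ (by exact_mod_cast hq.le)
    have hlim : Filter.Tendsto (fun s => ∏ a ∈ J, (Z (T a s) * ∏ v ∈ S, (1 - T a s ^ v.deg)))
        (𝓝[≠] 0) (𝓝 (∏ a ∈ J, (Z (T a 0) * ∏ v ∈ S, (1 - T a 0 ^ v.deg)))) := by
      refine tendsto_finsetProd _ fun a ha => Filter.Tendsto.mono_left ?_ nhdsWithin_le_nhds
      exact ContinuousAt.comp (f := T a) (x := 0)
        (continuousAt_zeta_mul_prod Place.deg q δ hq hδ hdeg N A B S hS (key a ha)).1 (hTc a)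
    -- The index `⟨p, (0, 0)⟩` belongs to the eigenvalue `1`, so its argument is `T = 1` at `s = 0`.
    rw [Finset.prod_eq_zero hp ((continuousAt_zeta_mul_prod Place.deg q δ hq hδ hdeg N A B S hS
      (key _ hp)).2 (by rw [hT0]; simp [weightRoot]))] at hlim
    exact hlim.congr fun s => (hprod s).symm

end LValue
end

noncomputable section

/-! ### The character group of a diagonalized torus -/

theorem exists_units_zpow_ne_one (K : Type*) [Field K] [Infinite K] {N : ℤ} (hN : N ≠ 0) :
    ∃ z : Kˣ, z ^ N ≠ 1 := by
  classical
  obtain ⟨z, hz⟩ := Infinite.exists_notMem_finset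
    (insert (0 : K) (Polynomial.nthRootsFinset N.natAbs (1 : K)))
  rw [Finset.mem_insert, not_or, Polynomial.mem_nthRootsFinset (Int.natAbs_pos.2 hN)] at hz
  refine ⟨Units.mk0 z hz.1, fun h => hz.2 ?_⟩
  have h1 : (Units.mk0 z hz.1) ^ N.natAbs = 1 := by
    rcases Int.natAbs_eq N with h2 | h2
    · rwa [← zpow_natCast, ← h2]
    · rwa [← zpow_natCast, ← inv_eq_one, ← zpow_neg, ← h2]
  simpa using congrArg Units.val h1

/-- The invertible diagonal matrix with given entries. -/
def diagGL {K : Type*} [Field K] {n : ℕ} (a : Fin n → Kˣ) : GL (Fin n) K where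
  val := Matrix.diagonal fun i => (a i : K)
  inv := Matrix.diagonal fun i => ((a i)⁻¹ : Kˣ)
  val_inv := by simp [Matrix.diagonal_mul_diagonal]
  inv_val := by simp [Matrix.diagonal_mul_diagonal]

theorem val_conj_diagGL {K : Type*} [Field K] {n : ℕ} (Y : GL (Fin n) K) (a : Fin n → Kˣ) :
    (Y * (Y⁻¹ * diagGL a * Y) * Y⁻¹).1 = Matrix.diagonal fun i => (a i : K) := by
  rw [show Y * (Y⁻¹ * diagGL a * Y) * Y⁻¹ = diagGL a by group]
  rfl

theorem det_conj {K : Type*} [Field K] {n : ℕ} (Y g : GL (Fin n) K) :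
    (Y * g * Y⁻¹).1.det = g.1.det := by
  have h : Y.1.det * Y⁻¹.1.det = 1 := by
    rw [← Matrix.det_mul, ← Units.val_mul, mul_inv_cancel, Units.val_one, Matrix.det_one]
  rw [Units.val_mul, Units.val_mul, Matrix.det_mul, Matrix.det_mul, mul_right_comm, h, one_mul]

theorem eval_mem_subalgebra {K X σ : Type*} [Field K] (A : Subalgebra K (X → K)) (v : σ → X → K)
    (hv : ∀ x, v x ∈ A) (p : MvPolynomial σ K) :
    (fun t => MvPolynomial.eval (fun x => v x t) p) ∈ A := by
  induction p using MvPolynomial.induction_on with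
  | C c =>
    convert A.algebraMap_mem c using 1
    funext t
    rw [MvPolynomial.eval_C]
    rfl
  | add p q hp hq =>
    convert A.add_mem hp hq using 1
    funext t
    rw [map_add]
    rfl
  | mul_X p x hp =>
    convert A.mul_mem hp (hv x) using 1
    funext t
    rw [map_mul, MvPolynomial.eval_X]
    rfl

section Torus

variable {F K : Type*} [Field F] [Field K] [Algebra F K] {n : ℕ}

/-- The invertible matrix `Y` diagonalizes `γ` and identifies `T` with the diagonal matrices of
determinant `1`; the Galois group permutes the rows of `Y`. -/
structure IsDiagonalizing (γ : Matrix.SpecialLinearGroup (Fin n) F) (T : LinAlgGroup F K n)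
    (Y : GL (Fin n) K) (lam : Fin n → K) : Prop where
  mem_iff : ∀ t, t ∈ T.points ↔ (Y * t * Y⁻¹).1.IsDiag ∧ t.1.det = 1
  mul_eq : Y.1 * γ.1.map (algebraMap F K) = Matrix.diagonal lam * Y.1
  exists_perm : ∀ σ : Gal(K/F), ∃ π : Equiv.Perm (Fin n), ∀ i a, σ (Y.1 i a) = Y.1 (π i) a

namespace IsDiagonalizing

variable {γ : Matrix.SpecialLinearGroup (Fin n) F} {T : LinAlgGroup F K n} {Y : GL (Fin n) K}
  {lam : Fin n → K} (h : IsDiagonalizing γ T Y lam)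
include h

theorem conj_eq_diagonal (t : T.points) :
    (Y * t.1 * Y⁻¹).1 = Matrix.diagonal fun i => (Y * t.1 * Y⁻¹).1 i i :=
  (((h.mem_iff t.1).1 t.2).1.diagonal_diag).symm

/-- The `i`-th diagonal entry as a character. -/
def coord (h : IsDiagonalizing γ T Y lam) (i : Fin n) : T.points →* Kˣ :=
  MonoidHom.toHomUnits
    { toFun := fun t => (Y * t.1 * Y⁻¹).1 i i
      map_one' := by simp
      map_mul' := fun s t => by
        have h1 : Y * (s * t : T.points).1 * Y⁻¹ = (Y * s.1 * Y⁻¹) * (Y * t.1 * Y⁻¹) := by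
          rw [Subgroup.coe_mul]
          group
        rw [h1, Units.val_mul, h.conj_eq_diagonal s, h.conj_eq_diagonal t,
          Matrix.diagonal_mul_diagonal]
        simp }

theorem coe_coord (i : Fin n) (t : T.points) : (h.coord i t : K) = (Y * t.1 * Y⁻¹).1 i i := rfl

theorem conj_eq (t : T.points) : Y * t.1 * Y⁻¹ = diagGL fun i => h.coord i t :=
  Units.ext (h.conj_eq_diagonal t)

theorem val_eq (t : T.points) : t.1 = Y⁻¹ * diagGL (fun i => h.coord i t) * Y := by
  rw [← h.conj_eq]
  group

theorem prod_coord (t : T.points) : ∏ i, h.coord i t = 1 := by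
  have h1 := ((h.mem_iff t.1).1 t.2).2
  rw [← det_conj Y, h.conj_eq_diagonal, Matrix.det_diagonal] at h1
  ext
  rw [Units.coe_prod]
  exact h1

/-- The point of the torus with given diagonal entries. -/
def point (h : IsDiagonalizing γ T Y lam) (a : Fin n → Kˣ) (ha : ∏ i, a i = 1) : T.points :=
  ⟨Y⁻¹ * diagGL a * Y, (h.mem_iff _).2 (by
    constructor
    · rw [val_conj_diagGL]
      exact Matrix.isDiag_diagonal _
    · rw [← det_conj Y, val_conj_diagGL, Matrix.det_diagonal, ← Units.coe_prod, ha, Units.val_one])⟩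

theorem coord_point (a : Fin n → Kˣ) (ha : ∏ i, a i = 1) (i : Fin n) :
    h.coord i (h.point a ha) = a i := by
  ext
  rw [coe_coord]
  exact (congrFun (congrFun (val_conj_diagGL Y a) i) i).trans (Matrix.diagonal_apply_eq _ i)

theorem coord_mem (i : Fin n) : h.coord i ∈ charGroup T.points := by
  refine ⟨∑ l, (∑ k, MvPolynomial.C (Y.1 i k) * MvPolynomial.X (Sum.inl (k, l))) *
    MvPolynomial.C (Y⁻¹.1 l i), fun t => ?_⟩
  change (Y * t.1 * Y⁻¹).1 i i = _
  simp [Matrix.mul_apply]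

/-- The `i`-th diagonal entry as an element of the character group. -/
def char (h : IsDiagonalizing γ T Y lam) (i : Fin n) : charGroup T.points :=
  ⟨h.coord i, h.coord_mem i⟩

/-- The monomials in the diagonal entries. -/
def mono (h : IsDiagonalizing γ T Y lam) : Multiplicative (Fin n → ℤ) →* charGroup T.points where
  toFun k := ∏ i, h.char i ^ (k.toAdd i)
  map_one' := by simp
  map_mul' k l := by simp [zpow_add, Finset.prod_mul_distrib]

theorem mono_apply (k : Fin n → ℤ) (t : T.points) :
    (h.mono (Multiplicative.ofAdd k)).1 t = ∏ i, h.coord i t ^ k i := by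
  simp only [mono, MonoidHom.coe_mk, OneHom.coe_mk, toAdd_ofAdd]
  rw [Subgroup.val_finsetProd, MonoidHom.finsetProd_apply]
  rfl

/-- The regular functions are spanned by the monomials. -/
theorem regular_mem_span (f : T.points → K) (hf : IsRegularFun T.points f) :
    f ∈ Submodule.span K (Set.range fun k : Multiplicative (Fin n → ℤ) =>
      fun t => (((h.mono k).1 t : Kˣ) : K)) := by
  let Φ : Multiplicative (Fin n → ℤ) →* (T.points → K) :=
    { toFun := fun k t => (((h.mono k).1 t : Kˣ) : K)
      map_one' := by ext; simp
      map_mul' := fun k l => by ext; simp }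
  -- The monomials form a monoid, so their span is already an algebra, and it suffices that it
  -- contains the matrix entries of `t` and `t⁻¹`.
  have hspan : Submodule.span K (Set.range Φ) = Subalgebra.toSubmodule
      (Algebra.adjoin K (Set.range Φ)) := by
    rw [Algebra.adjoin_eq_span, ← MonoidHom.coe_mrange, Submonoid.closure_eq]
  show f ∈ Submodule.span K (Set.range Φ)
  rw [hspan, Subalgebra.mem_toSubmodule]
  obtain ⟨p, hp⟩ := hf
  have hmem : ∀ k : Fin n → ℤ, (fun t => ((∏ i, h.coord i t ^ k i : Kˣ) : K))
      ∈ Algebra.adjoin K (Set.range Φ) := fun k =>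
    Algebra.subset_adjoin ⟨Multiplicative.ofAdd k, funext fun t => by
      exact congrArg Units.val (h.mono_apply k t)⟩
  have hsingle : ∀ i (c : ℤ), (fun t => ((h.coord i t ^ c : Kˣ) : K))
      ∈ Algebra.adjoin K (Set.range Φ) := by
    intro i c
    have h1 := hmem (Pi.single i c)
    have h2 : ∀ t, ∏ j, h.coord j t ^ (Pi.single i c : Fin n → ℤ) j = h.coord i t ^ c := by
      intro t
      rw [Finset.prod_eq_single i (fun j _ hj => by simp [hj]) (by simp)]
      simp
    simpa only [h2] using h1
  have hentry : ∀ (c : ℤ) (k l : Fin n), (fun t => ∑ i, Y⁻¹.1 k i * ((h.coord i t ^ c : Kˣ) : K) * Y.1 i l)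
      ∈ Algebra.adjoin K (Set.range Φ) := by
    intro c k l
    have h1 : (fun t => ∑ i, Y⁻¹.1 k i * ((h.coord i t ^ c : Kˣ) : K) * Y.1 i l)
        = ∑ i, (Y⁻¹.1 k i * Y.1 i l) • fun t => ((h.coord i t ^ c : Kˣ) : K) := by
      funext t
      rw [Finset.sum_apply]
      refine Finset.sum_congr rfl fun i _ => ?_
      simp only [Pi.smul_apply, smul_eq_mul]
      ring
    rw [h1]
    exact Subalgebra.sum_mem _ fun i _ => Subalgebra.smul_mem _ (hsingle i c) _
  have hgl : ∀ (a : Fin n → Kˣ) (k l : Fin n), (Y⁻¹ * diagGL a * Y).1 k l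
      = ∑ i, Y⁻¹.1 k i * (a i : K) * Y.1 i l := by
    intro a k l
    rw [Units.val_mul, Units.val_mul, Matrix.mul_apply]
    refine Finset.sum_congr rfl fun i _ => ?_
    rw [show (diagGL a).1 = Matrix.diagonal fun i => (a i : K) from rfl, Matrix.mul_diagonal]
  have hf : f = fun t => MvPolynomial.eval (fun x => (Sum.elim (fun ij t => t.1.1 ij.1 ij.2)
      (fun ij t => (t⁻¹).1.1 ij.1 ij.2) : _ → T.points → K) x t) p := by
    funext t
    rw [hp]
    congr 2
    funext x
    rcases x with x | x <;> rfl
  rw [hf]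
  refine eval_mem_subalgebra _ _ (fun x => ?_) p
  rcases x with x | x
  · have h1 := hentry 1 x.1 x.2
    refine (congrArg (· ∈ Algebra.adjoin K (Set.range Φ)) (funext fun t => ?_)).mp h1
    rw [← hgl]
    refine Eq.trans ?_ (GL_entry_congr (h.val_eq t) x.1 x.2).symm
    simp only [zpow_one]
  · have h1 := hentry (-1) x.1 x.2
    refine (congrArg (· ∈ Algebra.adjoin K (Set.range Φ)) (funext fun t => ?_)).mp h1
    rw [← hgl]
    refine Eq.trans ?_ (GL_entry_congr (h.val_eq t⁻¹) x.1 x.2).symm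
    simp only [zpow_neg_one, map_inv]

/-- Every character is a monomial in the diagonal entries. -/
theorem mono_surjective : Function.Surjective h.mono := by
  rintro ⟨χ, hχ⟩
  have h1 := h.regular_mem_span _ hχ
  -- By Dedekind's independence of characters, a character in the span of the monomials is one of
  -- them.
  have hlin := linearIndependent_monoidHom T.points K
  by_contra hne
  refine hlin.notMem_span_image (s := Set.range fun k : Multiplicative (Fin n → ℤ) =>
    (Units.coeHom K).comp (h.mono k).1) (x := (Units.coeHom K).comp χ) ?_ ?_
  · rintro ⟨k, hk⟩
    refine hne ⟨k, Subtype.ext (MonoidHom.ext fun t => Units.ext ?_)⟩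
    exact DFunLike.congr_fun hk t
  · rw [← Set.range_comp]
    exact h1

/-- Evaluation at the point with entries `z` and `z⁻¹` in the places `i` and `j`; an infinite field
has a `z` which is not a root of unity of the order in question. -/
theorem mono_eq_one [Infinite K] (k : Fin n → ℤ) (hk : h.mono (Multiplicative.ofAdd k) = 1)
    (i j : Fin n) : k i = k j := by
  by_contra hij
  have hne : i ≠ j := fun e => hij (e ▸ rfl)
  obtain ⟨z, hz⟩ := exists_units_zpow_ne_one K (sub_ne_zero.2 hij)
  let a : Fin n → Kˣ := Pi.mulSingle i z * Pi.mulSingle j z⁻¹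
  have ha : ∏ l, a l = 1 := by
    simp [a, Finset.prod_mul_distrib]
  have h1 := h.mono_apply k (h.point a ha)
  rw [hk] at h1
  simp only [coord_point] at h1
  have h2 : ∏ l, a l ^ k l = z ^ (k i - k j) := by
    simp only [a, Pi.mul_apply, mul_zpow, Finset.prod_mul_distrib]
    rw [Finset.prod_eq_single i (fun l _ hl => by simp [hl]) (by simp),
      Finset.prod_eq_single j (fun l _ hl => by simp [hl]) (by simp)]
    simp [zpow_sub]
  rw [h2] at h1
  exact hz h1.symm

theorem prod_char : ∏ i, h.char i = 1 := by
  refine Subtype.ext (MonoidHom.ext fun t => ?_)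
  rw [Subgroup.val_finsetProd, MonoidHom.finsetProd_apply]
  exact h.prod_coord t

/-- The diagonal entries in `X^*(T) ⊗ ℚ`. -/
def vec (h : IsDiagonalizing γ T Y lam) (i : Fin n) : ratChar T :=
  (1 : ℚ) ⊗ₜ[ℤ] Additive.ofMul (h.char i)

theorem ratMap_vec (f : charGroup T.points →* charGroup T.points) {i j : Fin n}
    (hf : f (h.char i) = h.char j) : ratMap T f (h.vec i) = h.vec j := by
  unfold ratMap vec
  rw [LinearMap.baseChange_tmul, ← hf]
  rfl

theorem span_vec : Submodule.span ℚ (Set.range h.vec) = ⊤ := by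
  rw [eq_top_iff]
  rintro y -
  induction y using TensorProduct.induction_on with
  | zero => exact zero_mem _
  | add a b ha hb => exact add_mem ha hb
  | tmul c χ =>
    obtain ⟨k, hk⟩ := h.mono_surjective χ.toMul
    have h1 : χ = ∑ i, k.toAdd i • Additive.ofMul (h.char i) := by
      refine (congrArg Additive.ofMul hk.symm).trans ?_
      simp only [mono, MonoidHom.coe_mk, OneHom.coe_mk]
      rw [ofMul_prod]
      rfl
    rw [h1, TensorProduct.tmul_sum]
    refine Submodule.sum_mem _ fun i _ => ?_
    have h2 : c ⊗ₜ[ℤ] (k.toAdd i • Additive.ofMul (h.char i)) = (c * k.toAdd i) • h.vec i := by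
      rw [vec, TensorProduct.smul_tmul', smul_eq_mul, mul_one, ← TensorProduct.smul_tmul,
        zsmul_eq_mul, mul_comm]
    rw [h2]
    exact Submodule.smul_mem _ _ (Submodule.subset_span ⟨i, rfl⟩)

theorem sum_vec : ∑ i, h.vec i = 0 := by
  unfold vec
  rw [← TensorProduct.tmul_sum, ← ofMul_prod, h.prod_char, ofMul_one, TensorProduct.tmul_zero]

/-- The character group is a quotient of `ℤ ^ n` by constant vectors, and the pairing with `c` kills
these. So the vanishing of the sum is the only linear relation among the diagonal characters. -/
theorem exists_functional [Infinite K] (c : Fin n → ℂ) (hc : ∑ i, c i = 0) :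
    ∃ l : ratChar T →ₗ[ℚ] ℂ, ∀ i, l (h.vec i) = c i := by
  let ψ : (Fin n → ℤ) →+ ℂ := 
    { toFun := fun k => ∑ i, k i * c i
      map_zero' := by simp
      map_add' := fun k l => by simp [add_mul, Finset.sum_add_distrib] }
  let φ : (Fin n → ℤ) →+ Additive (charGroup T.points) := MonoidHom.toAdditiveRight h.mono
  have hφ : Function.Surjective φ := h.mono_surjective
  have hker : φ.ker ≤ ψ.ker := by
    intro k hk
    rw [AddMonoidHom.mem_ker] at hk ⊢
    have h1 := h.mono_eq_one k hk
    show ∑ i, (k i : ℂ) * c i = 0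
    rcases isEmpty_or_nonempty (Fin n) with h2 | ⟨⟨j⟩⟩
    · simp
    · rw [Finset.sum_congr rfl fun i _ => by rw [h1 i j], ← Finset.mul_sum, hc, mul_zero]
  let l0 : Additive (charGroup T.points) →+ ℂ :=
    φ.liftOfRightInverse (Function.surjInv hφ) (Function.rightInverse_surjInv hφ) ⟨ψ, hker⟩
  refine ⟨LinearMap.liftBaseChange ℚ l0.toIntLinearMap, fun i => ?_⟩
  have h1 : φ (Pi.single i 1) = Additive.ofMul (h.char i) := by
    refine congrArg Additive.ofMul (?_ : h.mono (Multiplicative.ofAdd (Pi.single i 1)) = h.char i)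
    simp only [mono, MonoidHom.coe_mk, OneHom.coe_mk, toAdd_ofAdd]
    rw [Finset.prod_eq_single i (fun j _ hj => by simp [hj]) (by simp)]
    simp
  have h2 : l0 (φ (Pi.single i 1)) = ψ (Pi.single i 1) :=
    AddMonoidHom.liftOfRightInverse_comp_apply _ _ _ _ _
  rw [vec, LinearMap.liftBaseChange_tmul, one_smul, ← h1]
  refine h2.trans ?_
  show ∑ j, (((Pi.single i 1 : Fin n → ℤ) j : ℤ) : ℂ) * c j = c i
  rw [Finset.sum_eq_single i (fun j _ hj => by simp [hj]) (by simp)]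
  simp

end IsDiagonalizing

end Torus
end

noncomputable section

/-! ### The Galois action and the Weyl group of a diagonalized torus -/

section Torus

variable {F K : Type*} [Field F] [Field K] [Algebra F K] {n : ℕ}

theorem conj_eq_diagonal_of_mul_eq {A t : GL (Fin n) K} {d : Fin n → K}
    (h : A.1 * t.1 = Matrix.diagonal d * A.1) : (A * t * A⁻¹).1 = Matrix.diagonal d := by
  rw [Units.val_mul, Units.val_mul, h, mul_assoc, ← Units.val_mul, mul_inv_cancel, Units.val_one,
    mul_one]

theorem mul_eq_of_conj_eq_diagonal {A t : GL (Fin n) K} {d : Fin n → K}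
    (h : (A * t * A⁻¹).1 = Matrix.diagonal d) : A.1 * t.1 = Matrix.diagonal d * A.1 := by
  rw [← h, ← Units.val_mul, ← Units.val_mul, inv_mul_cancel_right]

theorem mem_slCentralizer {γ : Matrix.SpecialLinearGroup (Fin n) F} {g : GL (Fin n) K} :
    g ∈ (slCentralizer K γ).points ↔ g.1.det = 1 ∧
      Matrix.SpecialLinearGroup.mapGL K γ * g = g * Matrix.SpecialLinearGroup.mapGL K γ := by
  refine and_congr ?_ ?_
  · constructor
    · rintro ⟨s, rfl⟩
      exact s.2
    · exact fun h => ⟨⟨g.1, h⟩, by ext; rfl⟩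
  · exact Subgroup.mem_centralizer_singleton_iff.trans eq_comm

/-- The monomial matrix with entries `a j` in the places `(ρ j, j)`. -/
def monomialMatrix (ρ : Equiv.Perm (Fin n)) (a : Fin n → K) : Matrix (Fin n) (Fin n) K :=
  Matrix.of fun i j => if i = ρ j then a j else 0

theorem det_monomialMatrix (ρ : Equiv.Perm (Fin n)) (a : Fin n → K) :
    (monomialMatrix ρ a).det = Equiv.Perm.sign ρ * ∏ i, a i := by
  have h : monomialMatrix ρ a = Equiv.Perm.permMatrix K ρ⁻¹ * Matrix.diagonal a := by
    ext i j
    rw [Matrix.mul_diagonal]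
    simp [monomialMatrix, Equiv.Perm.permMatrix, PEquiv.toMatrix_apply, Equiv.symm_apply_eq]
  rw [h, Matrix.det_mul, Matrix.det_permutation, Matrix.det_diagonal, Equiv.Perm.sign_inv]

theorem monomialMatrix_mul_diagonal (ρ : Equiv.Perm (Fin n)) (a d : Fin n → K) :
    monomialMatrix ρ a * Matrix.diagonal (d ∘ ρ) = Matrix.diagonal d * monomialMatrix ρ a := by
  ext i j
  rw [Matrix.mul_diagonal, Matrix.diagonal_mul]
  by_cases h : i = ρ j <;> simp [monomialMatrix, h, mul_comm]

/-- Some term of the Leibniz formula is nonzero. Such a permutation suffices to read off how an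
element of the normalizer acts on characters, without showing that it is a monomial matrix. -/
theorem exists_perm_apply_ne_zero {A : Matrix (Fin n) (Fin n) K} (hA : A.det ≠ 0) :
    ∃ ρ : Equiv.Perm (Fin n), ∀ j, A (ρ j) j ≠ 0 := by
  rw [Matrix.det_apply] at hA
  obtain ⟨ρ, -, hρ⟩ := Finset.exists_ne_zero_of_sum_ne_zero hA
  refine ⟨ρ, fun j hj => hρ ?_⟩
  have h : ∏ i, A (ρ i) i = 0 := Finset.prod_eq_zero (Finset.mem_univ j) hj
  exact (congrArg _ h).trans (smul_zero _)

namespace IsDiagonalizing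

variable {γ : Matrix.SpecialLinearGroup (Fin n) F} {T : LinAlgGroup F K n} {Y : GL (Fin n) K}
  {lam : Fin n → K} (h : IsDiagonalizing γ T Y lam)
include h

theorem galGL_mul {σ : Gal(K/F)} {π : Equiv.Perm (Fin n)}
    (hπ : ∀ i a, σ (Y.1 i a) = Y.1 (π i) a) {t : Matrix (Fin n) (Fin n) K} {d : Fin n → K}
    (ht : Y.1 * t = Matrix.diagonal d * Y.1) :
    (galGL σ Y).1 * t = Matrix.diagonal (d ∘ π) * (galGL σ Y).1 := by
  have hZ : ∀ i a, (galGL σ Y).1 i a = Y.1 (π i) a := hπ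
  ext i a
  have h1 := congrFun (congrFun ht (π i)) a
  rw [Matrix.diagonal_mul, Matrix.mul_apply] at h1 ⊢
  simpa only [hZ, Function.comp_apply] using h1

theorem galChar_char {σ : Gal(K/F)} {π : Equiv.Perm (Fin n)}
    (hπ : ∀ i a, σ (Y.1 i a) = Y.1 (π i) a) (i : Fin n) :
    galChar T σ (h.char i) = h.char (π i) := by
  refine Subtype.ext (MonoidHom.ext fun t => Units.ext ?_)
  have h1 : galGL σ (Y * (T.galPoints σ⁻¹ t).1 * Y⁻¹) = galGL σ Y * t.1 * (galGL σ Y)⁻¹ := by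
    rw [map_mul, map_mul, map_inv]
    congr 2
    exact galGL_galGL_inv σ t.1
  have h2 := conj_eq_diagonal_of_mul_eq
    (h.galGL_mul hπ (mul_eq_of_conj_eq_diagonal (h.conj_eq_diagonal t)))
  refine (GL_entry_congr h1 i i).trans ?_
  rw [h2, Matrix.diagonal_apply_eq]
  rfl

/-- Since `γ` is fixed by `σ`, the conjugate `σ(Y)` diagonalizes it in two ways: with eigenvalues `σ
∘ lam`, and, its rows being permuted rows of `Y`, with eigenvalues `lam ∘ π`. -/
theorem lam_perm {σ : Gal(K/F)} {π : Equiv.Perm (Fin n)}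
    (hπ : ∀ i a, σ (Y.1 i a) = Y.1 (π i) a) (i : Fin n) : lam (π i) = σ (lam i) := by
  have h1 := conj_eq_diagonal_of_mul_eq (t := Matrix.SpecialLinearGroup.mapGL K γ)
    (h.galGL_mul hπ h.mul_eq)
  have h2 : (galGL σ Y).1 * γ.1.map (algebraMap F K)
      = Matrix.diagonal (σ ∘ lam) * (galGL σ Y).1 := by
    have h3 := congrArg (fun A => A.map (σ : K →+* K)) h.mul_eq
    rw [Matrix.map_mul, Matrix.map_mul] at h3
    have h4 : (γ.1.map (algebraMap F K)).map (σ : K →+* K) = γ.1.map (algebraMap F K) := by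
      ext i j
      exact σ.commutes _
    rw [h4, Matrix.diagonal_map (map_zero _)] at h3
    exact h3
  have h5 := conj_eq_diagonal_of_mul_eq (t := Matrix.SpecialLinearGroup.mapGL K γ) h2
  exact congrFun (Matrix.diagonal_injective (h1.symm.trans h5)) i

theorem conj_commute {w : GL (Fin n) K} (hw : w ∈ (slCentralizer K γ).points) (i j : Fin n) :
    (Y * w * Y⁻¹).1 i j * lam j = lam i * (Y * w * Y⁻¹).1 i j := by
  have h1 := conj_eq_diagonal_of_mul_eq (t := Matrix.SpecialLinearGroup.mapGL K γ) h.mul_eq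
  have h2 : (Y * w * Y⁻¹) * (Y * Matrix.SpecialLinearGroup.mapGL K γ * Y⁻¹)
      = (Y * Matrix.SpecialLinearGroup.mapGL K γ * Y⁻¹) * (Y * w * Y⁻¹) := by
    have h3 := (mem_slCentralizer.1 hw).2
    calc _ = Y * (w * Matrix.SpecialLinearGroup.mapGL K γ) * Y⁻¹ := by group
      _ = Y * (Matrix.SpecialLinearGroup.mapGL K γ * w) * Y⁻¹ := by rw [h3]
      _ = _ := by group
  have h4 := GL_entry_congr h2 i j
  rw [Units.val_mul, Units.val_mul _ (Y * w * Y⁻¹), h1, Matrix.mul_diagonal,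
    Matrix.diagonal_mul] at h4
  exact h4

/-- Compare the entries at `(i, j)` in `w t' = t w`, where `t' = w⁻¹ t w` and both `t` and `t'` are
diagonal in the basis `Y`. -/
theorem weylChar_char (w : normalizerIn (slCentralizer K γ) T) {i j : Fin n}
    (hij : (Y * w.1 * Y⁻¹).1 i j ≠ 0) :
    weylChar (slCentralizer K γ) T w (h.char j) = h.char i := by
  refine Subtype.ext (MonoidHom.ext fun t => Units.ext ?_)
  set t' := conjPoints (slCentralizer K γ) T w t with ht'
  have e : t'.1 = w.1⁻¹ * t.1 * w.1 := by simp [ht', conjPoints]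
  have h2 : (Y * w.1 * Y⁻¹) * (Y * t'.1 * Y⁻¹) = (Y * t.1 * Y⁻¹) * (Y * w.1 * Y⁻¹) := by
    rw [e]
    group
  have h4 := GL_entry_congr h2 i j
  rw [Units.val_mul, Units.val_mul _ (Y * w.1 * Y⁻¹), h.conj_eq_diagonal t,
    h.conj_eq_diagonal t', Matrix.mul_diagonal, Matrix.diagonal_mul, mul_comm] at h4
  exact mul_right_cancel₀ hij h4

theorem exists_mem_normalizerIn [Nonempty (Fin n)] {ρ : Equiv.Perm (Fin n)}
    (hρ : ∀ i, lam (ρ i) = lam i) :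
    ∃ w : normalizerIn (slCentralizer K γ) T, ∀ i, (Y * w.1 * Y⁻¹).1 (ρ i) i ≠ 0 := by
  obtain ⟨i₀⟩ := ‹Nonempty (Fin n)›
  -- One entry is the sign of `ρ`, so that the monomial matrix has determinant `1`.
  let a : Fin n → K := Pi.mulSingle i₀ ((Equiv.Perm.sign ρ : ℤ) : K)
  have hsq : ((Equiv.Perm.sign ρ : ℤ) : K) * ((Equiv.Perm.sign ρ : ℤ) : K) = 1 := by
    rw [← Int.cast_mul, ← Units.val_mul, Int.units_mul_self, Units.val_one, Int.cast_one]
  have ha : ∀ i, a i ≠ 0 := by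
    intro i
    rcases eq_or_ne i i₀ with rfl | hi
    · simp only [a, Pi.mulSingle_eq_same]
      exact left_ne_zero_of_mul (hsq.trans_ne one_ne_zero)
    · simp [a, hi]
  have hdet : (monomialMatrix ρ a).det = 1 := by
    rw [det_monomialMatrix]
    simp only [a]
    rw [Finset.prod_pi_mulSingle']
    simpa using hsq
  let N : GL (Fin n) K := Matrix.GeneralLinearGroup.mkOfDetNeZero (monomialMatrix ρ a)
    (hdet.trans_ne one_ne_zero)
  have hN : N.1 = monomialMatrix ρ a := rfl
  have hY : Y * (Y⁻¹ * N * Y) * Y⁻¹ = N := by group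
  have hconj : ∀ t, Y * ((Y⁻¹ * N * Y) * t * (Y⁻¹ * N * Y)⁻¹) * Y⁻¹
      = N * (Y * t * Y⁻¹) * N⁻¹ := fun t => by group
  have hdetN : (Y⁻¹ * N * Y).1.det = 1 := by
    rw [← det_conj Y, hY]
    exact hdet
  have hdett : ∀ t, ((Y⁻¹ * N * Y) * t * (Y⁻¹ * N * Y)⁻¹).1.det = t.1.det :=
    fun t => det_conj _ t
  refine ⟨⟨Y⁻¹ * N * Y, mem_slCentralizer.2 ⟨hdetN, ?_⟩, ?_⟩, fun i => ?_⟩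
  · have h1 := conj_eq_diagonal_of_mul_eq (t := Matrix.SpecialLinearGroup.mapGL K γ) h.mul_eq
    have h2 : N * (Y * Matrix.SpecialLinearGroup.mapGL K γ * Y⁻¹)
        = (Y * Matrix.SpecialLinearGroup.mapGL K γ * Y⁻¹) * N := by
      refine Units.ext ?_
      rw [Units.val_mul, Units.val_mul _ N, h1, hN, ← monomialMatrix_mul_diagonal]
      congr 2
      funext i
      exact (hρ i).symm
    calc _ = Y⁻¹ * ((Y * Matrix.SpecialLinearGroup.mapGL K γ * Y⁻¹) * N) * Y := by group
      _ = Y⁻¹ * (N * (Y * Matrix.SpecialLinearGroup.mapGL K γ * Y⁻¹)) * Y := by rw [h2]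
      _ = _ := by group
  · refine Subgroup.mem_normalizer_iff.2 fun t => ?_
    rw [h.mem_iff, h.mem_iff, hdett, hconj]
    refine and_congr_left fun _ => ⟨fun ht => ?_, fun ht => ?_⟩
    · obtain ⟨d, hd⟩ : ∃ d : Fin n → K, (Y * t * Y⁻¹).1 = Matrix.diagonal (d ∘ ρ) :=
        ⟨(Y * t * Y⁻¹).1.diag ∘ ρ.symm, by
          rw [Function.comp_assoc, Equiv.symm_comp_self, Function.comp_id]
          exact ht.diagonal_diag.symm⟩
      rw [conj_eq_diagonal_of_mul_eq (d := d) (by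
        rw [hd, hN, monomialMatrix_mul_diagonal])]
      exact Matrix.isDiag_diagonal _
    · obtain ⟨d, hd⟩ : ∃ d : Fin n → K, (N * (Y * t * Y⁻¹) * N⁻¹).1 = Matrix.diagonal d :=
        ⟨_, ht.diagonal_diag.symm⟩
      have h1 := mul_eq_of_conj_eq_diagonal hd
      rw [hN, ← monomialMatrix_mul_diagonal, ← hN] at h1
      have h2 := N.isUnit.mul_left_cancel h1
      rw [h2]
      exact Matrix.isDiag_diagonal _
  · dsimp only
    rw [hY, hN]
    simpa [monomialMatrix] using ha i

/-- The action of the Weyl group on the characters of a diagonalized torus. -/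
theorem isYoungAction [Infinite K] [Nonempty (Fin n)] :
    IsYoungAction (weylSet (slCentralizer K γ) T) h.vec lam where
  span_eq_top := h.span_vec
  sum_eq_zero := h.sum_vec
  exists_functional := h.exists_functional
  exists_perm := by
    rintro _ ⟨w, rfl⟩
    obtain ⟨ρ, hρ⟩ := exists_perm_apply_ne_zero (A := (Y * w.1 * Y⁻¹).1)
      ((Matrix.isUnit_iff_isUnit_det _).1 (Y * w.1 * Y⁻¹).isUnit).ne_zero
    refine ⟨ρ, fun i => ?_, fun i => h.ratMap_vec _ (h.weylChar_char w (hρ i))⟩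
    have h1 := h.conj_commute w.2.1 (ρ i) i
    rw [mul_comm] at h1
    exact (mul_right_cancel₀ (hρ i) h1).symm
  exists_mem := by
    intro ρ hρ
    obtain ⟨w, hw⟩ := h.exists_mem_normalizerIn hρ
    exact ⟨_, ⟨w, rfl⟩, fun i => h.ratMap_vec _ (h.weylChar_char w (hw i))⟩

theorem exists_perm_vec (σ : Gal(K/F)) : ∃ π : Equiv.Perm (Fin n),
    (∀ i, ratMap T (galChar T σ) (h.vec i) = h.vec (π i)) ∧ ∀ i, lam (π i) = σ (lam i) := by
  obtain ⟨π, hπ⟩ := h.exists_perm σ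
  exact ⟨π, fun i => h.ratMap_vec _ (h.galChar_char hπ i), h.lam_perm hπ⟩

open Polynomial in
theorem charpoly_map : γ.1.charpoly.map (algebraMap F K) = ∏ i, (X - C (lam i)) := by
  rw [← Matrix.charpoly_map]
  have h1 : (Y * Matrix.SpecialLinearGroup.mapGL K γ * Y⁻¹).1 = _ :=
    conj_eq_diagonal_of_mul_eq h.mul_eq
  have h2 : (Y * Matrix.SpecialLinearGroup.mapGL K γ * Y⁻¹).1.charpoly
      = (γ.1.map (algebraMap F K)).charpoly := by
    rw [Units.val_mul, Units.val_mul, Matrix.coe_units_inv]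
    exact Matrix.charpoly_units_conj Y _
  rw [← h2, h1, Matrix.charpoly_diagonal]

end IsDiagonalizing

/-! ### Multiplicities of eigenvalues and of irreducible factors -/

open Polynomial UniqueFactorizationMonoid

theorem monic_irreducible_of_mem_normalizedFactors [DecidableEq F] {f p : F[X]}
    (hp : p ∈ normalizedFactors f) : p.Monic ∧ Irreducible p := by
  refine ⟨?_, irreducible_of_normalized_factor p hp⟩
  have h1 := normalize_normalized_factor p hp
  rw [← h1]
  exact monic_normalize (irreducible_of_normalized_factor p hp).ne_zero

theorem prod_normalizedFactors_of_monic [DecidableEq F] {f : F[X]} (hf : f.Monic) :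
    (normalizedFactors f).prod = f := by
  rw [prod_normalizedFactors_eq hf.ne_zero, hf.normalize_eq_self]

/-- Over a perfect field an irreducible factor is separable, so it has `μ` as a simple root if it is
the minimal polynomial of `μ` and not at all otherwise. -/
theorem count_roots_multiset_prod [PerfectField F] [Algebra.IsAlgebraic F K] [DecidableEq K]
    [DecidableEq F[X]] (M : Multiset F[X]) (hM : ∀ p ∈ M, p.Monic ∧ Irreducible p) (μ : K) :
    (M.prod.map (algebraMap F K)).roots.count μ = M.count (minpoly F μ) := by
  induction M using Multiset.induction with
  | empty => simp
  | cons p M ih =>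
    have hp := hM p (Multiset.mem_cons_self p M)
    have hM' : ∀ p ∈ M, p.Monic ∧ Irreducible p := fun r hr => hM r (Multiset.mem_cons_of_mem hr)
    have h1 : (M.prod.map (algebraMap F K)).Monic := by
      refine Monic.map _ ?_
      simpa using monic_multiset_prod_of_monic M id fun r hr => (hM' r hr).1
    rw [Multiset.prod_cons, Polynomial.map_mul, roots_mul ((hp.1.map _).mul h1).ne_zero,
      Multiset.count_add, ih hM', Multiset.count_cons, add_comm]
    congr 1
    have h2 : (p.map (algebraMap F K)).roots.Nodup :=
      nodup_roots (PerfectField.separable_of_irreducible hp.2).map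
    rw [Multiset.count_eq_of_nodup h2]
    simp only [mem_roots (hp.1.map _).ne_zero, IsRoot.def, eval_map_algebraMap]
    refine if_congr ⟨fun h => ?_, fun h => ?_⟩ rfl rfl
    · exact (minpoly.eq_of_irreducible_of_monic hp.2 h hp.1).symm
    · rw [← h, minpoly.aeval]

theorem IsDiagonalizing.card_lam_eq [PerfectField F] [Algebra.IsAlgebraic F K] [DecidableEq K]
    [DecidableEq F] [DecidableEq F[X]] {γ : Matrix.SpecialLinearGroup (Fin n) F}
    {T : LinAlgGroup F K n} {Y : GL (Fin n) K} {lam : Fin n → K} (h : IsDiagonalizing γ T Y lam)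
    (μ : K) : Fintype.card {i // lam i = μ}
      = (normalizedFactors γ.1.charpoly).count (minpoly F μ) := by
  rw [← count_roots_multiset_prod _ (fun p hp => monic_irreducible_of_mem_normalizedFactors hp),
    prod_normalizedFactors_of_monic (Matrix.charpoly_monic _), h.charpoly_map]
  have h1 : ∏ i, (X - C (lam i))
      = ((Finset.univ.val.map lam).map fun a => X - C a).prod := by
    rw [Multiset.map_map]
    rfl
  rw [h1, roots_multiset_prod_X_sub_C, Multiset.count_map, Fintype.card_subtype]
  simp only [eq_comm (a := μ)]
  rfl

end Torus
end

noncomputable section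

universe v

/-! ### Commuting semisimple endomorphisms -/

theorem isSemisimple_of_mem_adjoin {F V : Type*} [Field F] [PerfectField F] [AddCommGroup V]
    [Module F V] [FiniteDimensional F V] {s : Set (Module.End F V)}
    (hcomm : ∀ a ∈ s, ∀ b ∈ s, a * b = b * a) (hs : ∀ a ∈ s, a.IsSemisimple)
    {b : Module.End F V} (hb : b ∈ Algebra.adjoin F s) : b.IsSemisimple := by
  have := Algebra.isMulCommutative_adjoin F hcomm
  let _ : CommRing (Algebra.adjoin F s) :=
    { (Algebra.adjoin F s).toRing with mul_comm := mul_comm' }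
  have hc : ∀ x ∈ Algebra.adjoin F s, ∀ y ∈ Algebra.adjoin F s, Commute x y := fun x hx y hy =>
    congrArg Subtype.val (mul_comm (⟨x, hx⟩ : Algebra.adjoin F s) ⟨y, hy⟩)
  induction hb using Algebra.adjoin_induction with
  | mem x hx => exact hs x hx
  | algebraMap c =>
    rw [Algebra.algebraMap_eq_smul_one]
    exact Module.End.IsSemisimple_smul c Module.End.isSemisimple_id
  | add x y hx hy hx' hy' => exact hx'.add_of_commute (hc x hx y hy) hy'
  | mul x y hx hy hx' hy' => exact hx'.mul_of_commute (hc x hx y hy) hy'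

/-- A space with commuting semisimple endomorphisms is a product of fields on which these act by
multiplication. -/
theorem exists_linearEquiv_pi_field {F : Type*} {V : Type v} [Field F] [PerfectField F]
    [AddCommGroup V] [Module F V] [FiniteDimensional F V] {s : Set (Module.End F V)}
    (hcomm : ∀ a ∈ s, ∀ b ∈ s, a * b = b * a) (hs : ∀ a ∈ s, a.IsSemisimple) :
    ∃ (r : ℕ) (L : Fin r → Type v) (_ : ∀ j, Field (L j)) (_ : ∀ j, Algebra F (L j))
      (Ψ : V ≃ₗ[F] ∀ j, L j) (ev : ∀ j, Algebra.adjoin F s →ₐ[F] L j),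
      (∀ j, Function.Surjective (ev j)) ∧ ∀ b v j, Ψ (b.1 v) j = ev j b * Ψ v j := by
  classical
  have := Algebra.isMulCommutative_adjoin F hcomm
  let _ : CommRing (Algebra.adjoin F s) :=
    { (Algebra.adjoin F s).toRing with mul_comm := mul_comm' }
  have hred : IsReduced (Algebra.adjoin F s) := by
    refine ⟨fun x hx => Subtype.ext ?_⟩
    exact Module.End.eq_zero_of_isNilpotent_isSemisimple (hx.map (Algebra.adjoin F s).val)
      (isSemisimple_of_mem_adjoin hcomm hs x.2)
  have : IsArtinianRing (Algebra.adjoin F s) := IsArtinianRing.of_finite F (Algebra.adjoin F s)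
  have : IsSemisimpleRing (Algebra.adjoin F s) := IsArtinianRing.isSemisimpleRing_of_isReduced (Algebra.adjoin F s)
  have : Module.Finite (Algebra.adjoin F s) V := Module.Finite.of_restrictScalars_finite F (Algebra.adjoin F s) V
  -- The generated algebra is commutative, artinian and reduced, hence semisimple; so `V` is a sum
  -- of simple modules, each a quotient of the algebra by a maximal ideal.
  obtain ⟨r, S, e, hS⟩ := IsSemisimpleModule.exists_linearEquiv_fin_dfinsupp (Algebra.adjoin F s) V
  choose m hm eq using fun j => isSimpleModule_iff_quot_maximal.1 (hS j)
  let Ψ : V ≃ₗ[(Algebra.adjoin F s)] ∀ j, (Algebra.adjoin F s) ⧸ m j := e ≪≫ₗ DFinsupp.linearEquivFunOnFintype ≪≫ₗ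
    LinearEquiv.piCongrRight fun j => (eq j).some
  refine ⟨r, fun j => (Algebra.adjoin F s) ⧸ m j, fun j => Ideal.Quotient.field (m j), fun j => inferInstance,
    Ψ.restrictScalars F, fun j => Ideal.Quotient.mkₐ F (m j), fun j => Ideal.Quotient.mk_surjective,
    fun b v j => ?_⟩
  exact congrFun (Ψ.map_smul b v) j

end

noncomputable section

/-! ### Bases of a product of fields over the algebraic closure -/

section FunctionalMatrix

variable {F K : Type*} [Field F] [Field K] [Algebra F K] {n : ℕ}

/-- The matrix of a family of linear forms with values in an extension field. -/
def functionalMatrix (z : Fin n → (Fin n → F) →ₗ[F] K) : Matrix (Fin n) (Fin n) K :=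
  Matrix.of fun i a => z i (Pi.single a 1)

theorem functionalMatrix_mul_map (z : Fin n → (Fin n → F) →ₗ[F] K)
    (A : Matrix (Fin n) (Fin n) F) : functionalMatrix z * A.map (algebraMap F K)
      = functionalMatrix fun i => z i ∘ₗ Matrix.toLin' A := by
  ext i a
  have h : A.mulVec (Pi.single a 1) = ∑ b, A b a • (Pi.single b 1 : Fin n → F) := by
    ext c
    simp [Finset.sum_apply, Pi.single_apply]
  simp only [functionalMatrix, Matrix.mul_apply, Matrix.of_apply, Matrix.map_apply,
    LinearMap.comp_apply, Matrix.toLin'_apply]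
  rw [h, map_sum]
  refine Finset.sum_congr rfl fun b _ => ?_
  rw [map_smul, Algebra.smul_def, mul_comm]

theorem functionalMatrix_mul_map_of_comp {z : Fin n → (Fin n → F) →ₗ[F] K}
    {A : Matrix (Fin n) (Fin n) F} {d : Fin n → K} (h : ∀ i v, z i (A.mulVec v) = d i * z i v) :
    functionalMatrix z * A.map (algebraMap F K) = Matrix.diagonal d * functionalMatrix z := by
  rw [functionalMatrix_mul_map]
  ext i a
  rw [Matrix.diagonal_mul]
  exact h i _

theorem det_functionalMatrix_ne_zero {z : Fin n → (Fin n → F) →ₗ[F] K}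
    (hz : LinearIndependent K z) : (functionalMatrix z).det ≠ 0 := by
  intro h
  obtain ⟨c, hc, hc0⟩ := Matrix.exists_vecMul_eq_zero_iff.2 h
  refine hc (funext fun i => Fintype.linearIndependent_iff.1 hz c ?_ i)
  refine LinearMap.pi_ext' fun a => LinearMap.ext_ring ?_
  have h1 := congrFun hc0 a
  simpa [Matrix.vecMul, dotProduct, functionalMatrix] using h1

end FunctionalMatrix

section PiField

variable {F K : Type*} [Field F] [PerfectField F] [Field K] [Algebra F K] [IsAlgClosed K] {n r : ℕ}
  {L : Fin r → Type*} [∀ j, Field (L j)] [∀ j, Algebra F (L j)] [∀ j, FiniteDimensional F (L j)]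

/-- Dedekind's independence of embeddings on each field factor. As the factors are separable there
are exactly `n` embeddings, so they form the basis sought. -/
theorem linearIndependent_sigma_algHom (Ψ : (Fin n → F) ≃ₗ[F] ∀ j, L j) :
    LinearIndependent K fun x : Σ j, (L j →ₐ[F] K) =>
      x.2.toLinearMap ∘ₗ LinearMap.proj x.1 ∘ₗ Ψ.toLinearMap := by
  classical
  rw [Fintype.linearIndependent_iff]
  rintro c hc ⟨j, φ⟩
  have h1 := linearIndependent_algHom_toLinearMap F (L j) K
  refine Fintype.linearIndependent_iff.1 h1 (fun φ => c ⟨j, φ⟩) ?_ φ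
  ext y
  have h2 := LinearMap.congr_fun hc (Ψ.symm (Pi.single j y))
  rw [LinearMap.sum_apply, Fintype.sum_sigma, Finset.sum_eq_single j] at h2
  · simpa using h2
  · intro i _ hi
    refine Finset.sum_eq_zero fun φ _ => ?_
    simp [hi]
  · simp

theorem card_sigma_algHom (Ψ : (Fin n → F) ≃ₗ[F] ∀ j, L j) :
    Fintype.card (Σ j, (L j →ₐ[F] K)) = n := by
  have h := Ψ.finrank_eq
  rw [Module.finrank_fin_fun, Module.finrank_pi_fintype] at h
  rw [Fintype.card_sigma, h]
  exact Finset.sum_congr rfl fun j _ => AlgHom.card F (L j) K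

/-- If the space `F ^ n` is a product of fields then it has a basis over `K` which is adapted to
the decomposition, permuted by the Galois group, and in which the products of fields
act by diagonal matrices. -/
theorem exists_adapted_basis (Ψ : (Fin n → F) ≃ₗ[F] ∀ j, L j) :
    ∃ (Y : GL (Fin n) K) (H : GL (Fin n) F) (e : Fin n → Σ j, (L j →ₐ[F] K)) (part' : Fin n → Fin r),
      Function.Bijective e ∧
      (∀ σ : Gal(K/F), ∃ π : Equiv.Perm (Fin n), ∀ i, (∀ a, σ (Y.1 i a) = Y.1 (π i) a) ∧
        (e (π i)).1 = (e i).1) ∧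
      (∀ (A : Matrix (Fin n) (Fin n) F) (x : ∀ j, L j), (∀ v j, Ψ (A.mulVec v) j = x j * Ψ v j) →
        Y.1 * A.map (algebraMap F K) = Matrix.diagonal (fun i => (e i).2 (x (e i).1)) * Y.1) ∧
      ∀ i k, (Matrix.GeneralLinearGroup.map (algebraMap F K) H * Y⁻¹).1 i k ≠ 0 →
        (e k).1 = part' i := by
  classical
  let e : Fin n ≃ Σ j, (L j →ₐ[F] K) :=
    (Fintype.equivFinOfCardEq (card_sigma_algHom (K := K) Ψ)).symm
  let z : Fin n → (Fin n → F) →ₗ[F] K := fun i =>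
    (e i).2.toLinearMap ∘ₗ LinearMap.proj (e i).1 ∘ₗ Ψ.toLinearMap
  have hz : LinearIndependent K z := (linearIndependent_sigma_algHom Ψ).comp e e.injective
  let Y : GL (Fin n) K := Matrix.GeneralLinearGroup.mkOfDetNeZero _ (det_functionalMatrix_ne_zero hz)
  have hYz : Y.1 = functionalMatrix z := rfl
  let b : Module.Basis (Σ j, Fin (Module.finrank F (L j))) F (∀ j, L j) :=
    Pi.basis fun j => Module.finBasis F (L j)
  have hcard : Fintype.card (Σ j, Fin (Module.finrank F (L j))) = n := by
    rw [← Module.finrank_eq_card_basis b, ← Ψ.finrank_eq, Module.finrank_fin_fun]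
  let e' : Fin n ≃ Σ j, Fin (Module.finrank F (L j)) := (Fintype.equivFinOfCardEq hcard).symm
  let y : Fin n → (Fin n → F) →ₗ[F] F := fun i => b.coord (e' i) ∘ₗ Ψ.toLinearMap
  have hy : LinearIndependent F y := by
    rw [Fintype.linearIndependent_iff]
    intro c hc i
    have h1 := LinearMap.congr_fun hc (Ψ.symm (b (e' i)))
    rw [LinearMap.sum_apply, Finset.sum_eq_single i] at h1
    · simpa [y] using h1
    · intro k _ hk
      simp [y, e'.injective.eq_iff, Ne.symm hk]
    · simp
  let H : GL (Fin n) F := Matrix.GeneralLinearGroup.mkOfDetNeZero _ (det_functionalMatrix_ne_zero hy)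
  have hop : ∀ (A : Matrix (Fin n) (Fin n) F) (x : ∀ j, L j),
      (∀ v j, Ψ (A.mulVec v) j = x j * Ψ v j) →
        Y.1 * A.map (algebraMap F K) = Matrix.diagonal (fun i => (e i).2 (x (e i).1)) * Y.1 := by
    intro A x hA
    refine functionalMatrix_mul_map_of_comp fun i v => ?_
    change (e i).2 (Ψ (A.mulVec v) (e i).1) = _ * (e i).2 (Ψ v (e i).1)
    rw [hA, map_mul]
  refine ⟨Y, H, e, fun i => (e' i).1, e.bijective, fun σ => ?_, hop, fun i k hik => ?_⟩
  · let p : Equiv.Perm (Σ j, (L j →ₐ[F] K)) := Equiv.sigmaCongrRight fun j =>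
      { toFun := fun φ => (σ : K →ₐ[F] K).comp φ
        invFun := fun φ => (σ.symm : K →ₐ[F] K).comp φ
        left_inv := fun φ => by ext; simp
        right_inv := fun φ => by ext; simp }
    refine ⟨(e.trans p).trans e.symm, fun i => ?_⟩
    have h1 : e ((e.trans p).trans e.symm i) = p (e i) := by simp
    refine ⟨fun a => ?_, by rw [h1]; rfl⟩
    change σ ((e i).2 (Ψ (Pi.single a 1) (e i).1))
      = (e ((e.trans p).trans e.symm i)).2 (Ψ (Pi.single a 1) (e ((e.trans p).trans e.symm i)).1)
    rw [h1]
    rfl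
  · by_contra hne
    -- The projection to one factor is diagonal with respect to both `Y` and the rational basis `H`,
    -- so the change of basis only links indices of the same factor.
    let P : (Fin n → F) →ₗ[F] (Fin n → F) := Ψ.symm.toLinearMap ∘ₗ
      LinearMap.single F L (e k).1 ∘ₗ LinearMap.proj (e k).1 ∘ₗ Ψ.toLinearMap
    have hP : ∀ v j, Ψ ((LinearMap.toMatrix' P).mulVec v) j
        = (Pi.single (e k).1 1 : ∀ j, L j) j * Ψ v j := by
      intro v j
      rw [LinearMap.toMatrix'_mulVec]
      simp only [P, LinearMap.comp_apply, LinearEquiv.coe_coe, LinearEquiv.apply_symm_apply,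
        LinearMap.proj_apply, LinearMap.single_apply]
      rcases eq_or_ne j (e k).1 with rfl | hj
      · simp
      · simp [hj]
    have h1 := hop _ _ hP
    have h2 : H.1 * LinearMap.toMatrix' P
        = Matrix.diagonal (fun i => if (e' i).1 = (e k).1 then 1 else 0) * H.1 := by
      have h3 : (LinearMap.toMatrix' P).map (algebraMap F F) = LinearMap.toMatrix' P := by
        ext
        simp
      rw [← h3]
      refine functionalMatrix_mul_map_of_comp fun i v => ?_
      change b.repr (Ψ ((LinearMap.toMatrix' P).mulVec v)) (e' i) = _ * b.repr (Ψ v) (e' i)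
      simp only [b, Pi.basis_repr]
      rw [hP]
      by_cases h4 : (e' i).1 = (e k).1
      · have h5 : ∀ j' j, j = j' → (Pi.single j' 1 : ∀ j, L j) j = 1 := by
          rintro _ _ rfl
          exact Pi.single_eq_same _ _
        rw [if_pos h4, h5 _ _ h4, one_mul, one_mul]
      · simp [h4]
    set A := Matrix.GeneralLinearGroup.map (algebraMap F K) H * Y⁻¹ with hA
    have hAY : (Matrix.GeneralLinearGroup.map (algebraMap F K) H).1 = A.1 * Y.1 := by
      rw [← Units.val_mul, hA, inv_mul_cancel_right]
    have h5 : (H.1.map (algebraMap F K)) * (LinearMap.toMatrix' P).map (algebraMap F K)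
        = Matrix.diagonal (fun i => if (e' i).1 = (e k).1 then 1 else 0)
          * H.1.map (algebraMap F K) := by
      rw [← Matrix.map_mul, h2, Matrix.map_mul, Matrix.diagonal_map (map_zero _)]
      congr 2
      funext i
      split_ifs <;> simp
    have h6 : H.1.map (algebraMap F K) = A.1 * Y.1 := hAY
    rw [h6, mul_assoc, h1, ← mul_assoc, ← mul_assoc] at h5
    have h7 := congrFun (congrFun (Y.isUnit.mul_right_cancel h5) i) k
    rw [Matrix.mul_diagonal, Matrix.diagonal_mul, if_neg (Ne.symm hne)] at h7
    simp only [Pi.single_eq_same, map_one, mul_one, zero_mul] at h7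
    exact hik h7

end PiField

end

noncomputable section

/-! ### Bases adapted to a split torus and a commuting semisimple element -/

theorem IsIdempotentElem.isSemisimple {F V : Type*} [Field F] [AddCommGroup V] [Module F V]
    {f : Module.End F V} (hf : IsIdempotentElem f) : f.IsSemisimple := by
  refine Module.End.isSemisimple_of_squarefree_aeval_eq_zero
    (p := Polynomial.X * (Polynomial.X - Polynomial.C 1)) ?_ ?_
  · rw [squarefree_mul_iff]
    refine ⟨IsCoprime.isRelPrime ⟨1, -1, by rw [map_one]; ring⟩, Polynomial.irreducible_X.squarefree,
      (Polynomial.irreducible_X_sub_C 1).squarefree⟩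
  · rw [map_mul, map_sub, Polynomial.aeval_X, Polynomial.aeval_C, map_one, mul_sub, mul_one, hf.eq,
      sub_self]

section Adapted

variable {F K : Type*} [Field F] [Field K] [Algebra F K] {n : ℕ}

/-- The matrix `Y` diagonalizes `γ` and the elements of `S`, the latter with diagonal entries which
are constant on the parts of a partition which is stable under the Galois group, defined
over `F` and fine enough to be distinguished from each other by the eigenvalues of `γ`. -/
structure IsAdapted (γ : Matrix.SpecialLinearGroup (Fin n) F) (S : LinAlgGroup F K n)
    (Y : GL (Fin n) K) (lam : Fin n → K) {r : ℕ} (part : Fin n → Fin r) : Prop where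
  surjective : Function.Surjective part
  mul_eq : Y.1 * γ.1.map (algebraMap F K) = Matrix.diagonal lam * Y.1
  exists_perm : ∀ σ : Gal(K/F), ∃ π : Equiv.Perm (Fin n), ∀ i,
    (∀ a, σ (Y.1 i a) = Y.1 (π i) a) ∧ part (π i) = part i
  eq_of_eq : ∀ i k, part i = part k → lam i = lam k → i = k
  exists_rational : ∃ (H : GL (Fin n) F) (part' : Fin n → Fin r), ∀ i k,
    (Matrix.GeneralLinearGroup.map (algebraMap F K) H * Y⁻¹).1 i k ≠ 0 → part k = part' i
  exists_eq : ∀ s ∈ S.points, ∃ t : Fin r → K, (Y * s * Y⁻¹).1 = Matrix.diagonal (t ∘ part)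

/-- The projection to a sum of weight spaces. -/
def weightProj (g : GL (Fin n) F) {X : Type*} [DecidableEq X] (c : Fin n → X) (χ : X) :
    Matrix (Fin n) (Fin n) F :=
  g⁻¹.1 * Matrix.diagonal (fun i => if c i = χ then 1 else 0) * g.1

theorem conj_mul_conj (g : GL (Fin n) F) (A B : Matrix (Fin n) (Fin n) F) :
    (g⁻¹.1 * A * g.1) * (g⁻¹.1 * B * g.1) = g⁻¹.1 * (A * B) * g.1 := by
  have h : g.1 * g⁻¹.1 = 1 := by rw [← Units.val_mul, mul_inv_cancel, Units.val_one]
  calc _ = g⁻¹.1 * A * (g.1 * g⁻¹.1) * B * g.1 := by simp only [mul_assoc]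
    _ = _ := by rw [h]; simp only [mul_assoc, one_mul]

theorem weightProj_commute (g : GL (Fin n) F) {X : Type*} [DecidableEq X] (c : Fin n → X)
    (χ ψ : X) : weightProj g c χ * weightProj g c ψ = weightProj g c ψ * weightProj g c χ := by
  rw [weightProj, weightProj, conj_mul_conj, conj_mul_conj, Matrix.diagonal_mul_diagonal,
    Matrix.diagonal_mul_diagonal]
  simp only [mul_comm]

theorem weightProj_mul_self (g : GL (Fin n) F) {X : Type*} [DecidableEq X] (c : Fin n → X)
    (χ : X) : weightProj g c χ * weightProj g c χ = weightProj g c χ := by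
  rw [weightProj, conj_mul_conj, Matrix.diagonal_mul_diagonal]
  congr 3
  funext i
  split_ifs <;> simp

theorem weightProj_commute_of_apply (g : GL (Fin n) F) {X : Type*} [DecidableEq X] (c : Fin n → X)
    (χ : X) (A : Matrix (Fin n) (Fin n) F) (hA : ∀ i k, (g.1 * A * g⁻¹.1) i k ≠ 0 → c i = c k) :
    A * weightProj g c χ = weightProj g c χ * A := by
  have h : g⁻¹.1 * g.1 = 1 := by rw [← Units.val_mul, inv_mul_cancel, Units.val_one]
  have h1 : A = g⁻¹.1 * (g.1 * A * g⁻¹.1) * g.1 := by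
    calc A = (g⁻¹.1 * g.1) * A * (g⁻¹.1 * g.1) := by rw [h, one_mul, mul_one]
      _ = _ := by simp only [mul_assoc]
  rw [h1, weightProj, conj_mul_conj, conj_mul_conj]
  congr 2
  ext i k
  rw [Matrix.mul_diagonal, Matrix.diagonal_mul]
  by_cases h2 : (g.1 * A * g⁻¹.1) i k = 0
  · rw [h2, zero_mul, mul_zero]
  · rw [hA i k h2, mul_comm]

theorem sum_weightProj (g : GL (Fin n) F) {X : Type*} [DecidableEq X] (c : Fin n → X)
    (x : X → K) : ∑ χ ∈ Finset.univ.image c, x χ • (weightProj g c χ).map (algebraMap F K)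
      = ((Matrix.GeneralLinearGroup.map (algebraMap F K) g)⁻¹).1 * Matrix.diagonal (x ∘ c)
        * (Matrix.GeneralLinearGroup.map (algebraMap F K) g).1 := by
  have h1 : ∀ χ, (weightProj g c χ).map (algebraMap F K)
      = ((Matrix.GeneralLinearGroup.map (algebraMap F K) g)⁻¹).1
        * Matrix.diagonal (fun i => if c i = χ then 1 else 0)
        * (Matrix.GeneralLinearGroup.map (algebraMap F K) g).1 := by
    intro χ
    rw [weightProj, Matrix.map_mul, Matrix.map_mul, Matrix.diagonal_map (map_zero _), ← map_inv]
    congr 3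
    funext i
    split_ifs <;> simp
  simp only [h1]
  have h2 : Matrix.diagonal (x ∘ c) = ∑ χ ∈ Finset.univ.image c,
      x χ • Matrix.diagonal (fun i => if c i = χ then (1 : K) else 0) := by
    ext i k
    rw [Matrix.sum_apply]
    rcases eq_or_ne i k with rfl | hik
    · simp
    · simp [hik]
  rw [h2, Finset.mul_sum, Finset.sum_mul]
  refine Finset.sum_congr rfl fun χ _ => ?_
  rw [Matrix.mul_smul, Matrix.smul_mul]

/-- The weight projections of `S` are defined over `F` because `S` is split, and they commute with
`γ`. Decomposing `F ^ n` under the algebra generated by `γ` and these projections gives one part for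
each field factor. -/
theorem exists_isAdapted [PerfectField F] [IsAlgClosed K]
    (γ : Matrix.SpecialLinearGroup (Fin n) F) (hγ : Module.End.IsSemisimple (Matrix.toLin' γ.1))
    (S : LinAlgGroup F K n) (hS : S.points ≤ (slCentralizer K γ).points) (g : GL (Fin n) F)
    (hg : ∀ s ∈ S.points, (Matrix.GeneralLinearGroup.map (algebraMap F K) g * s *
      (Matrix.GeneralLinearGroup.map (algebraMap F K) g)⁻¹ : GL (Fin n) K).1.IsDiag) :
    ∃ Y lam, ∃ (r : ℕ) (part : Fin n → Fin r), IsAdapted γ S Y lam part := by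
  classical
  set gK := Matrix.GeneralLinearGroup.map (algebraMap F K) g with hgK
  -- The weight of a coordinate is recorded as a mere function on `S`; only equality of weights is
  -- used.
  let c : Fin n → S.points → K := fun i s => (gK * s.1 * gK⁻¹).1 i i
  have hc : ∀ s : S.points, (gK * s.1 * gK⁻¹).1 = Matrix.diagonal fun i => c i s := fun s =>
    (hg s.1 s.2).diagonal_diag.symm
  let gens : Set (Matrix (Fin n) (Fin n) F) := insert γ.1 (Set.range (weightProj g c))
  have hγc : ∀ i k, (g.1 * γ.1 * g⁻¹.1) i k ≠ 0 → c i = c k := by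
    intro i k hik
    funext s
    have h1 := (mem_slCentralizer.1 (hS s.2)).2
    have h2 : (gK * Matrix.SpecialLinearGroup.mapGL K γ * gK⁻¹) * (gK * s.1 * gK⁻¹)
        = (gK * s.1 * gK⁻¹) * (gK * Matrix.SpecialLinearGroup.mapGL K γ * gK⁻¹) := by
      calc _ = gK * (Matrix.SpecialLinearGroup.mapGL K γ * s.1) * gK⁻¹ := by group
        _ = gK * (s.1 * Matrix.SpecialLinearGroup.mapGL K γ) * gK⁻¹ := by rw [h1]
        _ = _ := by group
    have h3 : (gK * Matrix.SpecialLinearGroup.mapGL K γ * gK⁻¹).1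
        = (g.1 * γ.1 * g⁻¹.1).map (algebraMap F K) := by
      rw [Matrix.map_mul, Matrix.map_mul, hgK, ← map_inv]
      rfl
    have h4 := GL_entry_congr h2 i k
    rw [Units.val_mul, Units.val_mul (gK * s.1 * gK⁻¹), hc, h3, Matrix.mul_diagonal,
      Matrix.diagonal_mul, Matrix.map_apply, mul_comm] at h4
    exact (mul_right_cancel₀ ((map_ne_zero _).2 hik) h4).symm
  have hcomm : ∀ A ∈ gens, ∀ B ∈ gens, A * B = B * A := by
    rintro A (rfl | ⟨χ, rfl⟩) B (rfl | ⟨ψ, rfl⟩)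
    · rfl
    · exact weightProj_commute_of_apply g c ψ _ hγc
    · exact (weightProj_commute_of_apply g c χ _ hγc).symm
    · exact weightProj_commute g c χ ψ
  obtain ⟨r, L, _, _, Ψ, ev, hev, hΨ⟩ := exists_linearEquiv_pi_field (F := F) (V := Fin n → F)
    (s := Matrix.toLinAlgEquiv' '' gens) (by
      rintro _ ⟨A, hA, rfl⟩ _ ⟨B, hB, rfl⟩
      rw [← map_mul, ← map_mul, hcomm A hA B hB]) (by
      rintro _ ⟨A, rfl | ⟨χ, rfl⟩, rfl⟩
      · exact hγ
      · refine IsIdempotentElem.isSemisimple ?_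
        rw [IsIdempotentElem, ← map_mul, weightProj_mul_self])
  have : ∀ j, FiniteDimensional F (L j) := fun j =>
    Module.Finite.of_surjective (ev j).toLinearMap (hev j)
  let gen : ∀ A ∈ gens, Algebra.adjoin F (Matrix.toLinAlgEquiv' '' gens) := fun A hA =>
    ⟨Matrix.toLinAlgEquiv' A, Algebra.subset_adjoin ⟨A, hA, rfl⟩⟩
  have hγm : γ.1 ∈ gens := Or.inl rfl
  have hχm : ∀ χ, weightProj g c χ ∈ gens := fun χ => Or.inr ⟨χ, rfl⟩
  obtain ⟨Y, H, e, part', he, hgal, hop, hH⟩ := exists_adapted_basis (K := K) Ψ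
  have hgen : ∀ A (hA : A ∈ gens), Y.1 * A.map (algebraMap F K)
      = Matrix.diagonal (fun i => (e i).2 (ev (e i).1 (gen A hA))) * Y.1 := fun A hA =>
    hop A (fun j => ev j (gen A hA)) fun v j => hΨ (gen A hA) v j
  -- An idempotent of a field is `0` or `1`, so elements of `S` are scalar on each part. It also
  -- follows that an embedding of a factor is determined by the image of `γ`.
  have h01 : ∀ j χ, ev j (gen _ (hχm χ)) = 0 ∨ ev j (gen _ (hχm χ)) = 1 := by
    intro j χ
    refine IsIdempotentElem.iff_eq_zero_or_one.1 ?_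
    rw [IsIdempotentElem, ← map_mul]
    congr 1
    refine Subtype.ext ?_
    change Matrix.toLinAlgEquiv' _ * Matrix.toLinAlgEquiv' _ = Matrix.toLinAlgEquiv' _
    rw [← map_mul, weightProj_mul_self]
  let u : (S.points → K) → Fin r → K := fun χ j => if ev j (gen _ (hχm χ)) = 1 then 1 else 0
  have hu : ∀ χ (x : Σ j, (L j →ₐ[F] K)), x.2 (ev x.1 (gen _ (hχm χ))) = u χ x.1 := by
    rintro χ ⟨j, φ⟩
    dsimp only [u]
    rcases h01 j χ with h | h
    · rw [h, map_zero, if_neg zero_ne_one]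
    · rw [h, map_one, if_pos rfl]
  have hinj : ∀ x y : Σ j, (L j →ₐ[F] K), x.1 = y.1 →
      x.2 (ev x.1 (gen _ hγm)) = y.2 (ev y.1 (gen _ hγm)) → x = y := by
    rintro ⟨j, φ⟩ ⟨_, ψ⟩ rfl h
    have h1 : φ.comp (ev j) = ψ.comp (ev j) := by
      refine AlgHom.adjoin_ext ?_
      rintro _ ⟨A, rfl | ⟨χ, rfl⟩, rfl⟩
      · exact h
      · exact (hu χ ⟨j, φ⟩).trans (hu χ ⟨j, ψ⟩).symm
    have h2 : φ = ψ := by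
      refine AlgHom.ext fun y => ?_
      obtain ⟨b, rfl⟩ := hev j y
      exact DFunLike.congr_fun h1 b
    rw [h2]
  refine ⟨Y, fun i => (e i).2 (ev (e i).1 (gen _ hγm)), r, fun i => (e i).1,
    { surjective := fun j => ?_
      mul_eq := hgen _ hγm
      exists_perm := hgal
      eq_of_eq := fun i k h1 h2 => he.1 (hinj _ _ h1 h2)
      exists_rational := ⟨H, part', hH⟩
      exists_eq := fun s hs => ?_ }⟩
  · obtain ⟨i, hi⟩ := he.2 ⟨j, IsAlgClosed.lift⟩
    exact ⟨i, congrArg Sigma.fst hi⟩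
  · refine ⟨fun j => ∑ χ ∈ Finset.univ.image c, χ ⟨s, hs⟩ * u χ j,
      conj_eq_diagonal_of_mul_eq ?_⟩
    have h1 : s = gK⁻¹ * (gK * s * gK⁻¹) * gK := by group
    have h2 : s.1 = ∑ χ ∈ Finset.univ.image c, χ ⟨s, hs⟩ •
        (weightProj g c χ).map (algebraMap F K) := by
      rw [sum_weightProj g c fun χ => χ ⟨s, hs⟩]
      refine (congrArg Units.val h1).trans ?_
      rw [Units.val_mul, Units.val_mul, hc ⟨s, hs⟩]
      rfl
    rw [h2, Finset.mul_sum]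
    have h3 : Matrix.diagonal ((fun j => ∑ χ ∈ Finset.univ.image c, χ ⟨s, hs⟩ * u χ j) ∘
        fun i => (e i).1) = ∑ χ ∈ Finset.univ.image c, χ ⟨s, hs⟩ • Matrix.diagonal
          (fun i => (e i).2 (ev (e i).1 (gen _ (hχm χ)))) := by
      ext i k
      rw [Matrix.sum_apply]
      rcases eq_or_ne i k with rfl | hik
      · simp [hu]
      · simp [hik]
    rw [h3, Finset.sum_mul]
    refine Finset.sum_congr rfl fun χ _ => ?_
    rw [Matrix.mul_smul, Matrix.smul_mul, hgen _ (hχm χ)]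

end Adapted
end

noncomputable section

/-! ### Tori of block scalar matrices -/

/-- For block sizes `m j` the determinant of a block scalar matrix is the `g`-th power of `∏ t j ^ c
j`. Dividing by the gcd `g` yields a connected group, and the Bézout coefficients `u` parametrize
it. -/
theorem exists_mul_and_sum_mul_eq_one {r : ℕ} [Nonempty (Fin r)] (m : Fin r → ℕ)
    (hm : ∀ j, 0 < m j) : ∃ (g : ℕ) (c : Fin r → ℕ) (u : Fin r → ℤ), 0 < g ∧ (∀ j, m j = c j * g) ∧
      ∑ j, u j * (c j : ℤ) = 1 := by
  obtain ⟨g, hg⟩ := IsPrincipalIdealRing.principal (Ideal.span (Set.range fun j => (m j : ℤ)))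
  have hdvd : ∀ j, g.natAbs ∣ m j := by
    intro j
    have h1 : (m j : ℤ) ∈ Ideal.span (Set.range fun j => (m j : ℤ)) := Ideal.subset_span ⟨j, rfl⟩
    rw [hg] at h1
    exact Int.natAbs_dvd_natAbs.2 (Ideal.mem_span_singleton.1 h1)
  obtain ⟨j₀⟩ := ‹Nonempty (Fin r)›
  have hpos : 0 < g.natAbs := Nat.pos_of_dvd_of_pos (hdvd j₀) (hm j₀)
  choose c hc using hdvd
  have h1 : g ∈ Ideal.span (Set.range fun j => (m j : ℤ)) := by
    rw [hg]
    exact Ideal.mem_span_singleton_self g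
  obtain ⟨u, hu⟩ := (Ideal.mem_span_range_iff_exists_fun).1 h1
  refine ⟨g.natAbs, c, fun j => g.sign * u j, hpos, fun j => (hc j).trans (mul_comm _ _), ?_⟩
  have h2 : (g.natAbs : ℤ) * ∑ j, g.sign * u j * (c j : ℤ) = g.natAbs := by
    rw [Finset.mul_sum]
    calc _ = g.sign * ∑ j, u j * (m j : ℤ) := by
          rw [Finset.mul_sum]
          refine Finset.sum_congr rfl fun j _ => ?_
          rw [hc j]
          push_cast
          ring
      _ = _ := by rw [hu, Int.sign_mul_self_eq_natAbs]
  have h3 : (g.natAbs : ℤ) ≠ 0 := by exact_mod_cast hpos.ne'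
  exact mul_left_cancel₀ h3 (h2.trans (mul_one _).symm)

section Laurent

variable (K : Type*) [Field K] (r : ℕ)

/-- The functions on the units which are given by Laurent polynomials. -/
def laurentSubalgebra : Subalgebra K ((Fin r → Kˣ) → K) where
  carrier := {f | ∃ (p : MvPolynomial (Fin r) K) (N : ℕ), ∀ t,
    f t * (∏ j, (t j : K)) ^ N = MvPolynomial.eval (fun j => (t j : K)) p}
  mul_mem' := by
    rintro f g ⟨p, N, hp⟩ ⟨q, M, hq⟩
    refine ⟨p * q, N + M, fun t => ?_⟩
    rw [map_mul, ← hp, ← hq, Pi.mul_apply]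
    ring
  add_mem' := by
    rintro f g ⟨p, N, hp⟩ ⟨q, M, hq⟩
    refine ⟨p * (∏ j, MvPolynomial.X j) ^ M + q * (∏ j, MvPolynomial.X j) ^ N, N + M, fun t => ?_⟩
    simp only [map_mul, map_add, map_pow, map_prod, MvPolynomial.eval_X, ← hp, ← hq, Pi.add_apply]
    ring
  algebraMap_mem' a := ⟨MvPolynomial.C a, 0, fun t => by simp⟩

variable {K r}

theorem coord_mem_laurentSubalgebra (j : Fin r) :
    (fun t : Fin r → Kˣ => (t j : K)) ∈ laurentSubalgebra K r :=
  ⟨MvPolynomial.X j, 0, fun t => by simp⟩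

theorem coord_inv_mem_laurentSubalgebra (j : Fin r) :
    (fun t : Fin r → Kˣ => (((t j)⁻¹ : Kˣ) : K)) ∈ laurentSubalgebra K r := by
  refine ⟨∏ i ∈ Finset.univ.erase j, MvPolynomial.X i, 1, fun t => ?_⟩
  rw [pow_one, ← Finset.mul_prod_erase _ _ (Finset.mem_univ j), ← mul_assoc, Units.inv_mul, one_mul]
  simp

theorem zpow_mem_laurentSubalgebra {z : (Fin r → Kˣ) → Kˣ}
    (hz : (fun t => (z t : K)) ∈ laurentSubalgebra K r)
    (hz' : (fun t => (((z t)⁻¹ : Kˣ) : K)) ∈ laurentSubalgebra K r) (k : ℤ) :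
    (fun t => ((z t ^ k : Kˣ) : K)) ∈ laurentSubalgebra K r := by
  cases k with
  | ofNat k =>
    convert pow_mem hz k using 1
    funext t
    simp
  | negSucc k =>
    convert pow_mem hz' (k + 1) using 1
    funext t
    simp [zpow_negSucc]

theorem prod_zpow_mem_laurentSubalgebra (k : Fin r → ℤ) :
    (fun t : Fin r → Kˣ => ((∏ j, t j ^ k j : Kˣ) : K)) ∈ laurentSubalgebra K r := by
  have h := prod_mem (S := laurentSubalgebra K r) (t := Finset.univ)
    (f := fun j (t : Fin r → Kˣ) => ((t j ^ k j : Kˣ) : K)) fun j _ =>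
      zpow_mem_laurentSubalgebra (coord_mem_laurentSubalgebra j)
        (coord_inv_mem_laurentSubalgebra j) (k j)
  convert h using 1
  funext t
  rw [Finset.prod_apply, Units.coe_prod]

theorem eq_zero_or_eq_zero_of_mem_laurentSubalgebra [Infinite K] {f g : (Fin r → Kˣ) → K}
    (hf : f ∈ laurentSubalgebra K r) (hg : g ∈ laurentSubalgebra K r) (hfg : ∀ t, f t * g t = 0) :
    (∀ t, f t = 0) ∨ ∀ t, g t = 0 := by
  obtain ⟨p, N, hp⟩ := hf
  obtain ⟨q, M, hq⟩ := hg
  have hne : ∀ t : Fin r → Kˣ, ∏ j, (t j : K) ≠ 0 := fun t =>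
    Finset.prod_ne_zero_iff.2 fun j _ => (t j).ne_zero
  -- The extra factor makes the product vanish also at points with a zero coordinate, so that it is
  -- zero as a polynomial.
  have h1 : p * q * ∏ j, MvPolynomial.X j = 0 := by
    refine MvPolynomial.funext fun x => ?_
    rw [map_mul, map_mul, map_zero, map_prod]
    by_cases hx : ∀ j, x j ≠ 0
    · have h2 := hp fun j => Units.mk0 (x j) (hx j)
      have h3 := hq fun j => Units.mk0 (x j) (hx j)
      simp only [Units.val_mk0] at h2 h3
      rw [← h2, ← h3, mul_mul_mul_comm, hfg, zero_mul, zero_mul]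
    · push Not at hx
      obtain ⟨j, hj⟩ := hx
      rw [Finset.prod_eq_zero (Finset.mem_univ j) (by rw [MvPolynomial.eval_X, hj]), mul_zero]
  have h2 : (∏ j : Fin r, MvPolynomial.X j : MvPolynomial (Fin r) K) ≠ 0 :=
    Finset.prod_ne_zero_iff.2 fun j _ => MvPolynomial.X_ne_zero j
  rcases mul_eq_zero.1 ((mul_eq_zero.1 h1).resolve_right h2) with rfl | rfl
  · left
    intro t
    have h3 := hp t
    rw [map_zero] at h3
    exact (mul_eq_zero.1 h3).resolve_right (pow_ne_zero _ (hne t))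
  · right
    intro t
    have h3 := hq t
    rw [map_zero] at h3
    exact (mul_eq_zero.1 h3).resolve_right (pow_ne_zero _ (hne t))

/-- The image of a torus under a map which is given by Laurent polynomials is connected. -/
theorem isZariskiConnected_range [Infinite K] {n : ℕ} (ρ : (Fin r → Kˣ) → GL (Fin n) K)
    (hρ : ∀ i k, (fun t => (ρ t).1 i k) ∈ laurentSubalgebra K r) :
    IsZariskiConnected (Set.range ρ) := by
  refine ⟨⟨ρ 1, 1, rfl⟩, ?_⟩
  rintro Z₁ Z₂ ⟨I₁, h₁⟩ ⟨I₂, h₂⟩ hZ -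
  by_contra! h
  obtain ⟨⟨_, ⟨t₁, rfl⟩, ht₁⟩, ⟨_, ⟨t₂, rfl⟩, ht₂⟩⟩ :=
    And.intro (Set.not_subset.1 h.1) (Set.not_subset.1 h.2)
  rw [h₁] at ht₁
  rw [h₂] at ht₂
  push Not at ht₁ ht₂
  obtain ⟨p, hp, hpt⟩ := ht₁
  obtain ⟨q, hq, hqt⟩ := ht₂
  have hmem := eval_mem_subalgebra (laurentSubalgebra K r)
    (fun ij : Fin n × Fin n => fun t => (ρ t).1 ij.1 ij.2) fun ij => hρ ij.1 ij.2
  rcases eq_zero_or_eq_zero_of_mem_laurentSubalgebra (hmem p) (hmem q) fun t => by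
    rcases hZ ⟨t, rfl⟩ with hz | hz
    · exact mul_eq_zero_of_left ((h₁ _).1 hz p hp) _
    · exact mul_eq_zero_of_right _ ((h₂ _).1 hz q hq) with h0 | h0
  · exact hpt (h0 t₁)
  · exact hqt (h0 t₂)

end Laurent

section BlockTorus

variable {F K : Type*} [Field F] [Field K] [Algebra F K] {n r : ℕ}

/-- The entry of `Y * s * Y⁻¹` as a polynomial in the entries of `s`. -/
def conjPoly (Y : GL (Fin n) K) (i k : Fin n) : MvPolynomial (Fin n × Fin n) K :=
  ∑ l, (∑ m, MvPolynomial.C (Y.1 i m) * MvPolynomial.X (m, l)) * MvPolynomial.C (Y⁻¹.1 l k)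

theorem eval_conjPoly (Y s : GL (Fin n) K) (i k : Fin n) :
    MvPolynomial.eval (fun ij => s.1 ij.1 ij.2) (conjPoly Y i k) = (Y * s * Y⁻¹).1 i k := by
  rw [Units.val_mul, Units.val_mul]
  simp [conjPoly, Matrix.mul_apply]

theorem diagGL_mul (a b : Fin n → Kˣ) : diagGL a * diagGL b = diagGL (a * b) := by
  refine Units.ext ?_
  change Matrix.diagonal _ * Matrix.diagonal _ = Matrix.diagonal _
  rw [Matrix.diagonal_mul_diagonal]
  rfl

theorem diagGL_one : diagGL (1 : Fin n → Kˣ) = 1 :=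
  Units.ext Matrix.diagonal_one

/-- The group of the elements `s` for which `Y * s * Y⁻¹` is a diagonal matrix with entries `t j`
in the places of the `j`-th part, where the product of the `t j ^ c j` is `1`. -/
def blockTorus (Y : GL (Fin n) K) (part : Fin n → Fin r) (c : Fin r → ℕ) :
    Subgroup (GL (Fin n) K) where
  carrier := {s | ∃ t : Fin r → Kˣ, Y * s * Y⁻¹ = diagGL (t ∘ part) ∧ ∏ j, t j ^ c j = 1}
  one_mem' := ⟨1, by rw [mul_one, mul_inv_cancel]; exact diagGL_one.symm, by simp⟩
  mul_mem' := by
    rintro s s' ⟨t, h, h1⟩ ⟨t', h', h1'⟩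
    refine ⟨t * t', ?_, ?_⟩
    · rw [show Y * (s * s') * Y⁻¹ = (Y * s * Y⁻¹) * (Y * s' * Y⁻¹) by group, h, h', diagGL_mul]
      rfl
    · simp only [Pi.mul_apply, mul_pow, Finset.prod_mul_distrib, h1, h1', mul_one]
  inv_mem' := by
    rintro s ⟨t, h, h1⟩
    refine ⟨t⁻¹, ?_, by simp [h1]⟩
    rw [show Y * s⁻¹ * Y⁻¹ = (Y * s * Y⁻¹)⁻¹ by group, h, inv_eq_iff_mul_eq_one, diagGL_mul,
      ← diagGL_one]
    congr 1
    funext i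
    simp

theorem mem_blockTorus {Y : GL (Fin n) K} {part : Fin n → Fin r} {c : Fin r → ℕ} {s : GL (Fin n) K} :
    s ∈ blockTorus Y part c ↔
      ∃ t : Fin r → Kˣ, Y * s * Y⁻¹ = diagGL (t ∘ part) ∧ ∏ j, t j ^ c j = 1 :=
  Iff.rfl

/-- The product of powers of the entries of `Y * s * Y⁻¹` as a polynomial in the entries of `s`. -/
def blockPoly (Y : GL (Fin n) K) (part : Fin n → Fin r) (hpart : Function.Surjective part)
    (c : Fin r → ℕ) : MvPolynomial (Fin n × Fin n) K :=
  ∏ j, conjPoly Y (Function.surjInv hpart j) (Function.surjInv hpart j) ^ c j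

theorem eval_blockPoly {Y : GL (Fin n) K} {part : Fin n → Fin r} (hpart : Function.Surjective part)
    (c : Fin r → ℕ) {s : GL (Fin n) K} {t : Fin r → K}
    (hs : (Y * s * Y⁻¹).1 = Matrix.diagonal (t ∘ part)) :
    MvPolynomial.eval (fun ij => s.1 ij.1 ij.2) (blockPoly Y part hpart c) = ∏ j, t j ^ c j := by
  rw [blockPoly, map_prod]
  refine Finset.prod_congr rfl fun j _ => ?_
  rw [map_pow, eval_conjPoly, hs, Matrix.diagonal_apply_eq, Function.comp_apply,
    Function.surjInv_eq hpart j]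

theorem exists_units_of_conj_eq {Y s : GL (Fin n) K} {part : Fin n → Fin r}
    (hpart : Function.Surjective part) {t : Fin r → K}
    (hs : (Y * s * Y⁻¹).1 = Matrix.diagonal (t ∘ part)) :
    ∃ t' : Fin r → Kˣ, (∀ j, (t' j : K) = t j) ∧ Y * s * Y⁻¹ = diagGL (t' ∘ part) := by
  have h1 : (Y * s * Y⁻¹).1.det ≠ 0 :=
    ((Matrix.isUnit_iff_isUnit_det _).1 (Y * s * Y⁻¹).isUnit).ne_zero
  rw [hs, Matrix.det_diagonal, Finset.prod_ne_zero_iff] at h1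
  have h2 : ∀ j, t j ≠ 0 := by
    intro j
    obtain ⟨i, rfl⟩ := hpart j
    exact h1 i (Finset.mem_univ i)
  exact ⟨fun j => Units.mk0 (t j) (h2 j), fun j => rfl, Units.ext hs⟩

theorem isZariskiClosed_blockTorus (Y : GL (Fin n) K) {part : Fin n → Fin r}
    (hpart : Function.Surjective part) (c : Fin r → ℕ) :
    IsZariskiClosed (blockTorus Y part c : Set (GL (Fin n) K)) := by
  refine ⟨{p | (∃ i k, i ≠ k ∧ p = conjPoly Y i k) ∨
    (∃ i k, part i = part k ∧ p = conjPoly Y i i - conjPoly Y k k) ∨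
    p = blockPoly Y part hpart c - 1}, fun s => ?_⟩
  rw [SetLike.mem_coe, mem_blockTorus]
  constructor
  · rintro ⟨t, hs, ht⟩ p (⟨i, k, hik, rfl⟩ | ⟨i, k, hik, rfl⟩ | rfl)
    · rw [eval_conjPoly, hs]
      exact Matrix.diagonal_apply_ne _ hik
    · rw [map_sub, eval_conjPoly, eval_conjPoly, hs, sub_eq_zero]
      change Matrix.diagonal _ _ _ = Matrix.diagonal _ _ _
      rw [Matrix.diagonal_apply_eq, Matrix.diagonal_apply_eq, Function.comp_apply,
        Function.comp_apply, hik]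
    · rw [map_sub, eval_blockPoly hpart c (t := fun j => (t j : K)) (congrArg Units.val hs), map_one,
        sub_eq_zero]
      simpa using congrArg Units.val ht
  · intro h
    have h1 : (Y * s * Y⁻¹).1 = Matrix.diagonal
        ((fun j => (Y * s * Y⁻¹).1 (Function.surjInv hpart j) (Function.surjInv hpart j)) ∘ part) := by
      ext i k
      rcases eq_or_ne i k with rfl | hik
      · rw [Matrix.diagonal_apply_eq, Function.comp_apply, ← eval_conjPoly, ← eval_conjPoly,
          ← sub_eq_zero, ← map_sub]
        exact h _ (Or.inr (Or.inl ⟨_, _, (Function.surjInv_eq hpart _).symm, rfl⟩))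
      · rw [Matrix.diagonal_apply_ne _ hik, ← eval_conjPoly]
        exact h _ (Or.inl ⟨i, k, hik, rfl⟩)
    obtain ⟨t, ht, hs⟩ := exists_units_of_conj_eq hpart h1
    refine ⟨t, hs, Units.ext ?_⟩
    have h2 := h _ (Or.inr (Or.inr rfl))
    rw [map_sub, eval_blockPoly hpart c h1, map_one, sub_eq_zero] at h2
    rw [Units.coe_prod, Units.val_one, ← h2]
    exact Finset.prod_congr rfl fun j _ => by rw [Units.val_pow_eq_pow_val, ht]

theorem isZariskiConnected_blockTorus [Infinite K] (Y : GL (Fin n) K) (part : Fin n → Fin r)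
    {c : Fin r → ℕ} {u : Fin r → ℤ} (hu : ∑ j, u j * (c j : ℤ) = 1) :
    IsZariskiConnected (blockTorus Y part c : Set (GL (Fin n) K)) := by
  -- By `∑ u j * c j = 1` this is a retraction of the full torus onto the subgroup, which is
  -- therefore a Laurent image of a torus and connected.
  let ret : (Fin r → Kˣ) → Fin r → Kˣ := fun t j => t j * (∏ i, t i ^ c i) ^ (-u j)
  have hret : ∀ t, ∏ j, ret t j ^ c j = 1 := by
    intro t
    have h1 : ∀ j, ret t j ^ c j = t j ^ c j * (∏ i, t i ^ c i) ^ (-(u j * c j)) := by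
      intro j
      rw [mul_pow, ← zpow_natCast ((∏ i, t i ^ c i) ^ (-u j)), ← zpow_mul, neg_mul]
    simp only [h1]
    have h2 : ∀ (a : Kˣ) (f : Fin r → ℤ), ∏ j, a ^ f j = a ^ ∑ j, f j := fun a f =>
      (map_prod (zpowersHom Kˣ a) (fun j => Multiplicative.ofAdd (f j)) Finset.univ).symm
    rw [Finset.prod_mul_distrib, h2, Finset.sum_neg_distrib, hu, zpow_neg_one, mul_inv_cancel]
  have hfix : ∀ t : Fin r → Kˣ, ∏ j, t j ^ c j = 1 → ret t = t := by
    intro t ht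
    funext j
    simp [ret, ht]
  have hrange : (blockTorus Y part c : Set (GL (Fin n) K))
      = Set.range fun t => Y⁻¹ * diagGL (ret t ∘ part) * Y := by
    ext s
    rw [SetLike.mem_coe, mem_blockTorus]
    constructor
    · rintro ⟨t, hs, ht⟩
      refine ⟨t, ?_⟩
      dsimp only
      rw [hfix t ht, ← hs]
      group
    · rintro ⟨t, rfl⟩
      exact ⟨ret t, by group, hret t⟩
  rw [hrange]
  refine isZariskiConnected_range _ fun i k => ?_
  have h1 : ∀ j, (fun t => (ret t j : K)) ∈ laurentSubalgebra K r := by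
    intro j
    convert prod_zpow_mem_laurentSubalgebra (K := K)
      (fun i => (Pi.single j 1 : Fin r → ℤ) i + c i * -u j) using 1
    funext t
    congr 1
    simp only [zpow_add, Finset.prod_mul_distrib, zpow_mul, zpow_natCast, Finset.prod_zpow, ret]
    congr 1
    rw [Finset.prod_eq_single j (fun i _ hi => by simp [hi]) (by simp)]
    simp
  have h2 : (fun t => (Y⁻¹ * diagGL (ret t ∘ part) * Y).1 i k)
      = ∑ l, (Y⁻¹.1 i l * Y.1 l k) • fun t => (ret t (part l) : K) := by
    funext t
    rw [Units.val_mul, Units.val_mul, Matrix.mul_apply, Finset.sum_apply]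
    refine Finset.sum_congr rfl fun l _ => ?_
    rw [show (diagGL (ret t ∘ part)).1 = Matrix.diagonal fun i => (ret t (part i) : K) from rfl,
      Matrix.mul_diagonal, Pi.smul_apply, smul_eq_mul]
    ring
  rw [h2]
  exact Subalgebra.sum_mem _ fun l _ => Subalgebra.smul_mem _ (h1 _) _

end BlockTorus
end

noncomputable section

/-! ### The centralizer of a maximal split torus -/

section MaximalTorus

variable {F K : Type*} [Field F] [Field K] [Algebra F K] {n r : ℕ}

namespace IsAdapted

variable {γ : Matrix.SpecialLinearGroup (Fin n) F} {S : LinAlgGroup F K n}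
  {Y : GL (Fin n) K} {lam : Fin n → K} {part : Fin n → Fin r} (h : IsAdapted γ S Y lam part)
include h

theorem galGL_mem_blockTorus (c : Fin r → ℕ) (σ : Gal(K/F)) {s : GL (Fin n) K}
    (hs : s ∈ blockTorus Y part c) : galGL σ s ∈ blockTorus Y part c := by
  obtain ⟨t, hs, ht⟩ := hs
  obtain ⟨π, hπ⟩ := h.exists_perm σ
  refine ⟨fun j => Units.map (σ : K →* K) (t j), Units.ext ?_, ?_⟩
  · refine conj_eq_diagonal_of_mul_eq ?_
    have h1 : Y.1 * s.1 = Matrix.diagonal (fun i => (t (part i) : K)) * Y.1 :=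
      mul_eq_of_conj_eq_diagonal (congrArg Units.val hs)
    ext i a
    obtain ⟨i, rfl⟩ := π.surjective i
    have h2 := congrArg σ (congrFun (congrFun h1 i) a)
    rw [Matrix.diagonal_mul, Matrix.mul_apply, map_sum, map_mul, (hπ i).1] at h2
    rw [Matrix.diagonal_mul, Matrix.mul_apply, Function.comp_apply, (hπ i).2]
    refine Eq.trans (Finset.sum_congr rfl fun b _ => ?_) h2
    rw [map_mul, (hπ i).1]
    rfl
  · have h1 := congrArg (Units.map (σ : K →* K)) ht
    simpa only [map_prod, map_pow, map_one] using h1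

/-- The torus of block scalar matrices as an algebraic group over `F`. -/
def blockGroup (h : IsAdapted γ S Y lam part) (c : Fin r → ℕ) : LinAlgGroup F K n where
  points := blockTorus Y part c
  isClosed := isZariskiClosed_blockTorus Y h.surjective c
  gal_mem σ _ hs := h.galGL_mem_blockTorus c σ hs

/-- The rational basis `H` respects the partition, so block scalar matrices are diagonal in it as
well. -/
theorem isSplitTorus_blockGroup [Infinite K] {c : Fin r → ℕ} {u : Fin r → ℤ}
    (hu : ∑ j, u j * (c j : ℤ) = 1) : (h.blockGroup c).IsSplitTorus := by
  refine ⟨isZariskiConnected_blockTorus Y part hu, ?_⟩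
  obtain ⟨H, part', hH⟩ := h.exists_rational
  refine ⟨H, ?_⟩
  rintro s ⟨t, hs, -⟩
  set A := Matrix.GeneralLinearGroup.map (algebraMap F K) H * Y⁻¹ with hA
  have h1 : Matrix.GeneralLinearGroup.map (algebraMap F K) H = A * Y := by
    rw [hA, inv_mul_cancel_right]
  have h2 : A * Y * s * (A * Y)⁻¹ = A * (Y * s * Y⁻¹) * A⁻¹ := by group
  rw [h1, h2, hs, conj_eq_diagonal_of_mul_eq (d := fun i => (t (part' i) : K))]
  · exact Matrix.isDiag_diagonal _
  · ext i k
    change (A.1 * Matrix.diagonal fun i => (t (part i) : K)) i k = _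
    rw [Matrix.mul_diagonal, Matrix.diagonal_mul]
    by_cases h3 : A.1 i k = 0
    · rw [h3, zero_mul, mul_zero]
    · rw [hH i k h3, mul_comm]

theorem commute_of_conj_eq {s : GL (Fin n) K} {d : Fin n → K}
    (hs : (Y * s * Y⁻¹).1 = Matrix.diagonal d) :
    Matrix.SpecialLinearGroup.mapGL K γ * s = s * Matrix.SpecialLinearGroup.mapGL K γ := by
  have h1 : (Y * Matrix.SpecialLinearGroup.mapGL K γ * Y⁻¹).1 = _ :=
    conj_eq_diagonal_of_mul_eq h.mul_eq
  have h2 : (Y * Matrix.SpecialLinearGroup.mapGL K γ * Y⁻¹) * (Y * s * Y⁻¹)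
      = (Y * s * Y⁻¹) * (Y * Matrix.SpecialLinearGroup.mapGL K γ * Y⁻¹) := by
    refine Units.ext ?_
    rw [Units.val_mul, Units.val_mul (Y * s * Y⁻¹), h1, hs, Matrix.diagonal_mul_diagonal,
      Matrix.diagonal_mul_diagonal]
    simp only [mul_comm]
  calc _ = Y⁻¹ * ((Y * Matrix.SpecialLinearGroup.mapGL K γ * Y⁻¹) * (Y * s * Y⁻¹)) * Y := by group
    _ = Y⁻¹ * ((Y * s * Y⁻¹) * (Y * Matrix.SpecialLinearGroup.mapGL K γ * Y⁻¹)) * Y := by rw [h2]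
    _ = _ := by group

theorem prod_pow_eq_det {g : ℕ} {c : Fin r → ℕ}
    (hc : ∀ j, Finset.card {i | part i = j} = c j * g) {s : GL (Fin n) K} {t : Fin r → K}
    (hs : (Y * s * Y⁻¹).1 = Matrix.diagonal (t ∘ part)) : (∏ j, t j ^ c j) ^ g = s.1.det := by
  rw [← det_conj Y, hs, Matrix.det_diagonal, ← Finset.prod_pow]
  refine Eq.trans ?_ (Finset.prod_fiberwise' Finset.univ part t)
  refine Finset.prod_congr rfl fun j _ => ?_
  rw [Finset.prod_const, hc, pow_mul]

theorem blockGroup_le {g : ℕ} {c : Fin r → ℕ}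
    (hc : ∀ j, Finset.card {i | part i = j} = c j * g) :
    (h.blockGroup c).points ≤ (slCentralizer K γ).points := by
  rintro s ⟨t, hs, ht⟩
  have hs' := congrArg Units.val hs
  refine mem_slCentralizer.2 ⟨?_, h.commute_of_conj_eq hs'⟩
  rw [← h.prod_pow_eq_det hc (t := fun j => (t j : K)) hs']
  have h1 : ∏ j, (t j : K) ^ c j = 1 := by simpa using congrArg Units.val ht
  rw [h1, one_pow]

/-- On `S` the function `∏ t j ^ c j` has `g`-th power equal to the determinant `1`. It takes
finitely many values, so it is constant by connectedness, with value `1` at the identity. -/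
theorem le_blockGroup (hS : S.points ≤ (slCentralizer K γ).points)
    (hconn : IsZariskiConnected (S.points : Set (GL (Fin n) K))) {g : ℕ} (hg : 0 < g)
    {c : Fin r → ℕ} (hc : ∀ j, Finset.card {i | part i = j} = c j * g) :
    S.points ≤ (h.blockGroup c).points := by
  classical
  let p := blockPoly Y part h.surjective c
  let Z₁ : Set (GL (Fin n) K) := {s | MvPolynomial.eval (fun ij => s.1 ij.1 ij.2) p = 1}
  let Z₂ : Set (GL (Fin n) K) := {s | ∏ ξ ∈ (Polynomial.nthRootsFinset g (1 : K)).erase 1,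
    (MvPolynomial.eval (fun ij => s.1 ij.1 ij.2) p - ξ) = 0}
  have hZ₁ : IsZariskiClosed Z₁ := ⟨{p - 1}, fun s => by simp [Z₁, sub_eq_zero]⟩
  have hZ₂ : IsZariskiClosed Z₂ :=
    ⟨{∏ ξ ∈ (Polynomial.nthRootsFinset g (1 : K)).erase 1, (p - MvPolynomial.C ξ)},
      fun s => by
        simp only [Z₂, Set.mem_ofPred_eq, Set.mem_singleton_iff, forall_eq, map_prod, map_sub,
          MvPolynomial.eval_C]⟩
  have h12 : ∀ s ∈ Z₁, s ∉ Z₂ := by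
    intro s hs₁ hs₂
    obtain ⟨ξ, hξ, h0⟩ := Finset.prod_eq_zero_iff.1 (show _ = (0 : K) from hs₂)
    rw [show MvPolynomial.eval (fun ij => s.1 ij.1 ij.2) p = 1 from hs₁] at h0
    exact (Finset.mem_erase.1 hξ).1 (sub_eq_zero.1 h0).symm
  have hcover : (S.points : Set (GL (Fin n) K)) ⊆ Z₁ ∪ Z₂ := by
    intro s hs
    obtain ⟨t, ht⟩ := h.exists_eq s hs
    have h1 := h.prod_pow_eq_det hc ht
    rw [(mem_slCentralizer.1 (hS hs)).1, ← eval_blockPoly h.surjective c ht] at h1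
    by_cases h2 : MvPolynomial.eval (fun ij => s.1 ij.1 ij.2) p = 1
    · exact Or.inl h2
    · refine Or.inr (Finset.prod_eq_zero (Finset.mem_erase.2 ⟨h2, ?_⟩) (sub_self _))
      exact (Polynomial.mem_nthRootsFinset hg _).2 h1
  have hone : (1 : GL (Fin n) K) ∈ Z₁ := by
    have h1 : (Y * 1 * Y⁻¹).1 = Matrix.diagonal ((1 : Fin r → K) ∘ part) := by
      rw [mul_one, mul_inv_cancel]
      exact Matrix.diagonal_one.symm
    change MvPolynomial.eval _ p = 1
    rw [eval_blockPoly h.surjective c h1]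
    simp
  have hsub : (S.points : Set (GL (Fin n) K)) ⊆ Z₁ := by
    refine (hconn.2 Z₁ Z₂ hZ₁ hZ₂ hcover ?_).resolve_right fun h2 => h12 1 hone (h2 (one_mem _))
    exact Set.eq_empty_of_forall_notMem fun s hs => h12 s hs.2.1 hs.2.2
  intro s hs
  obtain ⟨t, ht⟩ := h.exists_eq s hs
  obtain ⟨t', htt, ht'⟩ := exists_units_of_conj_eq h.surjective ht
  refine ⟨t', ht', Units.ext ?_⟩
  have h1 : MvPolynomial.eval (fun ij => s.1 ij.1 ij.2) p = 1 := hsub hs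
  rw [eval_blockPoly h.surjective c ht] at h1
  rw [Units.coe_prod, Units.val_one, ← h1]
  exact Finset.prod_congr rfl fun j _ => by rw [Units.val_pow_eq_pow_val, htt]

theorem exists_blockTorus_ne [Infinite K] {c : Fin r → ℕ} (hc : ∀ j, 0 < c j) {a b : Fin r}
    (hab : a ≠ b) : ∃ t : Fin r → Kˣ, ∏ j, t j ^ c j = 1 ∧ t a ≠ t b := by
  have h0 : (c a : ℤ) + c b ≠ 0 := by
    have := hc a
    omega
  obtain ⟨z, hz⟩ := exists_units_zpow_ne_one K h0
  refine ⟨Pi.mulSingle a (z ^ c b) * Pi.mulSingle b (z ^ c a)⁻¹, ?_, ?_⟩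
  · simp only [Pi.mul_apply, mul_pow, Finset.prod_mul_distrib]
    rw [Finset.prod_eq_single a (fun i _ hi => by simp [hi]) (by simp),
      Finset.prod_eq_single b (fun i _ hi => by simp [hi]) (by simp)]
    simp only [Pi.mulSingle_eq_same, inv_pow, ← pow_mul]
    rw [mul_comm (c b), mul_inv_cancel]
  · intro h1
    simp only [Pi.mul_apply, Pi.mulSingle_eq_same, Pi.mulSingle_eq_of_ne hab,
      Pi.mulSingle_eq_of_ne hab.symm, mul_one, one_mul] at h1
    refine hz ?_
    rw [zpow_add, zpow_natCast, zpow_natCast, h1, mul_inv_cancel]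

/-- The centralizer of a maximal split torus is a diagonalized torus. -/
theorem isDiagonalizing [Infinite K] [Nonempty (Fin n)]
    (hS : (slCentralizer K γ).IsMaximalSplitTorus S) :
    IsDiagonalizing γ ((slCentralizer K γ).centralizer S) Y lam := by
  classical
  have : Nonempty (Fin r) := ‹Nonempty (Fin n)›.map part
  obtain ⟨g, c, u, hg, hc, hu⟩ := exists_mul_and_sum_mul_eq_one
    (fun j => Finset.card {i | part i = j}) fun j => by
      obtain ⟨i, hi⟩ := h.surjective j
      exact Finset.card_pos.2 ⟨i, by simpa using hi⟩
  have hcpos : ∀ j, 0 < c j := by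
    intro j
    refine Nat.pos_of_ne_zero fun h0 => ?_
    obtain ⟨i, hi⟩ := h.surjective j
    have h1 := hc j
    rw [h0, zero_mul, Finset.card_eq_zero] at h1
    exact Finset.notMem_empty i (h1 ▸ by simpa using hi)
  -- By maximality `S` contains all block scalar matrices with `∏ t j ^ c j = 1`, hence enough
  -- elements to separate the parts.
  have hmax : (h.blockGroup c).points = S.points :=
    hS.2.2 _ (h.blockGroup_le hc) (h.isSplitTorus_blockGroup hu)
      (h.le_blockGroup hS.1 hS.2.1.1 hg hc)
  refine ⟨fun t => ⟨fun ht => ⟨?_, (mem_slCentralizer.1 ht.1).1⟩, fun ht => ⟨?_, ?_⟩⟩, h.mul_eq,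
    fun σ => ?_⟩
  · intro i k hik
    by_contra hne
    -- An off-diagonal entry inside a part vanishes because `γ` has distinct eigenvalues there;
    -- between different parts it vanishes by commutation with `S`.
    by_cases hpart : part i = part k
    · have h1 : (Y * Matrix.SpecialLinearGroup.mapGL K γ * Y⁻¹).1 = _ :=
        conj_eq_diagonal_of_mul_eq h.mul_eq
      have h2 : (Y * Matrix.SpecialLinearGroup.mapGL K γ * Y⁻¹) * (Y * t * Y⁻¹)
          = (Y * t * Y⁻¹) * (Y * Matrix.SpecialLinearGroup.mapGL K γ * Y⁻¹) := by
        calc _ = Y * (Matrix.SpecialLinearGroup.mapGL K γ * t) * Y⁻¹ := by group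
          _ = Y * (t * Matrix.SpecialLinearGroup.mapGL K γ) * Y⁻¹ := by
            rw [(mem_slCentralizer.1 ht.1).2]
          _ = _ := by group
      have h3 := GL_entry_congr h2 i k
      rw [Units.val_mul, Units.val_mul (Y * t * Y⁻¹), h1, Matrix.mul_diagonal, Matrix.diagonal_mul,
        mul_comm] at h3
      exact hik (h.eq_of_eq i k hpart (mul_left_cancel₀ hne h3))
    · obtain ⟨a, ha, hab⟩ := h.exists_blockTorus_ne hcpos hpart
      have h1 : Y⁻¹ * diagGL (a ∘ part) * Y ∈ S.points := by
        rw [← hmax]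
        exact ⟨a, by group, ha⟩
      have h2 := Subgroup.mem_centralizer_iff.1 ht.2 _ h1
      have h3 : diagGL (a ∘ part) * (Y * t * Y⁻¹) = (Y * t * Y⁻¹) * diagGL (a ∘ part) := by
        calc _ = Y * ((Y⁻¹ * diagGL (a ∘ part) * Y) * t) * Y⁻¹ := by group
          _ = Y * (t * (Y⁻¹ * diagGL (a ∘ part) * Y)) * Y⁻¹ := by rw [h2]
          _ = _ := by group
      have h4 : (Matrix.diagonal (fun i => (a (part i) : K)) * (Y * t * Y⁻¹).1) i k
          = ((Y * t * Y⁻¹).1 * Matrix.diagonal (fun i => (a (part i) : K))) i k :=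
        GL_entry_congr h3 i k
      rw [Matrix.mul_diagonal, Matrix.diagonal_mul, mul_comm] at h4
      exact hab (Units.ext (mul_left_cancel₀ hne h4))
  · exact mem_slCentralizer.2 ⟨ht.2, h.commute_of_conj_eq ht.1.diagonal_diag.symm⟩
  · refine Subgroup.mem_centralizer_iff.2 fun s hs => ?_
    obtain ⟨a, ha⟩ := h.exists_eq s hs
    have h1 : (Y * s * Y⁻¹) * (Y * t * Y⁻¹) = (Y * t * Y⁻¹) * (Y * s * Y⁻¹) := by
      refine Units.ext ?_
      rw [Units.val_mul, Units.val_mul (Y * t * Y⁻¹), ha, ← ht.1.diagonal_diag,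
        Matrix.diagonal_mul_diagonal, Matrix.diagonal_mul_diagonal]
      simp only [mul_comm]
    calc _ = Y⁻¹ * ((Y * s * Y⁻¹) * (Y * t * Y⁻¹)) * Y := by group
      _ = Y⁻¹ * ((Y * t * Y⁻¹) * (Y * s * Y⁻¹)) * Y := by rw [h1]
      _ = _ := by group
  · obtain ⟨π, hπ⟩ := h.exists_perm σ
    exact ⟨π, fun i => (hπ i).1⟩

end IsAdapted

theorem exists_isDiagonalizing [PerfectField F] [IsAlgClosed K] [Nonempty (Fin n)]
    (γ : Matrix.SpecialLinearGroup (Fin n) F)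
    (hγ : Module.End.IsSemisimple (Matrix.toLin' γ.1)) (S : LinAlgGroup F K n)
    (hS : (slCentralizer K γ).IsMaximalSplitTorus S) :
    ∃ Y lam, IsDiagonalizing γ ((slCentralizer K γ).centralizer S) Y lam := by
  have : Infinite K := IsAlgClosed.instInfinite
  obtain ⟨g, hg⟩ := hS.2.1.2
  obtain ⟨Y, lam, r, part, h⟩ := exists_isAdapted γ hγ S hS.1 g hg
  exact ⟨Y, lam, h.isDiagonalizing hS⟩

end MaximalTorus
end

/-! ### The type of an element -/

noncomputable section

section TypeOfElement

open UniqueFactorizationMonoid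

open Classical in
theorem slType_eq_singleton_iff {F : Type*} [Field F] {n : ℕ}
    {γ : Matrix.SpecialLinearGroup (Fin n) F} {a d : ℕ} :
    slType γ = {(a, d)} ↔ ∃ p, (normalizedFactors γ.1.charpoly).toFinset = {p} ∧
      (normalizedFactors γ.1.charpoly).count p = a ∧ p.natDegree = d := by
  rw [slType, Multiset.map_eq_singleton]
  refine exists_congr fun p => ?_
  rw [Prod.mk.injEq, ← Finset.val_inj]
  rfl

open Classical in
theorem count_mul_natDegree {F : Type*} [Field F] {n : ℕ}
    {γ : Matrix.SpecialLinearGroup (Fin n) F} {p : Polynomial F}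
    (hp : (normalizedFactors γ.1.charpoly).toFinset = {p}) :
    (normalizedFactors γ.1.charpoly).count p * p.natDegree = n := by
  have h1 := Multiset.toFinset_sum_count_nsmul_eq (normalizedFactors γ.1.charpoly)
  rw [hp, Finset.sum_singleton] at h1
  have h2 := prod_normalizedFactors_of_monic (Matrix.charpoly_monic γ.1)
  rw [← h1, Multiset.prod_nsmul, Multiset.prod_singleton] at h2
  have h3 := congrArg Polynomial.natDegree h2
  rwa [Polynomial.natDegree_pow, Matrix.charpoly_natDegree_eq_dim, Fintype.card_fin] at h3

end TypeOfElement

end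

theorem mainTheorem9 {F : Type*} [Field F] [Fintype F] {K : Type*} [Field K] [Algebra F K]
    [IsAlgClosure F K] {n : ℕ} (hn : 1 ≤ n) (γ : Matrix.SpecialLinearGroup (Fin n) F)
    (hγ : Module.End.IsSemisimple (Matrix.toLin' γ.1))
    (S₀ : LinAlgGroup F K n) (hS₀ : (slCentralizer K γ).IsMaximalSplitTorus S₀) :
    motiveDet (slCentralizer K γ) S₀ 1 (Fintype.card F : ℂ) ≠ 0 ∧
    (∀ a d : ℕ, slType γ = {(a, d)} →
      motiveDet (slCentralizer K γ) S₀ 1 1 /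
          motiveDet (slCentralizer K γ) S₀ 1 (Fintype.card F : ℂ) =
        d * ((1 - (Fintype.card F : ℂ)) / (1 - (Fintype.card F : ℂ) ^ n))) ∧
    ((¬ ∃ a d : ℕ, slType γ = {(a, d)}) →
      motiveDet (slCentralizer K γ) S₀ 1 1 /
          motiveDet (slCentralizer K γ) S₀ 1 (Fintype.card F : ℂ) = 0) ∧
    (∀ (k : Type*) [Field k] [Algebra F k] [Algebra (RatFunc F) k]
      [IsScalarTower F (RatFunc F) k] [FunctionField F k] (S : Finset (Place F k)),
      2 ≤ S.card → (¬ ∃ a d : ℕ, slType γ = {(a, d)}) →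
        HasModifiedLValue (slCentralizer K γ) S₀ S ∅ 0) := by
  classical
  have : Nonempty (Fin n) := ⟨⟨0, hn⟩⟩
  have : IsAlgClosed K := IsAlgClosure.isAlgClosed F
  have : Infinite K := IsAlgClosed.instInfinite
  obtain ⟨Y, lam, hY⟩ := exists_isDiagonalizing γ hγ S₀ hS₀
  have hq : 1 < Fintype.card F := Fintype.one_lt_card
  set M := UniqueFactorizationMonoid.normalizedFactors γ.1.charpoly with hMdef
  have hM : ∀ p ∈ M, p.Monic ∧ Irreducible p := fun p hp =>
    monic_irreducible_of_mem_normalizedFactors hp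
  have hdet : ∀ p ∈ M, ∀ (m : ℕ) (t : ℂ), motiveDet (slCentralizer K γ) S₀ m t
      = ∏ a ∈ (weightIndex M).erase ⟨p, (0, 0)⟩,
        (1 - t * (Fintype.card F : ℂ) ^ (a.2.1 * m) * weightRoot a ^ m) := fun p hp =>
    motiveDet_eq_prod hY.isYoungAction hY.exists_perm_vec M hM hY.card_lam_eq hp
  obtain ⟨p, hp⟩ : ∃ p, p ∈ M := by
    refine Multiset.exists_mem_of_ne_zero fun h0 => ?_
    have h1 := prod_normalizedFactors_of_monic (Matrix.charpoly_monic γ.1)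
    rw [← hMdef, h0, Multiset.prod_zero] at h1
    have h2 := congrArg Polynomial.natDegree h1
    rw [Matrix.charpoly_natDegree_eq_dim, Fintype.card_fin, Polynomial.natDegree_one] at h2
    omega
  -- A second irreducible factor is what leaves an eigenvalue `1` on the motive after one has been
  -- removed.
  have hother : (¬ ∃ a d : ℕ, slType γ = {(a, d)}) → ∃ p' ∈ M, p' ≠ p := by
    intro h
    by_contra! h'
    refine h ⟨_, _, slType_eq_singleton_iff.2 ⟨p, ?_, rfl, rfl⟩⟩
    refine Finset.eq_singleton_iff_unique_mem.2 ⟨Multiset.mem_toFinset.2 hp, fun p' hp' => ?_⟩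
    exact h' p' (Multiset.mem_toFinset.1 hp')
  refine ⟨?_, fun a d h => ?_, fun h => ?_, fun k _ _ _ _ _ S hS h => ?_⟩
  · rw [hdet p hp]
    exact prod_weight_ne_zero _ (Finset.erase_subset _ _) hq
  · obtain ⟨r, hr, -, rfl⟩ := slType_eq_singleton_iff.1 h
    have hrM : r ∈ M := Multiset.mem_toFinset.1 (hr ▸ Finset.mem_singleton_self r)
    rw [hdet r hrM, hdet r hrM]
    exact prod_weight_div hM hrM hr hq (count_mul_natDegree hr)
  · obtain ⟨p', hp', hne⟩ := hother h
    rw [hdet p hp 1 1, prod_weight_eq_zero hM hp' hne, zero_div]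
  · obtain ⟨p', hp', hne⟩ := hother h
    have : IsOneVariable F k := FunctionField.isOneVariable
    -- The eigenvalue `1` attached to `p'` survives the removal of the one attached to `p`.
    exact hasModifiedLValue_zero _ (Finset.erase_subset _ _) (hdet p hp)
      (Finset.mem_erase.2 ⟨by simpa using hne, mem_weightIndex hM hp'⟩) S hS
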